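/- Fix a vocabulary $\tau$ of relation symbols. For each sort $i\in\mathbb N$ let $\mathrm{Var}(i)$ be a countably infinite set of variables, disjoint for distinct sorts; every tuple $\vec x^{\,i}$ consists of variables of the single sort $i$ and may be empty. For a structure $\mathfrak A$ with nonempty domain $A$, a polyteam is a family $\vec X=(X_i)_{i\in\mathbb N}$ where $X_i$ is a set of assignments $s\colon D_i\to A$ with a common finite domain $D_i\subseteq \mathrm{Var}(i)$. The formulas of $\mathrm{PFO}$ are given by $$\varphi ::= x=y\mid x\neq y\mid R(\vec x)\mid \neg R(\vec x)\mid \varphi\wedge\varphi\mid\varphi\vee\varphi\mid\varphi\vee^j\varphi\mid\exists x\,\varphi\mid\forall x\,\varphi ,$$ where the variables in each atom have one sort, with the lax semantics: a literal on variables of sort $i$ holds in $\vec X$ iff it holds under every $s\in X_i$; $\wedge$ is conjunction; $\vec X\models\psi\vee\theta$ iff $\vec Y\models\psi$ and $\vec Z\models\theta$ for some $\vec Y,\vec Z$ with $Y_i\cup Z_i=X_i$ for all $i$; $\vee^j$ is the same with only $X_j$ split and all other teams unchanged; for $x\in\mathrm{Var}(i)$, $\vec X\models\forall x\,\psi$ iff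 $\psi$ holds after replacing $X_i$ by $\{s(a/x): s\in X_i, a\in A\}$, and $\vec X\models\exists x\,\psi$ iff for some $F\colon X_i\to\mathcal P(A)\setminus\{\emptyset\}$ it holds after replacing $X_i$ by $\{s(a/x): s\in X_i, a\in F(s)\}$. Consider the following atoms, where tuples that are compared have equal lengths: * $\mathrm{pdep}$: $=\!(\vec x^{\,i},\vec y^{\,i}/\vec u^{\,j},\vec v^{\,j})$ holds iff for all $s\in X_i$, $s'\in X_j$, $s(\vec x)=s'(\vec u)$ implies $s(\vec y)=s'(\vec v)$; * $\mathrm{pinc}$: $\vec x^{\,i}\subseteq\vec y^{\,j}$ holds iff for all $s\in X_i$ there is $s'\in X_j$ with $s(\vec x)=s'(\vec y)$; * $\mathrm{pexc}$: $\vec x^{\,i}\mid\vec y^{\,j}$ holds iff $s(\vec x)\ne s'(\vec y)$ for all $s\in X_i$, $s'\in X_j$; * $\mathrm{pind}$: $(\vec y^{\,i}/\vec v^{\,k})\perp_{(\vec x^{\,i},\vec a^{\,j}/\vec u^{\,k})}(\vec b^{\,j}/\vec w^{\,k})$ holds iff for all $s\in X_i$, $s'\in X_j$ with $s(\vec x)=s'(\vec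 a)$ there is $s''\in X_k$ with $s''(\vec u)=s(\vec x)$, $s''(\vec v)=s(\vec y)$, $s''(\vec w)=s'(\vec b)$; * $\mathrm{dep}$, $\mathrm{inc}$, $\mathrm{exc}$, $\mathrm{ind}$: the ordinary single-sort dependence atoms $=\!(\vec x,\vec y)$, inclusion atoms $\vec x\subseteq\vec y$, exclusion atoms $\vec x\mid\vec y$ and conditional independence atoms $\vec y\perp_{\vec x}\vec z$, all of whose variables have one sort $i$, evaluated in $X_i$. $\mathrm{PFO}(\mathcal C)$ is $\mathrm{PFO}$ extended by the atoms of the kinds in $\mathcal C$. Two logics are equivalent, $\mathcal L\equiv\mathcal L'$, over a class of pairs $(\mathfrak A,\vec X)$ if for each formula $\varphi$ of either of them there is a formula $\varphi'$ of the other, with no free variables beyond those of $\varphi$, such that $\mathfrak A\models_{\vec X}\varphi\Leftrightarrow\mathfrak A\models_{\vec X}\varphi'$ for every pair $(\mathfrak A,\vec X)$ in the class such that the domain of $\vec X$ contains the free variables of $\varphi$. (1) $\mathrm{PFO}(\mathrm{pdep})\equiv\mathrm{PFO}(\mathrm{pexc})$ over all pairs $(\mathfrak A,\vec X)$ such that $|A|\ge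 2$ or $X_i\neq\emptyset$ for all $i$. (2) Over all pairs $(\mathfrak A,\vec X)$ such that $X_i\ne\emptyset$ for all $i$, the logic $\mathrm{PFO}(\mathrm{pind})$ is equivalent to each of $\mathrm{PFO}(\mathrm{pexc},\mathrm{inc})$, $\mathrm{PFO}(\mathrm{pinc},\mathrm{exc})$, $\mathrm{PFO}(\mathrm{pdep},\mathrm{inc})$, $\mathrm{PFO}(\mathrm{pinc},\mathrm{dep})$, $\mathrm{PFO}(\mathrm{pdep},\mathrm{ind})$, $\mathrm{PFO}(\mathrm{pexc},\mathrm{ind})$ and $\mathrm{PFO}(\mathrm{pinc},\mathrm{ind})$. -/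

import Mathlib

universe u v w

namespace PolyTeam

/-- A partial assignment of the variables of one sort. The variables of each sort are
`x_0, x_1, …`, represented by natural numbers; `s x = none` means that `x` is not in the
domain of `s`. -/
abbrev Assignment (A : Type w) := ℕ → Option A

/-- A family of sets of assignments, one for each sort `i : ℕ`. -/
abbrev TeamFamily (A : Type w) := ℕ → Set (Assignment A)

/-- A polyteam: for each sort `i`, a team `team i`, that is, a set of assignments with the
common finite domain `dom i`. -/
structure Polyteam (A : Type w) where
  dom : ℕ → Finset ℕ
  team : TeamFamily A
  dom_eq : ∀ i, ∀ s ∈ team i, ∀ x, (s x).isSome ↔ x ∈ dom i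

/-- The assignment `s(a/x)`. -/
def assign {A : Type w} (s : Assignment A) (x : ℕ) (a : A) : Assignment A :=
  Function.update s x (some a)

/-- The team `T[F/x] = {s(a/x) | s ∈ T, a ∈ F s}`. -/
def supplement {A : Type w} (T : Set (Assignment A)) (x : ℕ) (F : Assignment A → Set A) :
    Set (Assignment A) :=
  {t | ∃ s ∈ T, ∃ a ∈ F s, t = assign s x a}

/-- Dependency atoms. The arguments `i j k : ℕ` are sorts, and a function `Fin n → ℕ` is a
(possibly empty) tuple of `n` variables of the sort indicated in the comments. -/
inductive Atom : Type
  /-- The dependence atom `=(x, y)` on sort `i`. -/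
  | dep (i : ℕ) {m n : ℕ} (x : Fin m → ℕ) (y : Fin n → ℕ)
  /-- The inclusion atom `x ⊆ y` on sort `i`. -/
  | inc (i : ℕ) {n : ℕ} (x y : Fin n → ℕ)
  /-- The exclusion atom `x | y` on sort `i`. -/
  | exc (i : ℕ) {n : ℕ} (x y : Fin n → ℕ)
  /-- The conditional independence atom `y ⊥_x z` on sort `i`. -/
  | ind (i : ℕ) {m n l : ℕ} (x : Fin m → ℕ) (y : Fin n → ℕ) (z : Fin l → ℕ)
  /-- The poly-dependence atom `=(xⁱ, yⁱ / uʲ, vʲ)`. -/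
  | pdep (i j : ℕ) {m n : ℕ} (x : Fin m → ℕ) (y : Fin n → ℕ) (a : Fin m → ℕ) (b : Fin n → ℕ)
  /-- The poly-inclusion atom `xⁱ ⊆ yʲ`. -/
  | pinc (i j : ℕ) {n : ℕ} (x y : Fin n → ℕ)
  /-- The poly-exclusion atom `xⁱ | yʲ`. -/
  | pexc (i j : ℕ) {n : ℕ} (x y : Fin n → ℕ)
  /-- The poly-independence atom `(yⁱ / vᵏ) ⊥_(xⁱ, aʲ / uᵏ) (bʲ / wᵏ)`. -/
  | pind (i j k : ℕ) {m n l : ℕ} (x : Fin m → ℕ) (a : Fin m → ℕ) (u : Fin m → ℕ)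
      (y : Fin n → ℕ) (v : Fin n → ℕ) (b : Fin l → ℕ) (w : Fin l → ℕ)

namespace Atom

/-- Satisfaction of an atom; `s ∘ x` is the tuple `s(x)`. -/
def Sat {A : Type w} (X : TeamFamily A) : Atom → Prop
  | dep i x y => ∀ s ∈ X i, ∀ s' ∈ X i, s ∘ x = s' ∘ x → s ∘ y = s' ∘ y
  | inc i x y => ∀ s ∈ X i, ∃ s' ∈ X i, s ∘ x = s' ∘ y
  | exc i x y => ∀ s ∈ X i, ∀ s' ∈ X i, s ∘ x ≠ s' ∘ y
  | ind i x y z => ∀ s ∈ X i, ∀ s' ∈ X i, s ∘ x = s' ∘ x →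
      ∃ s'' ∈ X i, s'' ∘ x = s ∘ x ∧ s'' ∘ y = s ∘ y ∧ s'' ∘ z = s' ∘ z
  | pdep i j x y a b => ∀ s ∈ X i, ∀ s' ∈ X j, s ∘ x = s' ∘ a → s ∘ y = s' ∘ b
  | pinc i j x y => ∀ s ∈ X i, ∃ s' ∈ X j, s ∘ x = s' ∘ y
  | pexc i j x y => ∀ s ∈ X i, ∀ s' ∈ X j, s ∘ x ≠ s' ∘ y
  | pind i j k x a u y v b w => ∀ s ∈ X i, ∀ s' ∈ X j, s ∘ x = s' ∘ a →
      ∃ s'' ∈ X k, s'' ∘ u = s ∘ x ∧ s'' ∘ v = s ∘ y ∧ s'' ∘ w = s' ∘ b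

end Atom

/-- The variables of sort `i` occurring in the tuple `x`, as pairs (sort, variable). -/
def tupleVars (i : ℕ) {n : ℕ} (x : Fin n → ℕ) : Set (ℕ × ℕ) :=
  Set.range fun k => (i, x k)

/-- The variables of an atom. -/
def Atom.vars : Atom → Set (ℕ × ℕ)
  | .dep i x y => tupleVars i x ∪ tupleVars i y
  | .inc i x y => tupleVars i x ∪ tupleVars i y
  | .exc i x y => tupleVars i x ∪ tupleVars i y
  | .ind i x y z => tupleVars i x ∪ tupleVars i y ∪ tupleVars i z
  | .pdep i j x y a b => tupleVars i x ∪ tupleVars i y ∪ tupleVars j a ∪ tupleVars j b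
  | .pinc i j x y => tupleVars i x ∪ tupleVars j y
  | .pexc i j x y => tupleVars i x ∪ tupleVars j y
  | .pind i j k x a u y v b w =>
      tupleVars i x ∪ tupleVars j a ∪ tupleVars k u ∪ tupleVars i y ∪ tupleVars k v ∪
        tupleVars j b ∪ tupleVars k w

/-- The class of all dependence atoms, and so on. -/
def depAtoms : Set Atom := {α | ∃ (i m n : ℕ) (x : Fin m → ℕ) (y : Fin n → ℕ), α = .dep i x y}

def incAtoms : Set Atom := {α | ∃ (i n : ℕ) (x y : Fin n → ℕ), α = .inc i x y}

def excAtoms : Set Atom := {α | ∃ (i n : ℕ) (x y : Fin n → ℕ), α = .exc i x y}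

def indAtoms : Set Atom :=
  {α | ∃ (i m n l : ℕ) (x : Fin m → ℕ) (y : Fin n → ℕ) (z : Fin l → ℕ), α = .ind i x y z}

def pdepAtoms : Set Atom :=
  {α | ∃ (i j m n : ℕ) (x a : Fin m → ℕ) (y b : Fin n → ℕ), α = .pdep i j x y a b}

def pincAtoms : Set Atom := {α | ∃ (i j n : ℕ) (x y : Fin n → ℕ), α = .pinc i j x y}

def pexcAtoms : Set Atom := {α | ∃ (i j n : ℕ) (x y : Fin n → ℕ), α = .pexc i j x y}

def pindAtoms : Set Atom :=
  {α | ∃ (i j k m n l : ℕ) (x a u : Fin m → ℕ) (y v : Fin n → ℕ) (b w : Fin l → ℕ),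
    α = .pind i j k x a u y v b w}

/-- Formulas of poly first-order logic over a vocabulary `L`, extended by dependency atoms.
The first argument `i` (or `j`) is always a sort. -/
inductive Formula (L : FirstOrder.Language.{u, v}) : Type v
  | eq (i x y : ℕ)
  | neq (i x y : ℕ)
  | rel (i : ℕ) {k : ℕ} (R : L.Relations k) (x : Fin k → ℕ)
  | nrel (i : ℕ) {k : ℕ} (R : L.Relations k) (x : Fin k → ℕ)
  | atom (α : Atom)
  | and (φ ψ : Formula L)
  /-- Global disjunction. -/
  | or (φ ψ : Formula L)
  /-- Local disjunction at sort `j`. -/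
  | lor (j : ℕ) (φ ψ : Formula L)
  | ex (i x : ℕ) (φ : Formula L)
  | all (i x : ℕ) (φ : Formula L)

namespace Formula

variable {L : FirstOrder.Language.{u, v}}

/-- Lax polyteam semantics. -/
def Sat {A : Type w} [L.Structure A] : Formula L → TeamFamily A → Prop
  | eq i x y, X => ∀ s ∈ X i, s x = s y
  | neq i x y, X => ∀ s ∈ X i, s x ≠ s y
  | rel i R x, X => ∀ s ∈ X i, ∃ a, s ∘ x = some ∘ a ∧ FirstOrder.Language.Structure.RelMap R a
  | nrel i R x, X => ∀ s ∈ X i, ∃ a, s ∘ x = some ∘ a ∧ ¬ FirstOrder.Language.Structure.RelMap R a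
  | atom α, X => α.Sat X
  | and φ ψ, X => φ.Sat X ∧ ψ.Sat X
  | or φ ψ, X => ∃ Y Z : TeamFamily A, (∀ i, Y i ∪ Z i = X i) ∧ φ.Sat Y ∧ ψ.Sat Z
  | lor j φ ψ, X => ∃ Y Z : Set (Assignment A), Y ∪ Z = X j ∧
      φ.Sat (Function.update X j Y) ∧ ψ.Sat (Function.update X j Z)
  | ex i x φ, X => ∃ F : Assignment A → Set A, (∀ s ∈ X i, (F s).Nonempty) ∧
      φ.Sat (Function.update X i (supplement (X i) x F))
  | all i x φ, X => φ.Sat (Function.update X i (supplement (X i) x fun _ => Set.univ))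

/-- Free variables, as pairs (sort, variable). -/
def free : Formula L → Set (ℕ × ℕ)
  | eq i x y => {(i, x), (i, y)}
  | neq i x y => {(i, x), (i, y)}
  | rel i _ x => tupleVars i x
  | nrel i _ x => tupleVars i x
  | atom α => α.vars
  | and φ ψ => φ.free ∪ ψ.free
  | or φ ψ => φ.free ∪ ψ.free
  | lor _ φ ψ => φ.free ∪ ψ.free
  | ex i x φ => φ.free \ {(i, x)}
  | all i x φ => φ.free \ {(i, x)}

/-- All dependency atoms occurring in the formula belong to `C`. -/
def AtomsIn (C : Set Atom) : Formula L → Prop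
  | eq _ _ _ => True
  | neq _ _ _ => True
  | rel _ _ _ => True
  | nrel _ _ _ => True
  | atom α => α ∈ C
  | and φ ψ => φ.AtomsIn C ∧ ψ.AtomsIn C
  | or φ ψ => φ.AtomsIn C ∧ ψ.AtomsIn C
  | lor _ φ ψ => φ.AtomsIn C ∧ ψ.AtomsIn C
  | ex _ _ φ => φ.AtomsIn C
  | all _ _ φ => φ.AtomsIn C

end Formula

/-- The logic `PFO(C)`, as a set of formulas. -/
def PFO (L : FirstOrder.Language.{u, v}) (C : Set Atom) : Set (Formula L) := {φ | φ.AtomsIn C}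

/-- The domain of a polyteam, as a set of pairs (sort, variable). -/
def Polyteam.domain {A : Type w} (X : Polyteam A) : Set (ℕ × ℕ) := {p | p.2 ∈ X.dom p.1}

/-- A class of pairs (underlying set, polyteam), over which two formulas are compared. -/
abbrev PolyteamClass := (A : Type w) → Polyteam A → Prop

/-- All the teams of the polyteam are nonempty. -/
def nonemptyTeams : PolyteamClass.{w} := fun _ X => ∀ i, (X.team i).Nonempty

/-- The underlying set has at least two elements, or all the teams are nonempty. -/
def nontrivialOrNonemptyTeams : PolyteamClass.{w} :=
  fun A X => Nontrivial A ∨ ∀ i, (X.team i).Nonempty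

/-- `𝓛 ≤ 𝓛'` over the class `K`: every formula of `𝓛` has an equivalent formula of `𝓛'` with no
new free variables, uniformly for all (nonempty) structures and all polyteams in `K` whose domain
contains the free variables. -/
def ExpressibleIn {L : FirstOrder.Language.{u, v}} (K : PolyteamClass.{w}) (𝓛 𝓛' : Set (Formula L)) : Prop :=
  ∀ φ ∈ 𝓛, ∃ φ' ∈ 𝓛', φ'.free ⊆ φ.free ∧
    ∀ (A : Type w) [Nonempty A] [L.Structure A] (X : Polyteam A),
      φ.free ⊆ X.domain → K A X → (φ.Sat X.team ↔ φ'.Sat X.team)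

/-- `𝓛 ≡ 𝓛'` over the class `K`. -/
def EquiExpressive {L : FirstOrder.Language.{u, v}} (K : PolyteamClass.{w}) (𝓛 𝓛' : Set (Formula L)) : Prop :=
  ExpressibleIn K 𝓛 𝓛' ∧ ExpressibleIn K 𝓛' 𝓛

end PolyTeam

open PolyTeam

namespace PolyTeam

/-! Replacing atoms by defining formulas is sound only if these formulas are correct for every
polyteam that a subformula can meet. Two things spoil this: one-element structures, and teams that
become empty when a disjunction splits them. Both are removed first, and then only single atoms
remain to be defined.

One-element structures: all tuples of the same length coincide, so satisfaction depends only on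
which relation symbols hold and which teams are nonempty (`Formula.sat_iff_sat₁`). In both classes
all teams over such a structure are nonempty, so a formula becomes a Boolean condition on finitely
many relation symbols, and a sentence of sort `0` expresses it (`exists_sentence`). A global
disjunction joins this sentence to a translation that is correct for at least two elements
(`expressibleIn_of_nontrivial`).

Empty teams: several definitions of atoms quantify universally in an auxiliary team and say nothing
if it is empty. Therefore teams are never really split. Over at least two elements, existentially
quantified marker variables record to which half of a split an assignment belongs, and the team met
by a subformula is the real, nonempty team restricted to an equality `p = q` of markers
(`definable_split`, `guard_translation`). Each atom must then be defined relative to such a guard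
(`GuardDefinable`). Usually it suffices to define it without guards, assuming at most that the teams
of other sorts are nonempty (`AtomDefinable`): a local disjunction imposes the guard on the sorts of
the atom itself.

Atoms: poly-dependence and poly-exclusion define each other (`definable_pdep`,
`atomDefinable_pexc`). Poly-independence is defined from poly-inclusion and poly-exclusion by
quantifying in a fresh sort (`atomDefinable_pind`). Next to inclusion, poly-exclusion defines
poly-inclusion (`guardDefinable_pinc`). Next to dependence, poly-inclusion defines poly-exclusion
(`atomDefinable_pexc_of_pinc_dep`). Independence defines inclusion (`atomDefinable_inc`) and
dependence. Conversely, the dependence, inclusion and independence atoms, poly or ordinary, are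
instances of poly-independence. Chaining these translations gives all the equivalences. -/

/-- The sorts of an atom. -/
def Atom.sorts : Atom → Finset ℕ
  | .dep i _ _ => {i}
  | .inc i _ _ => {i}
  | .exc i _ _ => {i}
  | .ind i _ _ _ => {i}
  | .pdep i j _ _ _ _ => {i, j}
  | .pinc i j _ _ => {i, j}
  | .pexc i j _ _ => {i, j}
  | .pind i j k _ _ _ _ _ _ _ => {i, j, k}

/-- All assignments obtained from members of `T` by giving arbitrary values to the variables
in `D`. -/
def extend {A : Type w} (T : Set (Assignment A)) (D : List ℕ) : Set (Assignment A) :=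
  {t | ∃ s ∈ T, (∀ v ∉ D, t v = s v) ∧ ∀ v ∈ D, (t v).isSome}

/-- `T'` arises from `T` by giving each member of `T` one or more values at the variables
in `D`. -/
structure IsSupp {A : Type w} (T : Set (Assignment A)) (D : List ℕ) (T' : Set (Assignment A)) :
    Prop where
  sub : T' ⊆ extend T D
  ex : ∀ s ∈ T, ∃ t ∈ T', ∀ v ∉ D, t v = s v

/-- The assignments in `T` satisfying `p = q`. -/
def guardTeam {A : Type w} (p q : ℕ) (T : Set (Assignment A)) : Set (Assignment A) :=
  {s ∈ T | s p = s q}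

/-- Every assignment in `X` is defined on the variables in `V`. -/
def Total {A : Type w} (V : Set (ℕ × ℕ)) (X : TeamFamily A) : Prop :=
  ∀ p ∈ V, ∀ s ∈ X p.1, (s p.2).isSome

/-! ### Teams obtained by blocks of quantifiers -/

section Teams

variable {A : Type w}

theorem extend_nil (T : Set (Assignment A)) : extend T [] = T := by
  ext t
  constructor
  · rintro ⟨s, hs, h, -⟩
    rwa [show t = s from funext fun v => h v (by simp)]
  · intro ht
    exact ⟨t, ht, fun _ _ => rfl, by simp⟩

theorem extend_cons (T : Set (Assignment A)) (x : ℕ) (D : List ℕ) :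
    extend (extend T [x]) D = extend T (x :: D) := by
  ext t
  constructor
  · rintro ⟨s1, ⟨s, hs, h1, h2⟩, h3, h4⟩
    refine ⟨s, hs, fun v hv => ?_, fun v hv => ?_⟩
    · simp only [List.mem_cons, not_or] at hv
      rw [h3 v hv.2, h1 v (by simp [hv.1])]
    · by_cases hD : v ∈ D
      · exact h4 v hD
      · rw [h3 v hD]
        exact h2 v (by simpa [hD] using hv)
  · rintro ⟨s, hs, h1, h2⟩
    refine ⟨fun v => if v = x then t x else s v, ⟨s, hs, fun v hv => ?_, fun v hv => ?_⟩,
      fun v hv => ?_, fun v hv => h2 v (by simp [hv])⟩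
    · simp only [List.mem_singleton] at hv
      simp [hv]
    · simp only [List.mem_singleton] at hv
      simpa [hv] using h2 x (by simp)
    · by_cases hx : v = x
      · simp [hx]
      · simpa [hx] using h1 v (by simp [hx, hv])

theorem supplement_univ (T : Set (Assignment A)) (x : ℕ) :
    supplement T x (fun _ => Set.univ) = extend T [x] := by
  ext t
  constructor
  · rintro ⟨s, hs, a, -, rfl⟩
    refine ⟨s, hs, fun v hv => ?_, fun v hv => ?_⟩
    · simp only [List.mem_singleton] at hv
      simp [assign, hv]
    · simp only [List.mem_singleton] at hv
      simp [assign, hv]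
  · rintro ⟨s, hs, h1, h2⟩
    obtain ⟨a, ha⟩ := Option.isSome_iff_exists.1 (h2 x (by simp))
    refine ⟨s, hs, a, trivial, funext fun v => ?_⟩
    by_cases hx : v = x
    · simp [assign, hx, ha]
    · simpa [assign, hx] using h1 v (by simp [hx])

theorem isSupp_nil {T T' : Set (Assignment A)} : IsSupp T [] T' ↔ T' = T := by
  constructor
  · rintro ⟨h1, h2⟩
    rw [extend_nil] at h1
    refine h1.antisymm fun s hs => ?_
    obtain ⟨t, ht, h⟩ := h2 s hs
    rwa [show s = t from funext fun v => (h v (by simp)).symm]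
  · rintro rfl
    exact ⟨(extend_nil _).ge, fun s hs => ⟨s, hs, fun _ _ => rfl⟩⟩

/-- The intermediate team consists of all one-variable extensions of `T` that some member of `T'`
continues. Together with `extend_cons` this lets a block of quantifiers be handled as one step. -/
theorem isSupp_cons {T T' : Set (Assignment A)} {x : ℕ} {D : List ℕ} :
    IsSupp T (x :: D) T' ↔ ∃ T1, IsSupp T [x] T1 ∧ IsSupp T1 D T' := by
  constructor
  · rintro ⟨h1, h2⟩
    have key : ∀ t ∈ T', ∀ s ∈ T, (∀ v ∉ x :: D, t v = s v) →
        (fun v => if v = x then t x else s v) ∈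
          {t1 ∈ extend T [x] | ∃ t ∈ T', ∀ v ∉ D, t v = t1 v} ∧
        ∀ v ∉ D, t v = (fun v => if v = x then t x else s v) v := by
      intro t ht s hs h
      have h' : ∀ v ∉ D, t v = (fun v => if v = x then t x else s v) v := by
        intro v hv
        by_cases hx : v = x
        · simp [hx]
        · simpa [hx] using h v (by simp [hx, hv])
      refine ⟨⟨⟨s, hs, fun v hv => ?_, fun v hv => ?_⟩, t, ht, h'⟩, h'⟩
      · simp only [List.mem_singleton] at hv
        simp [hv]
      · simp only [List.mem_singleton] at hv
        obtain ⟨_, _, _, h4⟩ := h1 ht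
        simpa [hv] using h4 x (by simp)
    refine ⟨{t1 ∈ extend T [x] | ∃ t ∈ T', ∀ v ∉ D, t v = t1 v}, ⟨fun t ht => ht.1, ?_⟩, ?_, ?_⟩
    · intro s hs
      obtain ⟨t, ht, h⟩ := h2 s hs
      refine ⟨_, (key t ht s hs h).1, fun v hv => ?_⟩
      simp only [List.mem_singleton] at hv
      simp [hv]
    · intro t ht
      obtain ⟨s, hs, h3, h4⟩ := h1 ht
      exact ⟨_, (key t ht s hs h3).1, (key t ht s hs h3).2, fun v hv => h4 v (by simp [hv])⟩
    · rintro t1 ⟨-, t, ht, h⟩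
      exact ⟨t, ht, h⟩
  · rintro ⟨T1, ⟨h1, h2⟩, h3, h4⟩
    refine ⟨?_, fun s hs => ?_⟩
    · rw [← extend_cons]
      intro t ht
      obtain ⟨s, hs, h5, h6⟩ := h3 ht
      exact ⟨s, h1 hs, h5, h6⟩
    · obtain ⟨t1, ht1, h5⟩ := h2 s hs
      obtain ⟨t, ht, h6⟩ := h4 t1 ht1
      refine ⟨t, ht, fun v hv => ?_⟩
      simp only [List.mem_cons, not_or] at hv
      rw [h6 v hv.2, h5 v (by simp [hv.1])]

theorem IsSupp.nonempty {T T' : Set (Assignment A)} {D : List ℕ} (h : IsSupp T D T')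
    (hT : T.Nonempty) : T'.Nonempty := by
  obtain ⟨s, hs⟩ := hT
  obtain ⟨t, ht, -⟩ := h.ex s hs
  exact ⟨t, ht⟩

theorem extend_empty (D : List ℕ) : extend (∅ : Set (Assignment A)) D = ∅ := by
  ext; simp [extend]

theorem extend_nonempty [Nonempty A] {T : Set (Assignment A)} (hT : T.Nonempty) (D : List ℕ) :
    (extend T D).Nonempty := by
  classical
  obtain ⟨s, hs⟩ := hT
  refine ⟨fun v => if v ∈ D then some (Classical.arbitrary A) else s v, s, hs, ?_, ?_⟩
  · intro v hv
    simp [hv]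
  · intro v hv
    simp [hv]

end Teams

/-! ### Quantifiers as team operations, bounds for sorts and variables, locality -/

namespace Formula

variable {L : FirstOrder.Language.{u, v}} {A : Type w} [L.Structure A]

theorem sat_all (i x : ℕ) (φ : Formula L) (X : TeamFamily A) :
    (all i x φ).Sat X ↔ φ.Sat (Function.update X i (extend (X i) [x])) := by
  rw [Sat, supplement_univ]

/-- A choice function is recovered from a supplemented team `T` by `F s = {a | s(a/x) ∈ T}`. Members
of the team that differ only at `x` then receive the same values, which the lax semantics permits.
-/
theorem sat_ex (i x : ℕ) (φ : Formula L) (X : TeamFamily A) :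
    (ex i x φ).Sat X ↔ ∃ T, IsSupp (X i) [x] T ∧ φ.Sat (Function.update X i T) := by
  rw [Sat]
  constructor
  · rintro ⟨F, hF, h⟩
    refine ⟨_, ⟨?_, ?_⟩, h⟩
    · rw [← supplement_univ]
      rintro t ⟨s, hs, a, -, rfl⟩
      exact ⟨s, hs, a, trivial, rfl⟩
    · intro s hs
      obtain ⟨a, ha⟩ := hF s hs
      refine ⟨assign s x a, ⟨s, hs, a, ha, rfl⟩, fun v hv => ?_⟩
      simp only [List.mem_singleton] at hv
      simp [assign, hv]
  · rintro ⟨T, ⟨h1, h2⟩, h⟩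
    rw [← supplement_univ] at h1
    refine ⟨fun s => {a | assign s x a ∈ T}, fun s hs => ?_, ?_⟩
    · obtain ⟨t, ht, h3⟩ := h2 s hs
      obtain ⟨s', hs', a, -, rfl⟩ := h1 ht
      refine ⟨a, ?_⟩
      rw [Set.mem_ofPred_eq, show assign s x a = assign s' x a from ?_]
      · exact ht
      · funext v
        by_cases hv : v = x
        · simp [assign, hv]
        · simpa [assign, hv] using (h3 v (by simp [hv])).symm
    · convert h using 2
      ext t
      constructor
      · rintro ⟨s, hs, a, ha, rfl⟩
        exact ha
      · intro ht
        obtain ⟨s, hs, a, -, rfl⟩ := h1 ht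
        exact ⟨s, hs, a, ht, rfl⟩

/-- Sorts and variables of the formula are smaller than `B`. -/
def BoundedBy (B : ℕ) : Formula L → Prop
  | eq i x y => i < B ∧ x < B ∧ y < B
  | neq i x y => i < B ∧ x < B ∧ y < B
  | rel i _ x => i < B ∧ ∀ k, x k < B
  | nrel i _ x => i < B ∧ ∀ k, x k < B
  | atom α => (∀ i ∈ α.sorts, i < B) ∧ ∀ p ∈ α.vars, p.2 < B
  | and φ ψ => φ.BoundedBy B ∧ ψ.BoundedBy B
  | or φ ψ => φ.BoundedBy B ∧ ψ.BoundedBy B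
  | lor j φ ψ => j < B ∧ φ.BoundedBy B ∧ ψ.BoundedBy B
  | ex i x φ => i < B ∧ x < B ∧ φ.BoundedBy B
  | all i x φ => i < B ∧ x < B ∧ φ.BoundedBy B

end Formula
theorem mem_tupleVars {i n : ℕ} {x : Fin n → ℕ} {p : ℕ × ℕ} :
    p ∈ tupleVars i x ↔ ∃ k, (i, x k) = p := Iff.rfl

theorem mem_tupleVars_self (i : ℕ) {n : ℕ} (x : Fin n → ℕ) (k : Fin n) :
    (i, x k) ∈ tupleVars i x := ⟨k, rfl⟩

theorem tupleVars_finite (i : ℕ) {n : ℕ} (x : Fin n → ℕ) : (tupleVars i x).Finite :=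
  Set.finite_range _

theorem Atom.vars_finite (α : Atom) : α.vars.Finite := by
  cases α <;> simp [Atom.vars, tupleVars_finite]

theorem Atom.fst_mem_sorts {α : Atom} {p : ℕ × ℕ} (hp : p ∈ α.vars) : p.1 ∈ α.sorts := by
  cases α <;> simp only [Atom.vars, Set.mem_union, mem_tupleVars] at hp <;> simp only [Atom.sorts]
  all_goals aesop

theorem Atom.sat_congr_sorts {A : Type w} {α : Atom} {X Y : TeamFamily A}
    (h : ∀ i ∈ α.sorts, X i = Y i) : α.Sat X ↔ α.Sat Y := by
  cases α <;> simp only [Atom.sorts, Finset.mem_insert, Finset.mem_singleton, forall_eq_or_imp,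
    forall_eq] at h <;> simp [Atom.Sat, h]

namespace Formula

variable {L : FirstOrder.Language.{u, v}}

theorem BoundedBy.mono {φ : Formula L} {B B' : ℕ} (h : φ.BoundedBy B) (hB : B ≤ B') :
    φ.BoundedBy B' := by
  induction φ with
  | eq | neq => exact ⟨h.1.trans_le hB, h.2.1.trans_le hB, h.2.2.trans_le hB⟩
  | rel | nrel => exact ⟨h.1.trans_le hB, fun k => (h.2 k).trans_le hB⟩
  | atom => exact ⟨fun i hi => (h.1 i hi).trans_le hB, fun p hp => (h.2 p hp).trans_le hB⟩
  | and _ _ h1 h2 | or _ _ h1 h2 => exact ⟨h1 h.1, h2 h.2⟩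
  | lor _ _ _ h1 h2 => exact ⟨h.1.trans_le hB, h1 h.2.1, h2 h.2.2⟩
  | ex _ _ _ h1 | all _ _ _ h1 => exact ⟨h.1.trans_le hB, h.2.1.trans_le hB, h1 h.2.2⟩

theorem exists_boundedBy (φ : Formula L) : ∃ B, φ.BoundedBy B := by
  induction φ with
  | eq i x y | neq i x y =>
    exact ⟨i + x + y + 1, by omega, by omega, by omega⟩
  | rel i R x | nrel i R x =>
    obtain ⟨N, hN⟩ := (Set.finite_range x).bddAbove
    refine ⟨i + N + 1, by omega, fun k => ?_⟩
    have := hN ⟨k, rfl⟩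
    omega
  | atom α =>
    obtain ⟨N, hN⟩ := (α.vars_finite.image Prod.snd).bddAbove
    obtain ⟨M, hM⟩ := α.sorts.bddAbove
    refine ⟨M + N + 1, fun i hi => ?_, fun p hp => ?_⟩
    · have := hM hi
      omega
    · have := hN ⟨p, hp, rfl⟩
      omega
  | and _ _ h1 h2 | or _ _ h1 h2 =>
    obtain ⟨B1, h1⟩ := h1
    obtain ⟨B2, h2⟩ := h2
    exact ⟨B1 + B2, h1.mono (by omega), h2.mono (by omega)⟩
  | lor j _ _ h1 h2 =>
    obtain ⟨B1, h1⟩ := h1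
    obtain ⟨B2, h2⟩ := h2
    exact ⟨B1 + B2 + j + 1, by omega, h1.mono (by omega), h2.mono (by omega)⟩
  | ex i x _ h1 | all i x _ h1 =>
    obtain ⟨B1, h1⟩ := h1
    exact ⟨B1 + i + x + 1, by omega, by omega, h1.mono (by omega)⟩

theorem AtomsIn.mono {φ : Formula L} {C C' : Set Atom} (h : φ.AtomsIn C) (hC : C ⊆ C') :
    φ.AtomsIn C' := by
  induction φ with
  | eq | neq | rel | nrel => trivial
  | atom => exact hC h
  | and _ _ h1 h2 | or _ _ h1 h2 | lor _ _ _ h1 h2 => exact ⟨h1 h.1, h2 h.2⟩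
  | ex _ _ _ h1 | all _ _ _ h1 => exact h1 h

theorem BoundedBy.free {φ : Formula L} {B : ℕ} (h : φ.BoundedBy B) :
    ∀ p ∈ φ.free, p.1 < B ∧ p.2 < B := by
  induction φ with
  | eq i x y | neq i x y =>
    obtain ⟨h1, h2, h3⟩ := h
    rintro p (rfl | rfl)
    exacts [⟨h1, h2⟩, ⟨h1, h3⟩]
  | rel i R x | nrel i R x =>
    rintro p ⟨k, rfl⟩
    exact ⟨h.1, h.2 k⟩
  | atom α => exact fun p hp => ⟨h.1 _ (Atom.fst_mem_sorts hp), h.2 p hp⟩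
  | and _ _ h1 h2 | or _ _ h1 h2 =>
    rintro p (hp | hp)
    exacts [h1 h.1 p hp, h2 h.2 p hp]
  | lor _ _ _ h1 h2 =>
    rintro p (hp | hp)
    exacts [h1 h.2.1 p hp, h2 h.2.2 p hp]
  | ex _ _ _ h1 | all _ _ _ h1 => exact fun p hp => h1 h.2.2 p hp.1

variable {A : Type w} [L.Structure A]

theorem sat_congr_sorts {φ : Formula L} {B : ℕ} (hB : φ.BoundedBy B) {X Y : TeamFamily A}
    (h : ∀ i < B, X i = Y i) : φ.Sat X ↔ φ.Sat Y := by
  have upd : ∀ {X Y : TeamFamily A}, (∀ i < B, X i = Y i) → ∀ (i : ℕ) (T : Set (Assignment A)),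
      ∀ k < B, Function.update X i T k = Function.update Y i T k := by
    intro X Y h i T k hk
    by_cases hki : k = i
    · subst hki
      simp
    · simp [hki, h k hk]
  induction φ generalizing X Y with
  | eq i | neq i | rel i | nrel i => simp [Sat, h i hB.1]
  | atom α => exact Atom.sat_congr_sorts fun i hi => h i (hB.1 i hi)
  | and _ _ h1 h2 => exact and_congr (h1 hB.1 h) (h2 hB.2 h)
  | or φ ψ h1 h2 =>
    have key : ∀ {X Y : TeamFamily A}, (∀ i < B, X i = Y i) →
        (or φ ψ).Sat X → (or φ ψ).Sat Y := by
      rintro X Y h ⟨Z, W, h3, h4, h5⟩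
      -- Sorts from `B` on are invisible to both disjuncts, so each half may keep the whole team
      -- there.
      refine ⟨fun i => if i < B then Z i else Y i, fun i => if i < B then W i else Y i,
        fun i => ?_, (h1 hB.1 ?_).1 h4, (h2 hB.2 ?_).1 h5⟩
      · by_cases hi : i < B
        · simp [hi, h3, h i hi]
        · simp [hi]
      · intro i hi
        simp [hi]
      · intro i hi
        simp [hi]
    exact ⟨key h, key fun i hi => (h i hi).symm⟩
  | lor j _ _ h1 h2 =>
    simp only [Sat, h j hB.1]
    exact exists_congr fun Z => exists_congr fun W => and_congr_right fun _ =>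
      and_congr (h1 hB.2.1 (upd h _ _)) (h2 hB.2.2 (upd h _ _))
  | ex i x _ h1 =>
    simp only [Sat, h i hB.1]
    exact exists_congr fun Z => and_congr_right fun _ => h1 hB.2.2 (upd h _ _)
  | all i x _ h1 =>
    simp only [Sat, h i hB.1]
    exact h1 hB.2.2 (upd h _ _)

/-- The empty team property: an unwanted disjunct is discharged by giving it nothing. -/
theorem sat_empty (φ : Formula L) : φ.Sat (fun _ => (∅ : Set (Assignment A))) := by
  have upd : ∀ i, Function.update (fun _ => (∅ : Set (Assignment A))) i ∅ = fun _ => ∅ :=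
    fun i => Function.update_eq_self (β := fun _ : ℕ => Set (Assignment A)) i (fun _ => ∅)
  induction φ with
  | eq | neq | rel | nrel => simp [Sat]
  | atom α => cases α <;> simp [Sat, Atom.Sat]
  | and _ _ h1 h2 => exact ⟨h1, h2⟩
  | or _ _ h1 h2 => exact ⟨_, _, fun i => Set.union_self _, h1, h2⟩
  | lor j _ _ h1 h2 => exact ⟨∅, ∅, Set.union_self _, by rwa [upd], by rwa [upd]⟩
  | ex i x _ h1 =>
    rw [sat_ex]
    refine ⟨∅, ⟨by simp, by simp⟩, by rwa [upd]⟩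
  | all i x _ h1 => rwa [sat_all, extend_empty, upd]

end Formula

/-! ### One-element structures -/

/-- Satisfaction of an atom over a one-element set, in terms of the set of sorts whose team is
nonempty. -/
def Atom.Sat₁ (E : Set ℕ) : Atom → Prop
  | .dep _ _ _ => True
  | .inc _ _ _ => True
  | .exc i _ _ => i ∉ E
  | .ind _ _ _ _ => True
  | .pdep _ _ _ _ _ _ => True
  | .pinc i j _ _ => i ∈ E → j ∈ E
  | .pexc i j _ _ => i ∈ E → j ∉ E
  | .pind i j k _ _ _ _ _ _ _ => i ∈ E → j ∈ E → k ∈ E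

/-- Satisfaction over a one-element structure, in terms of the truth values of the relation
symbols and the set of sorts whose team is nonempty. -/
def Formula.Sat₁ {L : FirstOrder.Language.{u, v}} (t : (Σ k, L.Relations k) → Prop) :
    Formula L → Set ℕ → Prop
  | .eq _ _ _, _ => True
  | .neq i _ _, E => i ∉ E
  | @Formula.rel _ i k R _, E => i ∈ E → t ⟨k, R⟩
  | @Formula.nrel _ i k R _, E => i ∈ E → ¬ t ⟨k, R⟩
  | .atom α, E => α.Sat₁ E
  | .and φ ψ, E => φ.Sat₁ t E ∧ ψ.Sat₁ t E
  | .or φ ψ, E => ∃ Y Z, Y ∪ Z = E ∧ φ.Sat₁ t Y ∧ ψ.Sat₁ t Z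
  | .lor j φ ψ, E => ∃ Y Z, Y ∪ Z = E ∧ Y \ {j} = E \ {j} ∧ Z \ {j} = E \ {j} ∧
      φ.Sat₁ t Y ∧ ψ.Sat₁ t Z
  | .ex _ _ φ, E => φ.Sat₁ t E
  | .all _ _ φ, E => φ.Sat₁ t E

/-- The vocabulary may be infinite, but a formula mentions only finitely many symbols. This makes
the case distinction in `exists_sentence` finite. -/
theorem Formula.exists_finset_sat₁_congr {L : FirstOrder.Language.{u, v}} (φ : Formula L) :
    ∃ F : Finset (Σ k, L.Relations k), ∀ t t' : (Σ k, L.Relations k) → Prop,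
      (∀ R ∈ F, t R ↔ t' R) → ∀ E, φ.Sat₁ t E ↔ φ.Sat₁ t' E := by
  classical
  induction φ with
  | eq | neq | atom => exact ⟨∅, fun _ _ _ _ => Iff.rfl⟩
  | @rel i k R x | @nrel i k R x => exact ⟨{⟨k, R⟩}, fun t t' h E => by simp [Sat₁, h ⟨k, R⟩]⟩
  | and _ _ h1 h2 | or _ _ h1 h2 | lor j _ _ h1 h2 =>
    obtain ⟨F1, h1⟩ := h1
    obtain ⟨F2, h2⟩ := h2
    refine ⟨F1 ∪ F2, fun t t' h E => ?_⟩
    simp only [Sat₁, h1 t t' fun R hR => h R (by simp [hR]), h2 t t' fun R hR => h R (by simp [hR])]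
  | ex _ _ _ h1 | all _ _ _ h1 => exact h1

/-- The sorts whose team is nonempty. -/
def support {A : Type w} (X : TeamFamily A) : Set ℕ := {i | (X i).Nonempty}

section Subsingleton

variable {A : Type w} [Subsingleton A]

theorem comp_eq_comp {n : ℕ} {s s' : Assignment A} {x y : Fin n → ℕ}
    (h : ∀ k, (s (x k)).isSome) (h' : ∀ k, (s' (y k)).isSome) : s ∘ x = s' ∘ y := by
  funext k
  obtain ⟨a, ha⟩ := Option.isSome_iff_exists.1 (h k)
  obtain ⟨b, hb⟩ := Option.isSome_iff_exists.1 (h' k)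
  simp [ha, hb, Subsingleton.elim a b]

theorem Total.comp_eq_comp {V : Set (ℕ × ℕ)} {X : TeamFamily A} (hX : Total V X) {i j n : ℕ}
    {x y : Fin n → ℕ} (hx : tupleVars i x ⊆ V) (hy : tupleVars j y ⊆ V) {s s' : Assignment A}
    (hs : s ∈ X i) (hs' : s' ∈ X j) : s ∘ x = s' ∘ y :=
  PolyTeam.comp_eq_comp (fun k => hX _ (hx (mem_tupleVars_self i x k)) s hs)
    (fun k => hX _ (hy (mem_tupleVars_self j y k)) s' hs')

/-- Defined tuples of equal length always agree, so equalities of values are automatic and only the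
existence of assignments matters. -/
theorem Atom.sat_iff_sat₁ {α : Atom} {X : TeamFamily A} (hX : Total α.vars X) :
    α.Sat X ↔ α.Sat₁ (support X) := by
  cases α with
  | dep i x y =>
    simp only [Sat, Sat₁, iff_true]
    exact fun s hs s' hs' _ => hX.comp_eq_comp (by simp [vars]) (by simp [vars]) hs hs'
  | inc i x y =>
    simp only [Sat, Sat₁, iff_true]
    exact fun s hs => ⟨s, hs, hX.comp_eq_comp (by simp [vars]) (by simp [vars]) hs hs⟩
  | ind i x y z =>
    simp only [Sat, Sat₁, iff_true]
    exact fun s hs s' hs' _ => ⟨s, hs, rfl, rfl,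
      hX.comp_eq_comp (by simp [vars]) (by simp [vars]) hs hs'⟩
  | pdep i j x y a b =>
    simp only [Sat, Sat₁, iff_true]
    exact fun s hs s' hs' _ => hX.comp_eq_comp (i := i) (j := j)
      (by simp [vars, Set.subset_def]; tauto) (by simp [vars, Set.subset_def]; tauto) hs hs'
  | exc i x y =>
    constructor
    · rintro h ⟨s, hs⟩
      exact h s hs s hs (hX.comp_eq_comp (by simp [vars]) (by simp [vars]) hs hs)
    · exact fun h s hs => (h ⟨s, hs⟩).elim
  | pexc i j x y =>
    constructor
    · rintro h ⟨s, hs⟩ ⟨s', hs'⟩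
      exact h s hs s' hs' (hX.comp_eq_comp (by simp [vars]) (by simp [vars]) hs hs')
    · exact fun h s hs s' hs' => (h ⟨s, hs⟩ ⟨s', hs'⟩).elim
  | pinc i j x y =>
    constructor
    · rintro h ⟨s, hs⟩
      obtain ⟨s', hs', -⟩ := h s hs
      exact ⟨s', hs'⟩
    · intro h s hs
      obtain ⟨s', hs'⟩ := h ⟨s, hs⟩
      exact ⟨s', hs', hX.comp_eq_comp (by simp [vars]) (by simp [vars]) hs hs'⟩
  | pind i j k x a u y v b w =>
    constructor
    · rintro h ⟨s, hs⟩ ⟨s', hs'⟩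
      obtain ⟨s'', hs'', -⟩ := h s hs s' hs' (hX.comp_eq_comp (i := i) (j := j)
        (by simp [vars, Set.subset_def]; tauto) (by simp [vars, Set.subset_def]; tauto) hs hs')
      exact ⟨s'', hs''⟩
    · intro h s hs s' hs' _
      obtain ⟨s'', hs''⟩ := h ⟨s, hs⟩ ⟨s', hs'⟩
      refine ⟨s'', hs'', hX.comp_eq_comp (i := k) (j := i) ?_ ?_ hs'' hs,
        hX.comp_eq_comp (i := k) (j := i) ?_ ?_ hs'' hs,
        hX.comp_eq_comp (i := k) (j := j) ?_ ?_ hs'' hs'⟩ <;>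
      · simp [vars, Set.subset_def]
        try tauto

end Subsingleton

/-- The truth values of the relation symbols at constant tuples. -/
def truthValues (L : FirstOrder.Language.{u, v}) (A : Type w) [L.Structure A]
    (R : Σ k, L.Relations k) : Prop :=
  ∃ a : Fin R.1 → A, FirstOrder.Language.Structure.RelMap R.2 a

theorem Total.mono {A : Type w} {V V' : Set (ℕ × ℕ)} {X : TeamFamily A} (h : Total V X)
    (hV : V' ⊆ V) : Total V' X := fun p hp => h p (hV hp)

theorem Total.update {A : Type w} {V : Set (ℕ × ℕ)} {X : TeamFamily A} (h : Total V X) {i : ℕ}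
    {T : Set (Assignment A)} (hT : ∀ v, (i, v) ∈ V → ∀ s ∈ T, (s v).isSome) :
    Total V (Function.update X i T) := by
  rintro ⟨j, v⟩ hp s hs
  by_cases hj : j = i
  · subst hj
    exact hT v hp s (by simpa using hs)
  · exact h _ hp s (by simpa [hj] using hs)

theorem Total.extend {A : Type w} {V V' : Set (ℕ × ℕ)} {X : TeamFamily A} (h : Total V X) {i : ℕ}
    {D : List ℕ} {T : Set (Assignment A)} (hT : T ⊆ extend (X i) D)
    (hV : ∀ p ∈ V', p ∈ V ∨ p.1 = i ∧ p.2 ∈ D) : Total V' (Function.update X i T) := by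
  rintro ⟨j, v⟩ hp s hs
  by_cases hj : j = i
  · subst hj
    obtain ⟨t, ht, h1, h2⟩ := hT (by simpa using hs : s ∈ T)
    by_cases hD : v ∈ D
    · exact h2 v hD
    · rw [h1 v hD]
      exact h _ ((hV _ hp).resolve_right (by simp [hD])) t ht
  · exact h _ ((hV _ hp).resolve_right (by simp [hj])) s (by simpa [hj] using hs)

theorem support_update_of_nonempty {A : Type w} {X : TeamFamily A} {i : ℕ} {T : Set (Assignment A)}
    (h : T.Nonempty ↔ (X i).Nonempty) : support (Function.update X i T) = support X := by
  ext j
  by_cases hj : j = i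
  · subst hj
    simp [support, h]
  · simp [support, hj]

section Subsingleton

variable {A : Type w} [Subsingleton A]

theorem Formula.sat_iff_sat₁ {L : FirstOrder.Language.{u, v}} [L.Structure A] [Nonempty A]
    {φ : Formula L} {X : TeamFamily A} (hX : Total φ.free X) :
    φ.Sat X ↔ φ.Sat₁ (truthValues L A) (support X) := by
  classical
  have supp : ∀ (i : ℕ) (D : List ℕ) (T T' : Set (Assignment A)), IsSupp T D T' →
      (T'.Nonempty ↔ T.Nonempty) := by
    refine fun i D T T' h => ⟨fun ⟨t, ht⟩ => ?_, h.nonempty⟩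
    obtain ⟨s, hs, -⟩ := h.sub ht
    exact ⟨s, hs⟩
  have tuple : ∀ {i k : ℕ} {x : Fin k → ℕ} {X : TeamFamily A}, Total (tupleVars i x) X →
      ∀ s ∈ X i, ∃ a : Fin k → A, s ∘ x = some ∘ a := by
    intro i k x X hX s hs
    have h : ∀ j, ∃ a, s (x j) = some a := fun j =>
      Option.isSome_iff_exists.1 (hX (i, x j) (mem_tupleVars_self i x j) s hs)
    choose a ha using h
    exact ⟨a, funext ha⟩
  induction φ generalizing X with
  | eq i x y =>
    simp only [Sat, Sat₁, iff_true]
    intro s hs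
    obtain ⟨a, ha⟩ := Option.isSome_iff_exists.1 (hX (i, x) (by simp [free]) s hs)
    obtain ⟨b, hb⟩ := Option.isSome_iff_exists.1 (hX (i, y) (by simp [free]) s hs)
    rw [ha, hb, Subsingleton.elim a b]
  | neq i x y =>
    simp only [Sat, Sat₁]
    constructor
    · rintro h ⟨s, hs⟩
      refine h s hs ?_
      obtain ⟨a, ha⟩ := Option.isSome_iff_exists.1 (hX (i, x) (by simp [free]) s hs)
      obtain ⟨b, hb⟩ := Option.isSome_iff_exists.1 (hX (i, y) (by simp [free]) s hs)
      rw [ha, hb, Subsingleton.elim a b]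
    · exact fun h s hs => (h ⟨s, hs⟩).elim
  | rel i R x =>
    constructor
    · rintro h ⟨s, hs⟩
      obtain ⟨a, -, ha⟩ := h s hs
      exact ⟨a, ha⟩
    · intro h s hs
      obtain ⟨a, ha⟩ := h ⟨s, hs⟩
      obtain ⟨b, hb⟩ := tuple hX s hs
      exact ⟨b, hb, by rwa [Subsingleton.elim b a]⟩
  | nrel i R x =>
    constructor
    · rintro h ⟨s, hs⟩ ⟨a, ha⟩
      obtain ⟨b, -, hb⟩ := h s hs
      rw [Subsingleton.elim b a] at hb
      exact hb ha
    · intro h s hs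
      obtain ⟨b, hb⟩ := tuple hX s hs
      exact ⟨b, hb, fun h' => h ⟨s, hs⟩ ⟨b, h'⟩⟩
  | atom α => exact Atom.sat_iff_sat₁ hX
  | and φ ψ h1 h2 =>
    exact and_congr (h1 (hX.mono Set.subset_union_left)) (h2 (hX.mono Set.subset_union_right))
  | or φ ψ h1 h2 =>
    constructor
    · rintro ⟨Y, Z, h, hY, hZ⟩
      have tY : Total φ.free Y := fun p hp s hs => hX p (.inl hp) s (h p.1 ▸ .inl hs)
      have tZ : Total ψ.free Z := fun p hp s hs => hX p (.inr hp) s (h p.1 ▸ .inr hs)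
      refine ⟨support Y, support Z, ?_, (h1 tY).1 hY, (h2 tZ).1 hZ⟩
      ext i
      simp [support, ← h i]
    · rintro ⟨E, E', h, hE, hE'⟩
      -- A split of the support is realized by giving each half, in every sort, either the whole
      -- team or the empty one.
      have key : ∀ E ⊆ support X, support (fun i => if i ∈ E then X i else ∅) = E := by
        intro E hE
        ext i
        by_cases hi : i ∈ E
        · simpa [support, hi] using hE hi
        · simp [support, hi]
      refine ⟨fun i => if i ∈ E then X i else ∅, fun i => if i ∈ E' then X i else ∅,
        fun i => ?_, (h1 ?_).2 ?_, (h2 ?_).2 ?_⟩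
      · have := Set.ext_iff.1 h i
        by_cases hi : i ∈ E
        · by_cases hi' : i ∈ E' <;> simp [hi, hi']
        · by_cases hi' : i ∈ E'
          · simp [hi, hi']
          · simp only [hi, hi', if_false, Set.union_self]
            have h3 : i ∉ support X := by
              rw [← h]
              simp [hi, hi']
            exact (Set.not_nonempty_iff_eq_empty.1 h3).symm
      · intro p hp s hs
        refine hX p (.inl hp) s ?_
        dsimp only at hs
        split_ifs at hs
        exacts [hs, hs.elim]
      · rwa [key E (h ▸ Set.subset_union_left)]
      · intro p hp s hs
        refine hX p (.inr hp) s ?_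
        dsimp only at hs
        split_ifs at hs
        exacts [hs, hs.elim]
      · rwa [key E' (h ▸ Set.subset_union_right)]
  | lor j φ ψ h1 h2 =>
    have tot : ∀ {V : Set (ℕ × ℕ)}, V ⊆ (lor j φ ψ).free → ∀ {T}, T ⊆ X j →
        Total V (Function.update X j T) := fun hV T hT =>
      (hX.mono hV).update fun v hv s hs => hX (j, v) (hV hv) s (hT hs)
    have off : ∀ T, support (Function.update X j T) \ {j} = support X \ {j} := by
      intro T
      ext i
      simp only [support, Set.mem_sdiff, Set.mem_ofPred_eq, Set.mem_singleton_iff]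
      refine and_congr_left fun hi => ?_
      simp [hi]
    constructor
    · rintro ⟨Y, Z, h, hY, hZ⟩
      refine ⟨_, _, ?_, off Y, off Z, (h1 (tot Set.subset_union_left ?_)).1 hY,
        (h2 (tot Set.subset_union_right ?_)).1 hZ⟩
      · ext i
        by_cases hi : i = j
        · subst hi
          simp [support, ← h]
        · simp [support, hi]
      · exact h ▸ Set.subset_union_left
      · exact h ▸ Set.subset_union_right
    · rintro ⟨E, E', h, hE1, hE1', hE, hE'⟩
      have key : ∀ E ⊆ support X, E \ {j} = support X \ {j} →
          support (Function.update X j (if j ∈ E then X j else ∅)) = E := by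
        intro E hE hE1
        ext i
        by_cases hi : i = j
        · subst hi
          by_cases hi : i ∈ E
          · simpa [support, hi] using hE hi
          · simp [support, hi]
        · have := Set.ext_iff.1 hE1 i
          simp only [Set.mem_sdiff, Set.mem_singleton_iff, hi, not_false_eq_true, and_true] at this
          rw [this]
          simp [support, hi]
      have sub : ∀ E : Set ℕ, (if j ∈ E then X j else ∅) ⊆ X j := by
        intro E
        split_ifs <;> simp
      refine ⟨if j ∈ E then X j else ∅, if j ∈ E' then X j else ∅, ?_,
        (h1 (tot Set.subset_union_left (sub E))).2 ?_,
        (h2 (tot Set.subset_union_right (sub E'))).2 ?_⟩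
      · by_cases hi : j ∈ E
        · by_cases hi' : j ∈ E' <;> simp [hi, hi']
        · by_cases hi' : j ∈ E'
          · simp [hi, hi']
          · simp only [hi, hi', if_false, Set.union_self]
            have h3 : j ∉ support X := by
              rw [← h]
              simp [hi, hi']
            exact (Set.not_nonempty_iff_eq_empty.1 h3).symm
      · rwa [key E (h ▸ Set.subset_union_left) hE1]
      · rwa [key E' (h ▸ Set.subset_union_right) hE1']
  | ex i x φ h1 =>
    have hV : ∀ p ∈ φ.free, p ∈ (ex i x φ).free ∨ p.1 = i ∧ p.2 ∈ [x] := by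
      rintro ⟨j, v⟩ hp
      by_cases h : j = i ∧ v = x
      · exact .inr (by simpa using h)
      · exact .inl ⟨hp, by simpa using h⟩
    rw [sat_ex]
    constructor
    · rintro ⟨T, hT, h⟩
      have := (h1 (hX.extend hT.sub hV)).1 h
      rwa [support_update_of_nonempty (supp i _ _ _ hT)] at this
    · intro h
      have hT : IsSupp (X i) [x] (extend (X i) [x]) := by
        refine ⟨subset_rfl, fun s hs => ?_⟩
        rw [← supplement_univ]
        exact ⟨assign s x (Classical.arbitrary A), ⟨s, hs, _, trivial, rfl⟩,
          fun v hv => by simp [assign, show v ≠ x by simpa using hv]⟩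
      refine ⟨_, hT, (h1 (hX.extend hT.sub hV)).2 ?_⟩
      rwa [support_update_of_nonempty (supp i _ _ _ hT)]
  | all i x φ h1 =>
    have hV : ∀ p ∈ φ.free, p ∈ (all i x φ).free ∨ p.1 = i ∧ p.2 ∈ [x] := by
      rintro ⟨j, v⟩ hp
      by_cases h : j = i ∧ v = x
      · exact .inr (by simpa using h)
      · exact .inl ⟨hp, by simpa using h⟩
    refine (sat_all i x φ X).trans ((h1 (hX.extend subset_rfl hV)).trans ?_)
    rw [support_update_of_nonempty]
    · rfl
    · refine ⟨fun ⟨t, s, hs, _⟩ => ⟨s, hs⟩, fun h => extend_nonempty h _⟩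

end Subsingleton

/-- Every property of the truth values of finitely many relation symbols is expressed over
one-element structures by a first-order sentence of sort `0`. -/
theorem exists_sentence {L : FirstOrder.Language.{u, v}} (F : Finset (Σ k, L.Relations k))
    (P : ((Σ k, L.Relations k) → Prop) → Prop)
    (hP : ∀ t t', (∀ R ∈ F, t R ↔ t' R) → (P t ↔ P t')) :
    ∃ χ : Formula L, χ.AtomsIn ∅ ∧ χ.free = ∅ ∧ ∀ (A : Type w) [Nonempty A] [Subsingleton A]
      [L.Structure A] (X : TeamFamily A), χ.Sat X ↔ ((X 0).Nonempty → P (truthValues L A)) := by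
  classical
  induction F using Finset.induction_on generalizing P with
  | empty =>
    by_cases h : P fun _ => True
    · refine ⟨.all 0 0 (.eq 0 0 0), trivial, by simp [Formula.free], fun A _ _ _ X => ?_⟩
      simp [Formula.Sat, (hP (truthValues L A) (fun _ => True) (by simp)).2 h]
    · refine ⟨.all 0 0 (.neq 0 0 0), trivial, by simp [Formula.free], fun A _ _ _ X => ?_⟩
      simp only [Formula.sat_iff_sat₁ (φ := .all 0 0 (.neq 0 0 0)) (X := X)
        (by simp [Total, Formula.free]), Formula.Sat₁, mt (hP (truthValues L A) (fun _ => True)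
        (by simp)).1 h, imp_false]
      rfl
  | insert R F hR ih =>
    -- Case distinction on `R`: fixing its truth value leaves a condition on the remaining symbols.
    obtain ⟨χ₁, a₁, f₁, h₁⟩ := ih (fun t => P (Function.update t R True)) fun t t' h => hP _ _ (by
      intro S hS
      by_cases hSR : S = R
      · simp [hSR]
      · simpa [hSR] using h S (by simpa [hSR] using hS))
    obtain ⟨χ₂, a₂, f₂, h₂⟩ := ih (fun t => P (Function.update t R False)) fun t t' h => hP _ _ (by
      intro S hS
      by_cases hSR : S = R
      · simp [hSR]
      · simpa [hSR] using h S (by simpa [hSR] using hS))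
    -- The split selects the case. A nonempty half confirms the truth value of `R` that it assumes;
    -- if both halves are empty, nothing is claimed. The quantifier binds the variable of the
    -- constant tuple, so a sentence results.
    refine ⟨.lor 0 (.and (.all 0 0 (.rel 0 R.2 fun _ => 0)) χ₁)
      (.and (.all 0 0 (.nrel 0 R.2 fun _ => 0)) χ₂), ⟨⟨trivial, a₁⟩, trivial, a₂⟩, ?_,
      fun A _ _ _ X => ?_⟩
    · simp only [Formula.free, f₁, f₂, Set.union_empty, Set.union_empty_iff]
      refine ⟨?_, ?_⟩ <;>
      · rw [Set.sdiff_eq_empty]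
        rintro _ ⟨k, rfl⟩
        rfl
    · have hpos : ∀ X : TeamFamily A, (Formula.all 0 0 (.rel 0 R.2 fun _ => 0)).Sat X ↔
          ((X 0).Nonempty → truthValues L A R) := fun X => by
        rw [Formula.sat_iff_sat₁ (fun p hp => absurd hp (by
          simp only [Formula.free]
          rintro ⟨⟨k, rfl⟩, h⟩
          exact h rfl))]
        rfl
      have hneg : ∀ X : TeamFamily A, (Formula.all 0 0 (.nrel 0 R.2 fun _ => 0)).Sat X ↔
          ((X 0).Nonempty → ¬ truthValues L A R) := fun X => by
        rw [Formula.sat_iff_sat₁ (fun p hp => absurd hp (by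
          simp only [Formula.free]
          rintro ⟨⟨k, rfl⟩, h⟩
          exact h rfl))]
        rfl
      have upd : P (truthValues L A) ↔
          P (Function.update (truthValues L A) R (truthValues L A R)) := by
        rw [Function.update_eq_self]
      simp only [Formula.Sat.eq_8, Formula.Sat.eq_6, h₁, h₂, hpos, hneg, Function.update_self]
      rw [upd]
      constructor
      · rintro ⟨Y, Z, h, ⟨h3, h4⟩, h5, h6⟩ hX
        rw [← h, Set.union_nonempty] at hX
        rcases hX with hY | hZ
        · simpa [h3 hY] using h4 hY
        · simpa [h5 hZ] using h6 hZ
      · intro h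
        by_cases hR : truthValues L A R
        · exact ⟨X 0, ∅, Set.union_empty _, ⟨fun _ => hR, fun h' => by simpa [hR] using h h'⟩,
            fun h => (Set.not_nonempty_empty h).elim, fun h => (Set.not_nonempty_empty h).elim⟩
        · exact ⟨∅, X 0, Set.empty_union _, ⟨fun h => (Set.not_nonempty_empty h).elim,
            fun h => (Set.not_nonempty_empty h).elim⟩, fun _ => hR,
            fun h' => by simpa [hR] using h h'⟩

/-! ### Separating one-element structures from the others -/

namespace Formula

/-- Every team of sort below `B` is empty, or the structure has one element. -/
def trivialDomain (L : FirstOrder.Language.{u, v}) : ℕ → Formula L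
  | 0 => all 0 0 (eq 0 0 0)
  | B + 1 => and (trivialDomain L B) (all B 0 (all B 1 (eq B 0 1)))

/-- Every team of sort below `B` is empty, or the structure has at least two elements. -/
def nontrivialDomain (L : FirstOrder.Language.{u, v}) : ℕ → Formula L
  | 0 => all 0 0 (eq 0 0 0)
  | B + 1 => and (nontrivialDomain L B) (ex B 0 (ex B 1 (neq B 0 1)))

variable {L : FirstOrder.Language.{u, v}}

theorem trivialDomain_atomsIn (C : Set Atom) (B : ℕ) : (trivialDomain L B).AtomsIn C := by
  induction B with
  | zero => trivial
  | succ B ih => exact ⟨ih, trivial⟩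

theorem nontrivialDomain_atomsIn (C : Set Atom) (B : ℕ) : (nontrivialDomain L B).AtomsIn C := by
  induction B with
  | zero => trivial
  | succ B ih => exact ⟨ih, trivial⟩

theorem trivialDomain_free (B : ℕ) : (trivialDomain L B).free = ∅ := by
  induction B with
  | zero => simp [trivialDomain, free]
  | succ B ih =>
    simp only [trivialDomain, free, ih, Set.empty_union, Set.sdiff_eq_empty]
    rintro p ⟨rfl | rfl, h⟩
    · rfl
    · exact (h rfl).elim

theorem nontrivialDomain_free (B : ℕ) : (nontrivialDomain L B).free = ∅ := by
  induction B with
  | zero => simp [nontrivialDomain, free]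
  | succ B ih =>
    simp only [nontrivialDomain, free, ih, Set.empty_union, Set.sdiff_eq_empty]
    rintro p ⟨rfl | rfl, h⟩
    · rfl
    · exact (h rfl).elim

variable {A : Type w} [L.Structure A]

omit [L.Structure A] in
theorem total_of_free_eq_empty {φ : Formula L} (h : φ.free = ∅) (X : TeamFamily A) :
    Total φ.free X := by
  simp [Total, h]

theorem sat_trivialDomain [Nonempty A] [Subsingleton A] (B : ℕ) (X : TeamFamily A) :
    (trivialDomain L B).Sat X := by
  rw [sat_iff_sat₁ (total_of_free_eq_empty (trivialDomain_free B) X)]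
  induction B with
  | zero => trivial
  | succ B ih => exact ⟨ih, trivial⟩

theorem eq_empty_of_nontrivialDomain [Nonempty A] [Subsingleton A] {B : ℕ} {X : TeamFamily A}
    (h : (nontrivialDomain L B).Sat X) : ∀ i < B, X i = ∅ := by
  rw [sat_iff_sat₁ (total_of_free_eq_empty (nontrivialDomain_free B) X)] at h
  induction B with
  | zero => simp
  | succ B ih =>
    intro i hi
    rcases Nat.lt_succ_iff_lt_or_eq.1 hi with hi | rfl
    · exact ih h.1 i hi
    · exact Set.not_nonempty_iff_eq_empty.1 h.2

theorem eq_empty_of_trivialDomain [Nontrivial A] {B : ℕ} {X : TeamFamily A}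
    (h : (trivialDomain L B).Sat X) : ∀ i < B, X i = ∅ := by
  induction B with
  | zero => simp
  | succ B ih =>
    intro i hi
    rcases Nat.lt_succ_iff_lt_or_eq.1 hi with hi | rfl
    · exact ih h.1 i hi
    · obtain ⟨-, h⟩ := h
      simp only [sat_all, Function.update_self, Function.update_idem, extend_cons] at h
      simp only [Sat, Function.update_self] at h
      rw [Set.eq_empty_iff_forall_notMem]
      intro s hs
      obtain ⟨a, b, hab⟩ := exists_pair_ne A
      refine hab (Option.some_injective _ (h (Function.update (Function.update s 0 (some a)) 1
        (some b)) ⟨s, hs, fun v hv => ?_, fun v hv => ?_⟩))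
      · simp only [List.mem_cons, List.not_mem_nil, or_false, not_or] at hv
        simp [hv]
      · simp only [List.mem_cons, List.not_mem_nil, or_false] at hv
        rcases hv with rfl | rfl <;> simp

theorem sat_nontrivialDomain [Nontrivial A] (B : ℕ) (X : TeamFamily A) :
    (nontrivialDomain L B).Sat X := by
  induction B with
  | zero => simp [nontrivialDomain, Sat]
  | succ B ih =>
    refine ⟨ih, ?_⟩
    obtain ⟨a, b, hab⟩ := exists_pair_ne A
    simp only [sat_ex, Function.update_self, Function.update_idem]
    simp only [Sat, Function.update_self]
    refine ⟨{t | ∃ s ∈ X B, t = Function.update s 0 (some a)}, ⟨?_, ?_⟩,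
      {t | ∃ s ∈ X B, t = Function.update (Function.update s 0 (some a)) 1 (some b)}, ⟨?_, ?_⟩, ?_⟩
    · rintro _ ⟨s, hs, rfl⟩
      exact ⟨s, hs, fun v hv => by simp [show v ≠ 0 by simpa using hv],
        fun v hv => by simp [show v = 0 by simpa using hv]⟩
    · exact fun s hs => ⟨_, ⟨s, hs, rfl⟩, fun v hv => by simp [show v ≠ 0 by simpa using hv]⟩
    · rintro _ ⟨s, hs, rfl⟩
      exact ⟨_, ⟨s, hs, rfl⟩, fun v hv => by simp [show v ≠ 1 by simpa using hv],
        fun v hv => by simp [show v = 1 by simpa using hv]⟩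
    · rintro _ ⟨s, hs, rfl⟩
      exact ⟨_, ⟨s, hs, rfl⟩, fun v hv => by simp [show v ≠ 1 by simpa using hv]⟩
    · rintro _ ⟨s, hs, rfl⟩
      simpa using hab

end Formula

theorem Polyteam.total {A : Type w} (X : Polyteam A) {V : Set (ℕ × ℕ)} (h : V ⊆ X.domain) :
    Total V X.team :=
  fun p hp s hs => (X.dom_eq p.1 s hs p.2).2 (h hp)

/-- It suffices to translate formulas over structures with at least two elements. -/
theorem expressibleIn_of_nontrivial {L : FirstOrder.Language.{u, v}} {K : PolyteamClass.{w}}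
    {C C' : Set Atom}
    (hK : ∀ (A : Type w) [Subsingleton A] (X : Polyteam A), K A X → ∀ i, (X.team i).Nonempty)
    (h : ∀ φ : Formula L, φ.AtomsIn C → ∃ φ' : Formula L, φ'.AtomsIn C' ∧ φ'.free ⊆ φ.free ∧
      ∀ (A : Type w) [Nontrivial A] [L.Structure A] (X : Polyteam A), φ.free ⊆ X.domain → K A X →
        (φ.Sat X.team ↔ φ'.Sat X.team)) :
    ExpressibleIn K (PFO L C) (PFO L C') := by
  intro φ hφ
  obtain ⟨φ', hφ', hfree, h'⟩ := h φ hφ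
  obtain ⟨F, hF⟩ := φ.exists_finset_sat₁_congr
  -- The support is `Set.univ`, since over one-element structures `K` admits only polyteams without
  -- empty teams.
  obtain ⟨χ, hχ, χfree, h₁⟩ := exists_sentence.{u, v, w} F (fun t => φ.Sat₁ t Set.univ)
    fun t t' ht => hF t t' ht _
  obtain ⟨B, hB⟩ := φ'.exists_boundedBy
  obtain ⟨B', hB'⟩ := χ.exists_boundedBy
  -- The disjunct that contradicts the size of the structure can receive only empty teams in the
  -- sorts below the bound, so the other one receives these teams entirely. The `+ 1` ensures that
  -- sort `0`, in which `χ` speaks, is among them.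
  refine ⟨.or (.and (Formula.trivialDomain L (B + B' + 1)) χ)
    (.and (Formula.nontrivialDomain L (B + B' + 1)) φ'),
    ⟨⟨Formula.trivialDomain_atomsIn _ _, hχ.mono (Set.empty_subset _)⟩,
      Formula.nontrivialDomain_atomsIn _ _, hφ'⟩, ?_, fun A _ _ X hX hKX => ?_⟩
  · simpa [Formula.free, Formula.trivialDomain_free, Formula.nontrivialDomain_free, χfree]
  rcases subsingleton_or_nontrivial A with hA | hA
  · have hne := hK A X hKX
    rw [Formula.sat_iff_sat₁ (X.total hX), show support X.team = Set.univ from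
      Set.eq_univ_of_forall hne]
    constructor
    · intro hs
      exact ⟨X.team, fun _ => ∅, fun i => Set.union_empty _, ⟨Formula.sat_trivialDomain _ _,
        (h₁ A _).2 fun _ => hs⟩, Formula.sat_empty _, Formula.sat_empty _⟩
    · rintro ⟨Y, Z, hYZ, ⟨-, hY⟩, hZ, -⟩
      refine (h₁ A Y).1 hY ?_
      have h0 := Formula.eq_empty_of_nontrivialDomain hZ 0 (by omega)
      have := hYZ 0
      rw [h0, Set.union_empty] at this
      rw [this]
      exact hne 0
  · rw [h' A X hX hKX]
    constructor
    · intro hs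
      exact ⟨fun _ => ∅, X.team, fun i => Set.empty_union _, ⟨Formula.sat_empty _,
        Formula.sat_empty _⟩, Formula.sat_nontrivialDomain _ _, hs⟩
    · rintro ⟨Y, Z, hYZ, ⟨hY, -⟩, -, hZ⟩
      have h0 := Formula.eq_empty_of_trivialDomain hY
      refine (Formula.sat_congr_sorts hB fun i hi => ?_).1 hZ
      rw [← hYZ, h0 i (by omega), Set.empty_union]

/-! ### Definability over structures with at least two elements -/

/-- Over structures with at least two elements, the property `P` of families of teams is
expressed by a formula with atoms in `C` and free variables in `V`. -/
def Definable (L : FirstOrder.Language.{u, v}) (C : Set Atom) (V : Set (ℕ × ℕ))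
    (P : ∀ (A : Type w) [L.Structure A], TeamFamily A → Prop) : Prop :=
  ∃ φ : Formula L, φ.AtomsIn C ∧ φ.free ⊆ V ∧
    ∀ (A : Type w) [Nontrivial A] [L.Structure A] (X : TeamFamily A), φ.Sat X ↔ P A X

namespace Definable

variable {L : FirstOrder.Language.{u, v}} {C : Set Atom} {V V' : Set (ℕ × ℕ)}
  {P Q : ∀ (A : Type w) [L.Structure A], TeamFamily A → Prop}

theorem congr (h : Definable L C V P)
    (hPQ : ∀ (A : Type w) [Nontrivial A] [L.Structure A] (X : TeamFamily A), P A X ↔ Q A X) :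
    Definable L C V Q := by
  obtain ⟨φ, h1, h2, h3⟩ := h
  exact ⟨φ, h1, h2, fun A _ _ X => (h3 A X).trans (hPQ A X)⟩

theorem mono (h : Definable L C V P) (hV : V ⊆ V') : Definable L C V' P := by
  obtain ⟨φ, h1, h2, h3⟩ := h
  exact ⟨φ, h1, h2.trans hV, h3⟩

theorem of_formula {φ : Formula L} (h : φ.AtomsIn C) (hV : φ.free ⊆ V) :
    Definable.{u, v, w} L C V fun _ _ X => φ.Sat X :=
  ⟨φ, h, hV, fun _ _ _ _ => Iff.rfl⟩

theorem atom {α : Atom} (h : α ∈ C) (hV : α.vars ⊆ V) :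
    Definable.{u, v, w} L C V fun _ _ X => α.Sat X :=
  ⟨.atom α, h, hV, fun _ _ _ _ => Iff.rfl⟩

theorem eq {i x y : ℕ} (hx : (i, x) ∈ V) (hy : (i, y) ∈ V) :
    Definable.{u, v, w} L C V fun _ _ X => ∀ s ∈ X i, s x = s y :=
  ⟨.eq i x y, trivial, by simp [Formula.free, Set.insert_subset_iff, hx, hy],
    fun _ _ _ _ => Iff.rfl⟩

theorem neq {i x y : ℕ} (hx : (i, x) ∈ V) (hy : (i, y) ∈ V) :
    Definable.{u, v, w} L C V fun _ _ X => ∀ s ∈ X i, s x ≠ s y :=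
  ⟨.neq i x y, trivial, by simp [Formula.free, Set.insert_subset_iff, hx, hy],
    fun _ _ _ _ => Iff.rfl⟩

theorem true (i : ℕ) : Definable.{u, v, w} L C V fun _ _ X => ∀ s ∈ X i, True :=
  ⟨.all i 0 (.eq i 0 0), trivial, by simp [Formula.free], fun _ _ _ _ => by simp [Formula.Sat]⟩

theorem false (i : ℕ) : Definable.{u, v, w} L C V fun _ _ X => ∀ s ∈ X i, False := by
  refine ⟨.all i 0 (.neq i 0 0), trivial, by simp [Formula.free], fun A _ _ X => ?_⟩
  simp only [Formula.sat_all]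
  simp only [Formula.Sat, Function.update_self]
  constructor
  · intro h s hs
    obtain ⟨t, ht⟩ := extend_nonempty ⟨s, hs⟩ [0]
    exact h t ht rfl
  · rintro h _ ⟨s, hs, -⟩
    exact (h s hs).elim

theorem and (hP : Definable L C V P) (hQ : Definable L C V Q) :
    Definable L C V fun A _ X => P A X ∧ Q A X := by
  obtain ⟨φ, h1, h2, h3⟩ := hP
  obtain ⟨ψ, h4, h5, h6⟩ := hQ
  exact ⟨.and φ ψ, ⟨h1, h4⟩, Set.union_subset h2 h5, fun A _ _ X =>
    and_congr (h3 A X) (h6 A X)⟩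

theorem lor (j : ℕ) (hP : Definable L C V P) (hQ : Definable L C V Q) :
    Definable L C V fun A _ X => ∃ Y Z : Set (Assignment A), Y ∪ Z = X j ∧
      P A (Function.update X j Y) ∧ Q A (Function.update X j Z) := by
  obtain ⟨φ, h1, h2, h3⟩ := hP
  obtain ⟨ψ, h4, h5, h6⟩ := hQ
  exact ⟨.lor j φ ψ, ⟨h1, h4⟩, Set.union_subset h2 h5, fun A _ _ X =>
    exists_congr fun Y => exists_congr fun Z => and_congr_right fun _ =>
      and_congr (h3 A _) (h6 A _)⟩

/-- For conditions on single assignments, a local split is ordinary disjunction: each assignment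
goes to a half whose condition it satisfies. -/
theorem lor_flat (j : ℕ) {p q : ∀ (A : Type w) [L.Structure A], Assignment A → Prop}
    (hP : Definable L C V fun A _ X => ∀ s ∈ X j, p A s)
    (hQ : Definable L C V fun A _ X => ∀ s ∈ X j, q A s) :
    Definable L C V fun A _ X => ∀ s ∈ X j, p A s ∨ q A s := by
  refine (hP.lor j hQ).congr fun A _ _ X => ?_
  simp only [Function.update_self]
  constructor
  · rintro ⟨Y, Z, h, hY, hZ⟩ s hs
    rcases h.symm ▸ hs with hs | hs
    exacts [.inl (hY s hs), .inr (hZ s hs)]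
  · intro h
    refine ⟨{s ∈ X j | p A s}, {s ∈ X j | q A s}, ?_, fun s hs => hs.2, fun s hs => hs.2⟩
    ext s
    constructor
    · rintro (hs | hs)
      exacts [hs.1, hs.1]
    · exact fun hs => (h s hs).imp (fun h => ⟨hs, h⟩) fun h => ⟨hs, h⟩

theorem and_flat (j : ℕ) {p q : ∀ (A : Type w) [L.Structure A], Assignment A → Prop}
    (hP : Definable L C V fun A _ X => ∀ s ∈ X j, p A s)
    (hQ : Definable L C V fun A _ X => ∀ s ∈ X j, q A s) :
    Definable L C V fun A _ X => ∀ s ∈ X j, p A s ∧ q A s :=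
  (hP.and hQ).congr fun _ _ _ _ =>
    ⟨fun h s hs => ⟨h.1 s hs, h.2 s hs⟩, fun h => ⟨fun s hs => (h s hs).1, fun s hs => (h s hs).2⟩⟩

theorem eqTuple {i n : ℕ} {x y : Fin n → ℕ} (hx : tupleVars i x ⊆ V) (hy : tupleVars i y ⊆ V) :
    Definable.{u, v, w} L C V fun _ _ X => ∀ s ∈ X i, s ∘ x = s ∘ y := by
  induction n with
  | zero => exact (true i).congr fun A _ _ X => by simp [funext_iff]
  | succ n ih =>
    refine ((eq (hx ⟨0, rfl⟩) (hy ⟨0, rfl⟩)).and_flat i (ih (x := x ∘ Fin.succ)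
      (y := y ∘ Fin.succ) ?_ ?_)).congr fun A _ _ X => ?_
    · rintro _ ⟨k, rfl⟩
      exact hx ⟨k.succ, rfl⟩
    · rintro _ ⟨k, rfl⟩
      exact hy ⟨k.succ, rfl⟩
    · simp [funext_iff, Fin.forall_fin_succ]

theorem neTuple {i n : ℕ} {x y : Fin n → ℕ} (hx : tupleVars i x ⊆ V) (hy : tupleVars i y ⊆ V) :
    Definable.{u, v, w} L C V fun _ _ X => ∀ s ∈ X i, s ∘ x ≠ s ∘ y := by
  induction n with
  | zero => exact (false i).congr fun A _ _ X => by simp [funext_iff]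
  | succ n ih =>
    refine ((neq (hx ⟨0, rfl⟩) (hy ⟨0, rfl⟩)).lor_flat i (ih (x := x ∘ Fin.succ)
      (y := y ∘ Fin.succ) ?_ ?_)).congr fun A _ _ X => ?_
    · rintro _ ⟨k, rfl⟩
      exact hx ⟨k.succ, rfl⟩
    · rintro _ ⟨k, rfl⟩
      exact hy ⟨k.succ, rfl⟩
    · simp [funext_iff, Fin.exists_fin_succ, or_iff_not_imp_left]

theorem all (i : ℕ) (D : List ℕ) (h : Definable L C (V ∪ {p | p.1 = i ∧ p.2 ∈ D}) P) :
    Definable L C V fun A _ X => P A (Function.update X i (extend (X i) D)) := by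
  induction D generalizing V P with
  | nil =>
    refine (h.mono (by simp)).congr fun A _ _ X => ?_
    rw [extend_nil, Function.update_eq_self]
  | cons x D ih =>
    obtain ⟨φ, h1, h2, h3⟩ := ih (V := V ∪ {(i, x)}) (h.mono (by
      rintro ⟨j, v⟩ hp
      simp only [Set.mem_union, Set.mem_ofPred_eq, List.mem_cons, Set.mem_singleton_iff,
        Prod.mk.injEq] at hp ⊢
      tauto))
    refine ⟨.all i x φ, h1, ?_, fun A _ _ X => ?_⟩
    · rintro p ⟨hp, hp'⟩
      exact (h2 hp).resolve_right hp'
    · simp only [Formula.sat_all, h3, Function.update_self, Function.update_idem, extend_cons]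

theorem ex (i : ℕ) (D : List ℕ) (h : Definable L C (V ∪ {p | p.1 = i ∧ p.2 ∈ D}) P) :
    Definable L C V fun A _ X => ∃ T, IsSupp (X i) D T ∧ P A (Function.update X i T) := by
  induction D generalizing V P with
  | nil =>
    refine (h.mono (by simp)).congr fun A _ _ X => ?_
    simp only [isSupp_nil, exists_eq_left, Function.update_eq_self]
  | cons x D ih =>
    obtain ⟨φ, h1, h2, h3⟩ := ih (V := V ∪ {(i, x)}) (h.mono (by
      rintro ⟨j, v⟩ hp
      simp only [Set.mem_union, Set.mem_ofPred_eq, List.mem_cons, Set.mem_singleton_iff,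
        Prod.mk.injEq] at hp ⊢
      tauto))
    refine ⟨.ex i x φ, h1, ?_, fun A _ _ X => ?_⟩
    · rintro p ⟨hp, hp'⟩
      exact (h2 hp).resolve_right hp'
    · simp only [Formula.sat_ex, h3, Function.update_self, Function.update_idem,
        isSupp_cons (x := x) (D := D)]
      constructor
      · rintro ⟨T1, hT1, T, hT, h⟩
        exact ⟨T, ⟨T1, hT1, hT⟩, h⟩
      · rintro ⟨T, ⟨T1, hT1, hT⟩, h⟩
        exact ⟨T1, hT1, T, hT, h⟩

theorem forall_mem (S : Finset ℕ) {P : ℕ → ∀ (A : Type w) [L.Structure A], TeamFamily A → Prop}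
    (h : ∀ i ∈ S, Definable L C V (P i)) : Definable L C V fun A _ X => ∀ i ∈ S, P i A X := by
  classical
  induction S using Finset.induction_on with
  | empty => exact (true 0).congr fun A _ _ X => by simp
  | insert i S hi ih =>
    exact ((h i (by simp)).and (ih fun j hj => h j (by simp [hj]))).congr fun A _ _ X => by simp

/-- Markers for a global disjunction must be chosen in several sorts before the matrix is evaluated,
hence a quantifier block over a finite set of sorts. -/
theorem exSorts (S : Finset ℕ) (D : List ℕ)
    (h : Definable L C (V ∪ {p | p.1 ∈ S ∧ p.2 ∈ D}) P) :
    Definable L C V fun A _ X => ∃ X' : TeamFamily A, (∀ i ∈ S, IsSupp (X i) D (X' i)) ∧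
      (∀ i ∉ S, X' i = X i) ∧ P A X' := by
  classical
  induction S using Finset.induction_on generalizing V P with
  | empty =>
    refine (h.mono (by simp)).congr fun A _ _ X => ⟨fun h => ⟨X, by simp, by simp, h⟩, ?_⟩
    rintro ⟨X', -, h1, h2⟩
    rwa [show X = X' from funext fun i => (h1 i (by simp)).symm]
  | insert i S hi ih =>
    refine (ex i D (ih (V := V ∪ {p | p.1 = i ∧ p.2 ∈ D}) (h.mono ?_))).congr fun A _ _ X => ?_
    · rintro ⟨j, v⟩ hp
      simp only [Set.mem_union, Set.mem_ofPred_eq, Finset.mem_insert] at hp ⊢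
      tauto
    · constructor
      · rintro ⟨T, hT, X', h1, h2, h3⟩
        refine ⟨X', fun j hj => ?_, fun j hj => ?_, h3⟩
        · by_cases hji : j = i
          · subst hji
            rw [h2 j hi]
            simpa using hT
          · have := h1 j (by simpa [hji] using hj)
            simpa [hji] using this
        · simp only [Finset.mem_insert, not_or] at hj
          rw [h2 j hj.2]
          simp [hj.1]
      · rintro ⟨X', h1, h2, h3⟩
        refine ⟨X' i, h1 i (by simp), X', fun j hj => ?_, fun j hj => ?_, h3⟩
        · have hji : j ≠ i := fun h => hi (h ▸ hj)
          simpa [hji] using h1 j (by simp [hj])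
        · by_cases hji : j = i
          · subst hji
            simp
          · simpa [hji] using h2 j (by simp [hji, hj])

/-- Restriction of the teams of the sorts in `S` to the assignments with `p = q`. -/
theorem guard (S : Finset ℕ) {p q : ℕ → ℕ} (hp : ∀ i ∈ S, (i, p i) ∈ V ∧ (i, q i) ∈ V)
    (h : Definable L C V P) : Definable L C V fun A _ X =>
      P A fun i => if i ∈ S then guardTeam (p i) (q i) (X i) else X i := by
  classical
  induction S using Finset.induction_on generalizing P with
  | empty => simpa using h
  | insert i S hi ih =>
    -- In `p ≠ q ∨ (p = q ∧ φ)` the split is forced: the right half is exactly the set of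
    -- assignments with `p = q`.
    refine ((neq (hp i (by simp)).1 (hp i (by simp)).2).lor i
      ((eq (hp i (by simp)).1 (hp i (by simp)).2).and
        (ih (fun j hj => hp j (by simp [hj])) h))).congr fun A _ _ X => ?_
    have key : (fun j => if j ∈ S then guardTeam (p j) (q j)
        (Function.update X i (guardTeam (p i) (q i) (X i)) j) else
        Function.update X i (guardTeam (p i) (q i) (X i)) j) =
        fun j => if j ∈ insert i S then guardTeam (p j) (q j) (X j) else X j := by
      funext j
      by_cases hj : j = i
      · subst hj
        simp [hi]
      · simp [hj]
    constructor
    · rintro ⟨Y, Z, h1, h2, h3, h4⟩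
      simp only [Function.update_self] at h2 h3
      rw [← key]
      convert h4 using 1
      have : guardTeam (p i) (q i) (X i) = Z := by
        ext s
        rw [guardTeam, ← h1]
        constructor
        · rintro ⟨hs | hs, h⟩
          exacts [(h2 s hs h).elim, hs]
        · exact fun hs => ⟨.inr hs, h3 s hs⟩
      rw [this]
    · intro h
      refine ⟨{s ∈ X i | s (p i) ≠ s (q i)}, guardTeam (p i) (q i) (X i), ?_, ?_, ?_, ?_⟩
      · ext s
        simp only [guardTeam, Set.mem_union, Set.mem_ofPred_eq]
        tauto
      · simp
      · simp [guardTeam]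
      · rwa [key]

end Definable

/-! ### Guarded teams and the elimination of splits -/

/-- The guard variables of the sorts below `B`. -/
def guardVars (B : ℕ) (p q : ℕ → ℕ) : Set (ℕ × ℕ) := {z | z.1 < B ∧ (z.2 = p z.1 ∨ z.2 = q z.1)}

/-- `s` and `t` agree on the variables of sort `i` in `V`. -/
def AgreeOn {A : Type w} (V : Set (ℕ × ℕ)) (i : ℕ) (s t : Assignment A) : Prop :=
  ∀ v, (i, v) ∈ V → s v = t v

/-- Up to variables outside `V`, the teams of `X` of sort below `B` are the teams of `W`
restricted to `p = q`. -/
def Simulates {A : Type w} (B : ℕ) (p q : ℕ → ℕ) (V : Set (ℕ × ℕ)) (X W : TeamFamily A) : Prop :=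
  ∀ i < B, (∀ s ∈ X i, ∃ t ∈ guardTeam (p i) (q i) (W i), AgreeOn V i s t) ∧
    ∀ t ∈ guardTeam (p i) (q i) (W i), ∃ s ∈ X i, AgreeOn V i s t

/-- The atom, evaluated in teams restricted to `p = q`, is definable. If `b` holds, then only
nonempty teams are considered. -/
def GuardDefinable (L : FirstOrder.Language.{u, v}) (b : Prop) (C : Set Atom) (α : Atom) : Prop :=
  ∀ p q : ℕ → ℕ, (∀ i, ∀ z ∈ α.vars, z.2 < p i ∧ z.2 < q i) →
    ∃ φ : Formula L, φ.AtomsIn C ∧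
      φ.free ⊆ α.vars ∪ {z | z.1 ∈ α.sorts ∧ (z.2 = p z.1 ∨ z.2 = q z.1)} ∧
      ∀ (A : Type w) [Nontrivial A] [L.Structure A] (X : TeamFamily A),
        Total (α.vars ∪ {z | z.1 ∈ α.sorts ∧ (z.2 = p z.1 ∨ z.2 = q z.1)}) X →
        (b → ∀ i, (X i).Nonempty) →
        (φ.Sat X ↔ α.Sat fun i => guardTeam (p i) (q i) (X i))

section

variable {A : Type w}

theorem AgreeOn.mono {V V' : Set (ℕ × ℕ)} {i : ℕ} {s t : Assignment A} (h : AgreeOn V i s t)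
    (hV : V' ⊆ V) : AgreeOn V' i s t := fun v hv => h v (hV hv)

theorem AgreeOn.comp {V : Set (ℕ × ℕ)} {i n : ℕ} {s t : Assignment A} {x : Fin n → ℕ}
    (h : AgreeOn V i s t) (hx : tupleVars i x ⊆ V) : s ∘ x = t ∘ x :=
  funext fun k => h _ (hx ⟨k, rfl⟩)

/-- An atom reads only its own variables, so it is transferred by a back-and-forth correspondence of
assignments. The correspondence need not be one-to-one: marked teams contain several copies of an
assignment. -/
theorem Atom.sat_of_agreeOn {α : Atom} {X Y : TeamFamily A}
    (h1 : ∀ i ∈ α.sorts, ∀ s ∈ X i, ∃ t ∈ Y i, AgreeOn α.vars i s t)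
    (h2 : ∀ i ∈ α.sorts, ∀ t ∈ Y i, ∃ s ∈ X i, AgreeOn α.vars i s t) (h : α.Sat X) :
    α.Sat Y := by
  cases α with
  | dep i x y =>
    intro t ht t' ht' h3
    obtain ⟨s, hs, hst⟩ := h2 i (by simp [sorts]) t ht
    obtain ⟨s', hs', hst'⟩ := h2 i (by simp [sorts]) t' ht'
    have := h s hs s' hs'
    rwa [hst.comp (x := x) (by simp [vars]), hst'.comp (x := x) (by simp [vars]),
      hst.comp (x := y) (by simp [vars]), hst'.comp (x := y) (by simp [vars]),
      imp_iff_right h3] at this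
  | inc i x y =>
    intro t ht
    obtain ⟨s, hs, hst⟩ := h2 i (by simp [sorts]) t ht
    obtain ⟨s', hs', h3⟩ := h s hs
    obtain ⟨t', ht', hst'⟩ := h1 i (by simp [sorts]) s' hs'
    rw [hst.comp (x := x) (by simp [vars]), hst'.comp (x := y) (by simp [vars])] at h3
    exact ⟨t', ht', h3⟩
  | exc i x y =>
    intro t ht t' ht'
    obtain ⟨s, hs, hst⟩ := h2 i (by simp [sorts]) t ht
    obtain ⟨s', hs', hst'⟩ := h2 i (by simp [sorts]) t' ht'
    have := h s hs s' hs'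
    rwa [hst.comp (x := x) (by simp [vars]), hst'.comp (x := y) (by simp [vars])] at this
  | ind i x y z =>
    intro t ht t' ht' h3
    obtain ⟨s, hs, hst⟩ := h2 i (by simp [sorts]) t ht
    obtain ⟨s', hs', hst'⟩ := h2 i (by simp [sorts]) t' ht'
    have := h s hs s' hs'
    have hx : tupleVars i x ⊆ (ind i x y z).vars := fun _ h => by
      simp only [vars, Set.mem_union]; tauto
    have hy : tupleVars i y ⊆ (ind i x y z).vars := fun _ h => by
      simp only [vars, Set.mem_union]; tauto
    have hz : tupleVars i z ⊆ (ind i x y z).vars := fun _ h => by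
      simp only [vars, Set.mem_union]; tauto
    rw [hst.comp hx, hst'.comp hx, hst.comp hy, hst'.comp hz] at this
    obtain ⟨s'', hs'', h4, h5, h6⟩ := this h3
    obtain ⟨t'', ht'', hst''⟩ := h1 i (by simp [sorts]) s'' hs''
    rw [hst''.comp hx] at h4
    rw [hst''.comp hy] at h5
    rw [hst''.comp hz] at h6
    exact ⟨t'', ht'', h4, h5, h6⟩
  | pdep i j x y a b =>
    intro t ht t' ht' h3
    obtain ⟨s, hs, hst⟩ := h2 i (by simp [sorts]) t ht
    obtain ⟨s', hs', hst'⟩ := h2 j (by simp [sorts]) t' ht'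
    have := h s hs s' hs'
    have hx : tupleVars i x ⊆ (pdep i j x y a b).vars := fun _ h => by
      simp only [vars, Set.mem_union]; tauto
    have hy : tupleVars i y ⊆ (pdep i j x y a b).vars := fun _ h => by
      simp only [vars, Set.mem_union]; tauto
    have ha : tupleVars j a ⊆ (pdep i j x y a b).vars := fun _ h => by
      simp only [vars, Set.mem_union]; tauto
    have hb : tupleVars j b ⊆ (pdep i j x y a b).vars := fun _ h => by
      simp only [vars, Set.mem_union]; tauto
    rw [hst.comp hx, hst.comp hy, hst'.comp ha, hst'.comp hb] at this
    exact this h3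
  | pinc i j x y =>
    intro t ht
    obtain ⟨s, hs, hst⟩ := h2 i (by simp [sorts]) t ht
    obtain ⟨s', hs', h3⟩ := h s hs
    obtain ⟨t', ht', hst'⟩ := h1 j (by simp [sorts]) s' hs'
    rw [hst.comp (x := x) (by simp [vars]), hst'.comp (x := y) (by simp [vars])] at h3
    exact ⟨t', ht', h3⟩
  | pexc i j x y =>
    intro t ht t' ht'
    obtain ⟨s, hs, hst⟩ := h2 i (by simp [sorts]) t ht
    obtain ⟨s', hs', hst'⟩ := h2 j (by simp [sorts]) t' ht'
    have := h s hs s' hs'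
    rwa [hst.comp (x := x) (by simp [vars]), hst'.comp (x := y) (by simp [vars])] at this
  | pind i j k x a u y v b w =>
    intro t ht t' ht' h3
    obtain ⟨s, hs, hst⟩ := h2 i (by simp [sorts]) t ht
    obtain ⟨s', hs', hst'⟩ := h2 j (by simp [sorts]) t' ht'
    have := h s hs s' hs'
    have hx : tupleVars i x ⊆ (pind i j k x a u y v b w).vars := fun _ h => by
      simp only [vars, Set.mem_union]; tauto
    have hy : tupleVars i y ⊆ (pind i j k x a u y v b w).vars := fun _ h => by
      simp only [vars, Set.mem_union]; tauto
    have ha : tupleVars j a ⊆ (pind i j k x a u y v b w).vars := fun _ h => by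
      simp only [vars, Set.mem_union]; tauto
    have hb : tupleVars j b ⊆ (pind i j k x a u y v b w).vars := fun _ h => by
      simp only [vars, Set.mem_union]; tauto
    have hu : tupleVars k u ⊆ (pind i j k x a u y v b w).vars := fun _ h => by
      simp only [vars, Set.mem_union]; tauto
    have hv : tupleVars k v ⊆ (pind i j k x a u y v b w).vars := fun _ h => by
      simp only [vars, Set.mem_union]; tauto
    have hw : tupleVars k w ⊆ (pind i j k x a u y v b w).vars := fun _ h => by
      simp only [vars, Set.mem_union]; tauto
    rw [hst.comp hx, hst.comp hy, hst'.comp ha, hst'.comp hb] at this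
    obtain ⟨s'', hs'', h4, h5, h6⟩ := this h3
    obtain ⟨t'', ht'', hst''⟩ := h1 k (by simp [sorts]) s'' hs''
    rw [hst''.comp hu] at h4
    rw [hst''.comp hv] at h5
    rw [hst''.comp hw] at h6
    exact ⟨t'', ht'', h4, h5, h6⟩

theorem Atom.sat_congr_agreeOn {α : Atom} {X Y : TeamFamily A}
    (h1 : ∀ i ∈ α.sorts, ∀ s ∈ X i, ∃ t ∈ Y i, AgreeOn α.vars i s t)
    (h2 : ∀ i ∈ α.sorts, ∀ t ∈ Y i, ∃ s ∈ X i, AgreeOn α.vars i s t) : α.Sat X ↔ α.Sat Y := by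
  refine ⟨Atom.sat_of_agreeOn h1 h2, Atom.sat_of_agreeOn (fun i hi s hs => ?_) fun i hi t ht => ?_⟩
  · obtain ⟨t, ht, h⟩ := h2 i hi s hs
    exact ⟨t, ht, fun v hv => (h v hv).symm⟩
  · obtain ⟨s, hs, h⟩ := h1 i hi t ht
    exact ⟨s, hs, fun v hv => (h v hv).symm⟩

theorem Simulates.mono {B : ℕ} {p q : ℕ → ℕ} {V V' : Set (ℕ × ℕ)} {X W : TeamFamily A}
    (h : Simulates B p q V X W) (hV : V' ⊆ V) : Simulates B p q V' X W := fun i hi =>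
  ⟨fun s hs => (h i hi).1 s hs |>.imp fun _ h => ⟨h.1, h.2.mono hV⟩,
    fun t ht => (h i hi).2 t ht |>.imp fun _ h => ⟨h.1, h.2.mono hV⟩⟩

theorem Simulates.forall_iff {B : ℕ} {p q : ℕ → ℕ} {V : Set (ℕ × ℕ)} {X W : TeamFamily A}
    (h : Simulates B p q V X W) {i : ℕ} (hi : i < B) {P : Assignment A → Prop}
    (hP : ∀ s t, AgreeOn V i s t → (P s ↔ P t)) :
    (∀ t ∈ guardTeam (p i) (q i) (W i), P t) ↔ ∀ s ∈ X i, P s := by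
  constructor
  · intro h' s hs
    obtain ⟨t, ht, hst⟩ := (h i hi).1 s hs
    exact (hP s t hst).2 (h' t ht)
  · intro h' t ht
    obtain ⟨s, hs, hst⟩ := (h i hi).2 t ht
    exact (hP s t hst).1 (h' s hs)

end

/-- Elimination of a simultaneous split of the teams of the sorts in `S` by means of marker
variables. -/
theorem definable_split {L : FirstOrder.Language.{u, v}} {b : Prop} {C : Set Atom} {B N : ℕ}
    {p q : ℕ → ℕ} (hp : ∀ i, B ≤ p i ∧ p i < N) (hq : ∀ i, B ≤ q i ∧ q i < N)
    {V₁ V₂ : Set (ℕ × ℕ)} (hV₁ : ∀ z ∈ V₁, z.2 < B) (hV₂ : ∀ z ∈ V₂, z.2 < B)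
    (S : Finset ℕ) (hS : ∀ i ∈ S, i < B) (φ₁ φ₂ ψ₁ ψ₂ : Formula L)
    (hψ₁ : ψ₁.AtomsIn C) (hψ₂ : ψ₂.AtomsIn C)
    (hf₁ : ψ₁.free ⊆ V₁ ∪ guardVars B (fun i => if i ∈ S then N else p i)
      (fun i => if i ∈ S then N + 1 else q i))
    (hf₂ : ψ₂.free ⊆ V₂ ∪ guardVars B (fun i => if i ∈ S then N else p i)
      (fun i => if i ∈ S then N + 2 else q i))
    (h₁ : ∀ (A : Type w) [Nontrivial A] [L.Structure A] (X W : TeamFamily A),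
      Total (V₁ ∪ guardVars B (fun i => if i ∈ S then N else p i)
        (fun i => if i ∈ S then N + 1 else q i)) W → (b → ∀ i, (W i).Nonempty) →
      Simulates B (fun i => if i ∈ S then N else p i) (fun i => if i ∈ S then N + 1 else q i)
        V₁ X W → (ψ₁.Sat W ↔ φ₁.Sat X))
    (h₂ : ∀ (A : Type w) [Nontrivial A] [L.Structure A] (X W : TeamFamily A),
      Total (V₂ ∪ guardVars B (fun i => if i ∈ S then N else p i)
        (fun i => if i ∈ S then N + 2 else q i)) W → (b → ∀ i, (W i).Nonempty) →
      Simulates B (fun i => if i ∈ S then N else p i) (fun i => if i ∈ S then N + 2 else q i)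
        V₂ X W → (ψ₂.Sat W ↔ φ₂.Sat X)) :
    ∃ ψ : Formula L, ψ.AtomsIn C ∧ ψ.free ⊆ (V₁ ∪ V₂) ∪ guardVars B p q ∧
      ∀ (A : Type w) [Nontrivial A] [L.Structure A] (X W : TeamFamily A),
        Total ((V₁ ∪ V₂) ∪ guardVars B p q) W → (b → ∀ i, (W i).Nonempty) →
        Simulates B p q (V₁ ∪ V₂) X W →
        (ψ.Sat W ↔ ∃ Y Z : TeamFamily A, (∀ i ∈ S, Y i ∪ Z i = X i) ∧
          (∀ i ∉ S, Y i = X i ∧ Z i = X i) ∧ φ₁.Sat Y ∧ φ₂.Sat Z) := by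
  classical
  set V := (V₁ ∪ V₂) ∪ guardVars B p q with hV
  have hVN : ∀ z ∈ V, z.2 < N := by
    have := hp 0
    rintro z ((hz | hz) | ⟨hz, hz' | hz'⟩)
    · have := hV₁ z hz
      omega
    · have := hV₂ z hz
      omega
    · rw [hz']
      exact (hp _).2
    · rw [hz']
      exact (hq _).2
  have hVD : ∀ i v, (i, v) ∈ V → v ∉ [N, N + 1, N + 2] := by
    intro i v hv h
    have : v < N := hVN _ hv
    simp only [List.mem_cons, List.not_mem_nil, or_false] at h
    omega
  have mark : ∀ i ∈ S, ∀ v ∈ [N, N + 1, N + 2],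
      (i, v) ∈ V ∪ {z | z.1 ∈ S ∧ z.2 ∈ [N, N + 1, N + 2]} := fun i hi v hv => .inr ⟨hi, hv⟩
  have hpV : ∀ i < B, (i, p i) ∈ V := fun i hi => .inr ⟨hi, .inl rfl⟩
  have hqV : ∀ i < B, (i, q i) ∈ V := fun i hi => .inr ⟨hi, .inr rfl⟩
  have hVS : ∀ W₁ ⊆ V₁ ∪ V₂, ∀ k ∈ [N + 1, N + 2],
      W₁ ∪ guardVars B (fun i => if i ∈ S then N else p i) (fun i => if i ∈ S then k else q i) ⊆
      V ∪ {z | z.1 ∈ S ∧ z.2 ∈ [N, N + 1, N + 2]} := by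
    rintro W₁ hW₁ k hk ⟨i, v⟩ (hz | ⟨hi, hz⟩)
    · exact .inl (.inl (hW₁ hz))
    · by_cases hiS : i ∈ S
      · refine mark i hiS v ?_
        simp only [hiS, if_true] at hz
        simp only [List.mem_cons, List.not_mem_nil, or_false] at hk ⊢
        omega
      · simp only [hiS, if_false] at hz
        exact .inl (.inr ⟨hi, hz⟩)
  -- Marking: `N = N + 1` puts an assignment into the left half, `N = N + 2` into the right half.
  -- Assignments inside the old guard carry at least one mark, those outside carry none, so the new
  -- guards alone delimit the halves.
  obtain ⟨ψ, hψ, hf, hs⟩ := ((Definable.forall_mem (P := fun i _ _ X => ∀ s ∈ X i,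
      (s (p i) = s (q i) ∧ (s N = s (N + 1) ∨ s N = s (N + 2))) ∨
      (s (p i) ≠ s (q i) ∧ (s N ≠ s (N + 1) ∧ s N ≠ s (N + 2)))) S fun i hi =>
    ((Definable.eq (.inl (hpV i (hS i hi))) (.inl (hqV i (hS i hi)))).and_flat i
      ((Definable.eq (mark i hi _ (by simp)) (mark i hi _ (by simp))).lor_flat i
        (Definable.eq (mark i hi _ (by simp)) (mark i hi _ (by simp))))).lor_flat i
    ((Definable.neq (.inl (hpV i (hS i hi))) (.inl (hqV i (hS i hi)))).and_flat i
      ((Definable.neq (mark i hi _ (by simp)) (mark i hi _ (by simp))).and_flat i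
        (Definable.neq (mark i hi _ (by simp)) (mark i hi _ (by simp)))))).and
    ((Definable.of_formula hψ₁ (hf₁.trans (hVS V₁ Set.subset_union_left _ (by simp)))).and
      (Definable.of_formula hψ₂ (hf₂.trans
        (hVS V₂ Set.subset_union_right _ (by simp)))))).exSorts S [N, N + 1, N + 2]
  refine ⟨ψ, hψ, hf, fun A _ _ X W hW hne hsim => ?_⟩
  have tot : ∀ W₁ ⊆ V₁ ∪ V₂, ∀ k ∈ [N + 1, N + 2], ∀ W' : TeamFamily A,
      (∀ i ∈ S, IsSupp (W i) [N, N + 1, N + 2] (W' i)) → (∀ i ∉ S, W' i = W i) →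
      Total (W₁ ∪ guardVars B (fun i => if i ∈ S then N else p i)
        (fun i => if i ∈ S then k else q i)) W' := by
    intro W₁ hW₁ k hk W' h3 h4
    refine Total.mono ?_ (hVS W₁ hW₁ k hk)
    rintro ⟨i, v⟩ hz s hs
    by_cases hi : i ∈ S
    · obtain ⟨t, ht, h5, h6⟩ := (h3 i hi).sub hs
      by_cases hv : v ∈ [N, N + 1, N + 2]
      · exact h6 v hv
      · change (s v).isSome
        rw [h5 v hv]
        exact hW (i, v) (hz.resolve_right fun h => hv h.2) t ht
    · exact hW (i, v) (hz.resolve_right fun h => hi h.1) s (by simpa [h4 i hi] using hs)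
  have ne : ∀ W' : TeamFamily A, (∀ i ∈ S, IsSupp (W i) [N, N + 1, N + 2] (W' i)) →
      (∀ i ∉ S, W' i = W i) → b → ∀ i, (W' i).Nonempty := by
    intro W' h3 h4 hb i
    by_cases hi : i ∈ S
    · exact (h3 i hi).nonempty (hne hb i)
    · rw [h4 i hi]
      exact hne hb i
  have agree : ∀ i (s t t' : Assignment A), AgreeOn (V₁ ∪ V₂) i s t →
      (∀ v ∉ [N, N + 1, N + 2], t' v = t v) → AgreeOn (V₁ ∪ V₂) i s t' := by
    intro i s t t' h3 h4 v hv
    rw [h3 v hv, h4 v (hVD i v (.inl hv))]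
  rw [hs]
  constructor
  · rintro ⟨W', h3, h4, hκ, h5, h6⟩
    have cover : ∀ i ∈ S, ∀ s ∈ X i, ∃ t' ∈ W' i, AgreeOn (V₁ ∪ V₂) i s t' ∧
        (t' N = t' (N + 1) ∨ t' N = t' (N + 2)) := by
      intro i hi s hs
      obtain ⟨t, ⟨ht, hg⟩, hst⟩ := (hsim i (hS i hi)).1 s hs
      obtain ⟨t', ht', htt'⟩ := (h3 i hi).ex t ht
      refine ⟨t', ht', agree i s t t' hst htt', ?_⟩
      have := hκ i hi t' ht'
      rw [htt' _ (hVD i _ (hpV i (hS i hi))), htt' _ (hVD i _ (hqV i (hS i hi)))] at this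
      tauto
    have back : ∀ i ∈ S, ∀ t' ∈ W' i, (t' N = t' (N + 1) ∨ t' N = t' (N + 2)) →
        ∃ s ∈ X i, AgreeOn (V₁ ∪ V₂) i s t' := by
      intro i hi t' ht' hm
      obtain ⟨t, ht, htt', -⟩ := (h3 i hi).sub ht'
      have hκ := hκ i hi t' ht'
      rw [htt' _ (hVD i _ (hpV i (hS i hi))), htt' _ (hVD i _ (hqV i (hS i hi)))] at hκ
      obtain ⟨s, hs, hst⟩ := (hsim i (hS i hi)).2 t ⟨ht, by tauto⟩
      exact ⟨s, hs, agree i s t t' hst htt'⟩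
    -- The halves read off from a marking: `k = N + 1` gives the left one, `k = N + 2` the right
    -- one. Sorts outside `S` are not split and keep the old guard.
    have sim : ∀ W₁ ⊆ V₁ ∪ V₂, ∀ k ∈ [N + 1, N + 2],
        Simulates B (fun i => if i ∈ S then N else p i) (fun i => if i ∈ S then k else q i) W₁
          (fun i => if i ∈ S then
            {s ∈ X i | ∃ t' ∈ W' i, AgreeOn (V₁ ∪ V₂) i s t' ∧ t' N = t' k} else X i) W' := by
      intro W₁ hW₁ k hk i hi
      by_cases hiS : i ∈ S
      · simp only [hiS, if_true]
        constructor
        · rintro s ⟨hs, t', ht', hst', hm⟩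
          exact ⟨t', ⟨ht', hm⟩, hst'.mono hW₁⟩
        · rintro t' ⟨ht', hm⟩
          have hk' : k = N + 1 ∨ k = N + 2 := by simpa using hk
          obtain ⟨s, hs, hst'⟩ := back i hiS t' ht' (by rcases hk' with rfl | rfl <;> simp [hm])
          exact ⟨s, ⟨hs, t', ht', hst', hm⟩, hst'.mono hW₁⟩
      · simp only [hiS, if_false, h4 i hiS]
        exact hsim.mono hW₁ i hi
    refine ⟨_, _, fun i hi => ?_, fun i hi => ?_,
      (h₁ A _ W' (tot V₁ Set.subset_union_left _ (by simp) W' h3 h4) (ne W' h3 h4)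
        (sim V₁ Set.subset_union_left _ (by simp))).1 h5,
      (h₂ A _ W' (tot V₂ Set.subset_union_right _ (by simp) W' h3 h4) (ne W' h3 h4)
        (sim V₂ Set.subset_union_right _ (by simp))).1 h6⟩
    · simp only [hi, if_true]
      ext s
      constructor
      · rintro (hs | hs)
        exacts [hs.1, hs.1]
      · intro hs
        obtain ⟨t', ht', hst', hm | hm⟩ := cover i hi s hs
        exacts [.inl ⟨hs, t', ht', hst', hm⟩, .inr ⟨hs, t', ht', hst', hm⟩]
    · simp [hi]
  · rintro ⟨Y, Z, h3, h4, h5, h6⟩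
    -- All admissible markings are taken at once. An assignment that matches both halves thus occurs
    -- with either mark, so overlapping halves of a lax split are represented.
    let W' : TeamFamily A := fun i => if i ∈ S then
      {t' ∈ extend (W i) [N, N + 1, N + 2] |
        ((t' (p i) = t' (q i) ∧ (t' N = t' (N + 1) ∨ t' N = t' (N + 2))) ∨
        (t' (p i) ≠ t' (q i) ∧ (t' N ≠ t' (N + 1) ∧ t' N ≠ t' (N + 2)))) ∧
        (t' N = t' (N + 1) → ∃ s ∈ Y i, AgreeOn (V₁ ∪ V₂) i s t') ∧
        (t' N = t' (N + 2) → ∃ s ∈ Z i, AgreeOn (V₁ ∪ V₂) i s t')} else W i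
    have hW'S : ∀ i ∉ S, W' i = W i := fun i hi => by simp [W', hi]
    -- Two elements suffice: `a, a, b'` is marked left only, `a, b', a` right only, and `a, b', b'`
    -- not at all.
    obtain ⟨a, b', hab⟩ := exists_pair_ne A
    let ext3 : Assignment A → A → A → A → Assignment A := fun t x y z v =>
      if v = N then some x else if v = N + 1 then some y else if v = N + 2 then some z else t v
    have e0 : ∀ t x y z, ext3 t x y z N = some x := by simp [ext3]
    have e1 : ∀ t x y z, ext3 t x y z (N + 1) = some y := by simp [ext3]
    have e2 : ∀ t x y z, ext3 t x y z (N + 2) = some z := by simp [ext3]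
    have e3 : ∀ t x y z, ∀ v ∉ [N, N + 1, N + 2], ext3 t x y z v = t v := by
      intro t x y z v hv
      simp only [List.mem_cons, List.not_mem_nil, or_false, not_or] at hv
      simp [ext3, hv]
    have e4 : ∀ i, ∀ t ∈ W i, ∀ x y z, ext3 t x y z ∈ extend (W i) [N, N + 1, N + 2] := by
      intro i t ht x y z
      refine ⟨t, ht, e3 t x y z, fun v hv => ?_⟩
      simp only [List.mem_cons, List.not_mem_nil, or_false] at hv
      rcases hv with rfl | rfl | rfl
      · simp [e0]
      · simp [e1]
      · simp [e2]
    have ep : ∀ i ∈ S, ∀ t x y z, ext3 t x y z (p i) = t (p i) := fun i hi t x y z =>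
      e3 t x y z _ (hVD i _ (hpV i (hS i hi)))
    have eq : ∀ i ∈ S, ∀ t x y z, ext3 t x y z (q i) = t (q i) := fun i hi t x y z =>
      e3 t x y z _ (hVD i _ (hqV i (hS i hi)))
    have inY : ∀ i ∈ S, ∀ t ∈ W i, t (p i) = t (q i) → ∀ s ∈ Y i, AgreeOn (V₁ ∪ V₂) i s t →
        ext3 t a a b' ∈ W' i := by
      intro i hi t ht hg s hs hst
      simp only [W', hi, if_true]
      refine ⟨e4 i t ht _ _ _, ?_, fun _ => ⟨s, hs, agree i s t _ hst (e3 t _ _ _)⟩, ?_⟩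
      · simp [ep i hi, eq i hi, e0, e1, hg]
      · simp [e0, e2, hab]
    have inZ : ∀ i ∈ S, ∀ t ∈ W i, t (p i) = t (q i) → ∀ s ∈ Z i, AgreeOn (V₁ ∪ V₂) i s t →
        ext3 t a b' a ∈ W' i := by
      intro i hi t ht hg s hs hst
      simp only [W', hi, if_true]
      refine ⟨e4 i t ht _ _ _, ?_, ?_, fun _ => ⟨s, hs, agree i s t _ hst (e3 t _ _ _)⟩⟩
      · simp [ep i hi, eq i hi, e0, e2, hg]
      · simp [e0, e1, hab]
    have hW' : ∀ i ∈ S, IsSupp (W i) [N, N + 1, N + 2] (W' i) := by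
      intro i hi
      refine ⟨?_, fun t ht => ?_⟩
      · simp only [W', hi, if_true]
        exact fun t ht => ht.1
      · by_cases hg : t (p i) = t (q i)
        · obtain ⟨s, hs, hst⟩ := (hsim i (hS i hi)).2 t ⟨ht, hg⟩
          rw [← h3 i hi] at hs
          rcases hs with hs | hs
          · exact ⟨_, inY i hi t ht hg s hs hst, e3 t _ _ _⟩
          · exact ⟨_, inZ i hi t ht hg s hs hst, e3 t _ _ _⟩
        · refine ⟨ext3 t a b' b', ?_, e3 t _ _ _⟩
          simp only [W', hi, if_true]
          exact ⟨e4 i t ht _ _ _, by simp [ep i hi, eq i hi, e0, e1, e2, hg, hab],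
            by simp [e0, e1, hab], by simp [e0, e2, hab]⟩
    refine ⟨W', hW', hW'S, fun i hi t' ht' => ?_,
      (h₁ A Y W' (tot V₁ Set.subset_union_left _ (by simp) W' hW' hW'S) (ne W' hW' hW'S) ?_).2 h5,
      (h₂ A Z W' (tot V₂ Set.subset_union_right _ (by simp) W' hW' hW'S) (ne W' hW' hW'S) ?_).2 h6⟩
    · simp only [W', hi, if_true] at ht'
      exact ht'.2.1
    · intro i hi
      by_cases hiS : i ∈ S
      · simp only [hiS, if_true]
        constructor
        · intro s hs
          obtain ⟨t, ⟨ht, hg⟩, hst⟩ := (hsim i hi).1 s (h3 i hiS ▸ .inl hs)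
          exact ⟨_, ⟨inY i hiS t ht hg s hs hst, by rw [e0, e1]⟩,
            (agree i s t _ hst (e3 t _ _ _)).mono Set.subset_union_left⟩
        · rintro t' ⟨ht', hm⟩
          simp only [W', hiS, if_true] at ht'
          obtain ⟨s, hs, hst⟩ := ht'.2.2.1 hm
          exact ⟨s, hs, hst.mono Set.subset_union_left⟩
      · simp only [hiS, if_false, hW'S i hiS, (h4 i hiS).1]
        exact hsim.mono Set.subset_union_left i hi
    · intro i hi
      by_cases hiS : i ∈ S
      · simp only [hiS, if_true]
        constructor
        · intro s hs
          obtain ⟨t, ⟨ht, hg⟩, hst⟩ := (hsim i hi).1 s (h3 i hiS ▸ .inr hs)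
          exact ⟨_, ⟨inZ i hiS t ht hg s hs hst, by rw [e0, e2]⟩,
            (agree i s t _ hst (e3 t _ _ _)).mono Set.subset_union_right⟩
        · rintro t' ⟨ht', hm⟩
          simp only [W', hiS, if_true] at ht'
          obtain ⟨s, hs, hst⟩ := ht'.2.2.2 hm
          exact ⟨s, hs, hst.mono Set.subset_union_right⟩
      · simp only [hiS, if_false, hW'S i hiS, (h4 i hiS).2]
        exact hsim.mono Set.subset_union_right i hi

/-- The quantifier step of the simulation: a value of `x` chosen on one side is copied to the
matching assignment on the other. -/
theorem AgreeOn.assign {A : Type w} {V V' : Set (ℕ × ℕ)} {i x : ℕ} {s t s' t' : Assignment A}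
    (h : AgreeOn V i s t) (hV : ∀ v, (i, v) ∈ V' → v ≠ x → (i, v) ∈ V)
    (hs : ∀ v ∉ [x], s' v = s v) (ht : ∀ v ∉ [x], t' v = t v) (hx : s' x = t' x) :
    AgreeOn V' i s' t' := by
  intro v hv
  by_cases hvx : v = x
  · rw [hvx, hx]
  · rw [hs v (by simp [hvx]), ht v (by simp [hvx]), h v (hV v hv hvx)]

/-- A literal is a condition on single assignments, so it suffices to evaluate it in the restricted
team. -/
theorem definable_literal {L : FirstOrder.Language.{u, v}} {C : Set Atom} {B i : ℕ}
    {p q : ℕ → ℕ} {φ : Formula L} (hi : i < B) (hφ : φ.AtomsIn C)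
    {P : ∀ (A : Type w) [L.Structure A], Assignment A → Prop}
    (h : ∀ (A : Type w) [L.Structure A] (X : TeamFamily A), φ.Sat X ↔ ∀ s ∈ X i, P A s)
    (hP : ∀ (A : Type w) [L.Structure A] (s t : Assignment A), AgreeOn φ.free i s t →
      (P A s ↔ P A t)) :
    ∃ ψ : Formula L, ψ.AtomsIn C ∧ ψ.free ⊆ φ.free ∪ guardVars B p q ∧
      ∀ (A : Type w) [Nontrivial A] [L.Structure A] (X W : TeamFamily A),
        Simulates B p q φ.free X W → (ψ.Sat W ↔ φ.Sat X) := by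
  obtain ⟨ψ, h1, h2, h3⟩ := Definable.guard {i} (p := p) (q := q)
    (V := φ.free ∪ guardVars B p q) (fun j hj => by
      rw [Finset.mem_singleton.1 hj]
      exact ⟨.inr ⟨hi, .inl rfl⟩, .inr ⟨hi, .inr rfl⟩⟩)
    (Definable.of_formula.{u, v, w} hφ Set.subset_union_left)
  refine ⟨ψ, h1, h2, fun A _ _ X W hsim => ?_⟩
  refine (h3 A W).trans ?_
  dsimp only
  rw [h, h, ← hsim.forall_iff hi (hP A)]
  simp

/-- Over structures with at least two elements, splitting of teams can be replaced by marking
assignments, so that atoms need to be translated only for teams restricted by markers. -/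
theorem guard_translation {L : FirstOrder.Language.{u, v}} {b : Prop} {C C' : Set Atom}
    (h : ∀ α ∈ C, GuardDefinable.{u, v, w} L b C' α) {B : ℕ} (φ : Formula L) (hφ : φ.AtomsIn C)
    (hB : φ.BoundedBy B) (N : ℕ) (p q : ℕ → ℕ) (hp : ∀ i, B ≤ p i ∧ p i < N)
    (hq : ∀ i, B ≤ q i ∧ q i < N) :
    ∃ ψ : Formula L, ψ.AtomsIn C' ∧ ψ.free ⊆ φ.free ∪ guardVars B p q ∧
      ∀ (A : Type w) [Nontrivial A] [L.Structure A] (X W : TeamFamily A),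
        Total (φ.free ∪ guardVars B p q) W → (b → ∀ i, (W i).Nonempty) →
        Simulates B p q φ.free X W → (ψ.Sat W ↔ φ.Sat X) := by
  classical
  -- Each elimination of a disjunction uses up three markers, so the translations of its disjuncts
  -- draw theirs from `N + 3` on. All markers stay at or above `B`, where no quantifier of `φ` can
  -- overwrite them.
  have newp : ∀ (N : ℕ) (S : Finset ℕ) (p : ℕ → ℕ), (∀ i, B ≤ p i ∧ p i < N) → ∀ k ≤ 2, ∀ i,
      B ≤ (if i ∈ S then N + k else p i) ∧ (if i ∈ S then N + k else p i) < N + 3 := by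
    intro N S p hp k hk i
    have := hp i
    split_ifs <;> omega
  induction φ generalizing N p q with
  | eq i x y =>
    obtain ⟨ψ, h1, h2, h3⟩ := definable_literal.{u, v, w} (p := p) (q := q) (C := C') hB.1
      (φ := Formula.eq (L := L) i x y) trivial (fun _ _ _ => Iff.rfl)
      fun A _ s t hst => by rw [hst x (by simp [Formula.free]), hst y (by simp [Formula.free])]
    exact ⟨ψ, h1, h2, fun A _ _ X W _ _ => h3 A X W⟩
  | neq i x y =>
    obtain ⟨ψ, h1, h2, h3⟩ := definable_literal.{u, v, w} (p := p) (q := q) (C := C') hB.1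
      (φ := Formula.neq (L := L) i x y) trivial (fun _ _ _ => Iff.rfl)
      fun A _ s t hst => by rw [hst x (by simp [Formula.free]), hst y (by simp [Formula.free])]
    exact ⟨ψ, h1, h2, fun A _ _ X W _ _ => h3 A X W⟩
  | rel i R x =>
    obtain ⟨ψ, h1, h2, h3⟩ := definable_literal.{u, v, w} (p := p) (q := q) (C := C') hB.1
      (φ := Formula.rel (L := L) i R x) trivial (fun _ _ _ => Iff.rfl)
      fun A _ s t hst => by rw [hst.comp (x := x) subset_rfl]
    exact ⟨ψ, h1, h2, fun A _ _ X W _ _ => h3 A X W⟩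
  | nrel i R x =>
    obtain ⟨ψ, h1, h2, h3⟩ := definable_literal.{u, v, w} (p := p) (q := q) (C := C') hB.1
      (φ := Formula.nrel (L := L) i R x) trivial (fun _ _ _ => Iff.rfl)
      fun A _ s t hst => by rw [hst.comp (x := x) subset_rfl]
    exact ⟨ψ, h1, h2, fun A _ _ X W _ _ => h3 A X W⟩
  | atom α =>
    have sub : α.vars ∪ {z | z.1 ∈ α.sorts ∧ (z.2 = p z.1 ∨ z.2 = q z.1)} ⊆
        (Formula.atom α : Formula L).free ∪ guardVars B p q :=
      Set.union_subset_union subset_rfl fun z hz => ⟨hB.1 _ hz.1, hz.2⟩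
    obtain ⟨ψ, h1, h2, h3⟩ := h α hφ p q fun i z hz =>
      ⟨(hB.2 z hz).trans_le (hp i).1, (hB.2 z hz).trans_le (hq i).1⟩
    refine ⟨ψ, h1, h2.trans sub, fun A _ _ X W hW hne hsim => ?_⟩
    rw [h3 A W (hW.mono sub) hne]
    exact (Atom.sat_congr_agreeOn (fun i hi => (hsim i (hB.1 i hi)).1)
      fun i hi => (hsim i (hB.1 i hi)).2).symm
  | and φ₁ φ₂ ih₁ ih₂ =>
    obtain ⟨ψ₁, a₁, f₁, h₁⟩ := ih₁ hφ.1 hB.1 N p q hp hq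
    obtain ⟨ψ₂, a₂, f₂, h₂⟩ := ih₂ hφ.2 hB.2 N p q hp hq
    refine ⟨.and ψ₁ ψ₂, ⟨a₁, a₂⟩, Set.union_subset
      (f₁.trans (Set.union_subset_union_left _ Set.subset_union_left))
      (f₂.trans (Set.union_subset_union_left _ Set.subset_union_right)),
      fun A _ _ X W hW hne hsim => and_congr
        (h₁ A X W (hW.mono (Set.union_subset_union_left _ Set.subset_union_left)) hne
          (hsim.mono Set.subset_union_left))
        (h₂ A X W (hW.mono (Set.union_subset_union_left _ Set.subset_union_right)) hne
          (hsim.mono Set.subset_union_right))⟩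
  | or φ₁ φ₂ ih₁ ih₂ =>
    obtain ⟨ψ₁, a₁, f₁, h₁⟩ := ih₁ hφ.1 hB.1 (N + 3)
      (fun i => if i ∈ Finset.range B then N else p i)
      (fun i => if i ∈ Finset.range B then N + 1 else q i)
      (newp N _ p hp 0 (by simp)) (newp N _ q hq 1 (by simp))
    obtain ⟨ψ₂, a₂, f₂, h₂⟩ := ih₂ hφ.2 hB.2 (N + 3)
      (fun i => if i ∈ Finset.range B then N else p i)
      (fun i => if i ∈ Finset.range B then N + 2 else q i)
      (newp N _ p hp 0 (by simp)) (newp N _ q hq 2 (by simp))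
    obtain ⟨ψ, a, f, h'⟩ := definable_split hp hq (fun z hz => (hB.1.free z hz).2)
      (fun z hz => (hB.2.free z hz).2) (Finset.range B) (fun i hi => Finset.mem_range.1 hi)
      φ₁ φ₂ ψ₁ ψ₂ a₁ a₂ f₁ f₂ h₁ h₂
    refine ⟨ψ, a, f, fun A _ _ X W hW hne hsim => (h' A X W hW hne hsim).trans ⟨?_, ?_⟩⟩
    · rintro ⟨Y, Z, h1, h2, h3, h4⟩
      refine ⟨Y, Z, fun i => ?_, h3, h4⟩
      by_cases hi : i ∈ Finset.range B
      · exact h1 i hi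
      · rw [(h2 i hi).1, (h2 i hi).2, Set.union_self]
    · rintro ⟨Y, Z, h1, h3, h4⟩
      -- Only sorts below `B` are marked. In the others the split is replaced by two copies of the
      -- whole team, which the disjuncts cannot notice.
      refine ⟨fun i => if i ∈ Finset.range B then Y i else X i,
        fun i => if i ∈ Finset.range B then Z i else X i, fun i hi => ?_, fun i hi => ?_,
        (Formula.sat_congr_sorts hB.1 fun i hi => ?_).1 h3,
        (Formula.sat_congr_sorts hB.2 fun i hi => ?_).1 h4⟩
      · simp only [hi, if_true, h1]
      · simp only [hi, if_false, and_self]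
      · simp [hi]
      · simp [hi]
  | lor j φ₁ φ₂ ih₁ ih₂ =>
    obtain ⟨ψ₁, a₁, f₁, h₁⟩ := ih₁ hφ.1 hB.2.1 (N + 3)
      (fun i => if i ∈ ({j} : Finset ℕ) then N else p i)
      (fun i => if i ∈ ({j} : Finset ℕ) then N + 1 else q i)
      (newp N _ p hp 0 (by simp)) (newp N _ q hq 1 (by simp))
    obtain ⟨ψ₂, a₂, f₂, h₂⟩ := ih₂ hφ.2 hB.2.2 (N + 3)
      (fun i => if i ∈ ({j} : Finset ℕ) then N else p i)
      (fun i => if i ∈ ({j} : Finset ℕ) then N + 2 else q i)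
      (newp N _ p hp 0 (by simp)) (newp N _ q hq 2 (by simp))
    obtain ⟨ψ, a, f, h'⟩ := definable_split hp hq (fun z hz => (hB.2.1.free z hz).2)
      (fun z hz => (hB.2.2.free z hz).2) {j} (fun i hi => Finset.mem_singleton.1 hi ▸ hB.1)
      φ₁ φ₂ ψ₁ ψ₂ a₁ a₂ f₁ f₂ h₁ h₂
    refine ⟨ψ, a, f, fun A _ _ X W hW hne hsim => (h' A X W hW hne hsim).trans ⟨?_, ?_⟩⟩
    · rintro ⟨Y, Z, h1, h2, h3, h4⟩
      have key : ∀ Y : TeamFamily A, (∀ i ∉ ({j} : Finset ℕ), Y i = X i) →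
          Function.update X j (Y j) = Y := by
        intro Y hY
        funext i
        by_cases hi : i = j
        · subst hi
          simp
        · simp [hi, hY]
      refine ⟨Y j, Z j, h1 j (by simp), ?_, ?_⟩
      · rwa [key Y fun i hi => (h2 i hi).1]
      · rwa [key Z fun i hi => (h2 i hi).2]
    · rintro ⟨Y, Z, h1, h3, h4⟩
      refine ⟨_, _, fun i hi => ?_, fun i hi => ?_, h3, h4⟩
      · obtain rfl := Finset.mem_singleton.1 hi
        simpa using h1
      · have : i ≠ j := by simpa using hi
        simp [this]
  | ex i x φ ih =>
    obtain ⟨ψ, a, f, h'⟩ := ih hφ hB.2.2 N p q hp hq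
    have hxp : p i ∉ [x] := by
      have := (hp i).1
      have := hB.2.1
      simp only [List.mem_singleton]
      omega
    have hxq : q i ∉ [x] := by
      have := (hq i).1
      have := hB.2.1
      simp only [List.mem_singleton]
      omega
    have hfree : ∀ v, (i, v) ∈ φ.free → v ≠ x → (i, v) ∈ (Formula.ex i x φ).free :=
      fun v hv hvx => ⟨hv, by simp [hvx]⟩
    refine ⟨.ex i x ψ, a, ?_, fun A _ _ X W hW hne hsim => ?_⟩
    · rintro z ⟨hz, hzx⟩
      exact (f hz).imp (fun h => ⟨h, hzx⟩) id
    have main : ∀ S T, IsSupp (W i) [x] T →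
        ((∀ s ∈ S, ∃ t ∈ guardTeam (p i) (q i) T, AgreeOn φ.free i s t) ∧
          ∀ t ∈ guardTeam (p i) (q i) T, ∃ s ∈ S, AgreeOn φ.free i s t) →
        (ψ.Sat (Function.update W i T) ↔ φ.Sat (Function.update X i S)) := by
      intro S T hT hST
      refine h' A _ _ (hW.extend hT.sub ?_) (fun hb j => ?_) fun j hj => ?_
      · rintro ⟨j, v⟩ (hz | hz)
        · by_cases hzx : (j, v) = (i, x)
          · right
            simpa using hzx
          · exact .inl (.inl ⟨hz, hzx⟩)
        · exact .inl (.inr hz)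
      · by_cases hji : j = i
        · subst hji
          simpa using hT.nonempty (hne hb j)
        · simpa [hji] using hne hb j
      · by_cases hji : j = i
        · subst hji
          simpa using hST
        · simp only [Function.update_of_ne hji]
          have := hsim.mono (V' := φ.free \ {(i, x)}) subset_rfl j hj
          have sub : ∀ s t : Assignment A, AgreeOn (φ.free \ {(i, x)}) j s t →
              AgreeOn φ.free j s t := fun s t h v hv => h v ⟨hv, by simp [hji]⟩
          exact ⟨fun s hs => (this.1 s hs).imp fun t ht => ⟨ht.1, sub _ _ ht.2⟩,
            fun s hs => (this.2 s hs).imp fun t ht => ⟨ht.1, sub _ _ ht.2⟩⟩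
    rw [Formula.sat_ex, Formula.sat_ex]
    constructor
    · rintro ⟨T, hT, hs⟩
      -- The clause `s x = t x` is needed because `x` may fail to occur in `φ.free`.
      refine ⟨{s ∈ extend (X i) [x] | ∃ t ∈ guardTeam (p i) (q i) T, AgreeOn φ.free i s t ∧
        s x = t x}, ⟨fun s hs => hs.1, fun s hs => ?_⟩, (main _ T hT ⟨?_, fun t ht => ?_⟩).1 hs⟩
      · obtain ⟨t, ⟨ht, hg⟩, hst⟩ := (hsim i hB.1).1 s hs
        obtain ⟨t', ht', htt'⟩ := hT.ex t ht
        refine ⟨Function.update s x (t' x), ⟨⟨s, hs, fun v hv => ?_, fun v hv => ?_⟩, t',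
          ⟨ht', ?_⟩, hst.assign hfree (fun v hv => ?_) htt' (by simp), by simp⟩, fun v hv => ?_⟩
        · simp [show v ≠ x by simpa using hv]
        · obtain ⟨_, _, _, h6⟩ := hT.sub ht'
          rw [show v = x by simpa using hv]
          simpa using h6 x (by simp)
        · rwa [htt' _ hxp, htt' _ hxq]
        · simp [show v ≠ x by simpa using hv]
        · simp [show v ≠ x by simpa using hv]
      · rintro s ⟨-, t, ht, hst, -⟩
        exact ⟨t, ht, hst⟩
      · obtain ⟨t₀, ht₀, h5, h6⟩ := hT.sub ht.1
        obtain ⟨s, hs, hst⟩ := (hsim i hB.1).2 t₀ ⟨ht₀, by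
          rw [← h5 _ hxp, ← h5 _ hxq]
          exact ht.2⟩
        have hag : AgreeOn φ.free i (Function.update s x (t x)) t :=
          hst.assign hfree (fun v hv => by simp [show v ≠ x by simpa using hv]) h5 (by simp)
        refine ⟨Function.update s x (t x), ⟨⟨s, hs, fun v hv => ?_, fun v hv => ?_⟩, t, ht, hag,
          by simp⟩, hag⟩
        · simp [show v ≠ x by simpa using hv]
        · rw [show v = x by simpa using hv]
          simpa using h6 x (by simp)
    · rintro ⟨S, hS, hs⟩
      -- Inside the guard the values of `x` are dictated by `S`; outside it they are arbitrary,
      -- since those assignments are ignored.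
      have hT : IsSupp (W i) [x] {t ∈ extend (W i) [x] | t (p i) = t (q i) →
          ∃ s ∈ S, AgreeOn φ.free i s t} := by
        refine ⟨fun t ht => ht.1, fun t ht => ?_⟩
        by_cases hg : t (p i) = t (q i)
        · obtain ⟨s, hs, hst⟩ := (hsim i hB.1).2 t ⟨ht, hg⟩
          obtain ⟨s', hs', hss'⟩ := hS.ex s hs
          refine ⟨Function.update t x (s' x), ⟨⟨t, ht, fun v hv => ?_, fun v hv => ?_⟩,
            fun _ => ⟨s', hs', hst.assign hfree hss' (fun v hv => ?_) (by simp)⟩⟩, fun v hv => ?_⟩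
          · simp [show v ≠ x by simpa using hv]
          · obtain ⟨_, _, _, h6⟩ := hS.sub hs'
            rw [show v = x by simpa using hv]
            simpa using h6 x (by simp)
          · simp [show v ≠ x by simpa using hv]
          · simp [show v ≠ x by simpa using hv]
        · refine ⟨Function.update t x (some (Classical.arbitrary A)),
            ⟨⟨t, ht, fun v hv => ?_, fun v hv => ?_⟩, fun h => (hg ?_).elim⟩, fun v hv => ?_⟩
          · simp [show v ≠ x by simpa using hv]
          · simp [show v = x by simpa using hv]
          · simpa [show p i ≠ x by simpa using hxp, show q i ≠ x by simpa using hxq] using h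
          · simp [show v ≠ x by simpa using hv]
      refine ⟨_, hT, (main S _ hT ⟨fun s' hs' => ?_, fun t ht => ht.1.2 ht.2⟩).2 hs⟩
      obtain ⟨s, hs, h5, h6⟩ := hS.sub hs'
      obtain ⟨t, ⟨ht, hg⟩, hst⟩ := (hsim i hB.1).1 s hs
      have hag : AgreeOn φ.free i s' (Function.update t x (s' x)) :=
        hst.assign hfree h5 (fun v hv => by simp [show v ≠ x by simpa using hv]) (by simp)
      refine ⟨Function.update t x (s' x), ⟨⟨⟨t, ht, fun v hv => ?_, fun v hv => ?_⟩,
        fun _ => ⟨s', hs', hag⟩⟩, ?_⟩, hag⟩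
      · simp [show v ≠ x by simpa using hv]
      · rw [show v = x by simpa using hv]
        simpa using h6 x (by simp)
      · simpa [show p i ≠ x by simpa using hxp, show q i ≠ x by simpa using hxq] using hg
  | all i x φ ih =>
    obtain ⟨ψ, a, f, h'⟩ := ih hφ hB.2.2 N p q hp hq
    have hxp : p i ∉ [x] := by
      have := (hp i).1
      have := hB.2.1
      simp only [List.mem_singleton]
      omega
    have hxq : q i ∉ [x] := by
      have := (hq i).1
      have := hB.2.1
      simp only [List.mem_singleton]
      omega
    have hfree : ∀ v, (i, v) ∈ φ.free → v ≠ x → (i, v) ∈ (Formula.all i x φ).free :=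
      fun v hv hvx => ⟨hv, by simp [hvx]⟩
    refine ⟨.all i x ψ, a, ?_, fun A _ _ X W hW hne hsim => ?_⟩
    · rintro z ⟨hz, hzx⟩
      exact (f hz).imp (fun h => ⟨h, hzx⟩) id
    rw [Formula.sat_all, Formula.sat_all]
    refine h' A _ _ (hW.extend subset_rfl ?_) (fun hb j => ?_) fun j hj => ?_
    · rintro ⟨j, v⟩ (hz | hz)
      · by_cases hzx : (j, v) = (i, x)
        · right
          simpa using hzx
        · exact .inl (.inl ⟨hz, hzx⟩)
      · exact .inl (.inr hz)
    · by_cases hji : j = i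
      · subst hji
        simpa using extend_nonempty (hne hb j) _
      · simpa [hji] using hne hb j
    · by_cases hji : j = i
      · subst hji
        simp only [Function.update_self]
        constructor
        · rintro s' ⟨s, hs, h5, h6⟩
          obtain ⟨t, ⟨ht, hg⟩, hst⟩ := (hsim j hB.1).1 s hs
          refine ⟨Function.update t x (s' x), ⟨⟨t, ht, fun v hv => ?_, fun v hv => ?_⟩, ?_⟩,
            hst.assign hfree h5 (fun v hv => by simp [show v ≠ x by simpa using hv]) (by simp)⟩
          · simp [show v ≠ x by simpa using hv]
          · rw [show v = x by simpa using hv]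
            simpa using h6 x (by simp)
          · simpa [show p j ≠ x by simpa using hxp, show q j ≠ x by simpa using hxq] using hg
        · rintro t' ⟨⟨t, ht, h5, h6⟩, hg⟩
          rw [h5 _ hxp, h5 _ hxq] at hg
          obtain ⟨s, hs, hst⟩ := (hsim j hB.1).2 t ⟨ht, hg⟩
          refine ⟨Function.update s x (t' x), ⟨s, hs, fun v hv => ?_, fun v hv => ?_⟩,
            hst.assign hfree (fun v hv => by simp [show v ≠ x by simpa using hv]) h5 (by simp)⟩
          · simp [show v ≠ x by simpa using hv]
          · rw [show v = x by simpa using hv]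
            simpa using h6 x (by simp)
      · simp only [Function.update_of_ne hji]
        have := hsim.mono (V' := φ.free \ {(i, x)}) subset_rfl j hj
        have sub : ∀ s t : Assignment A, AgreeOn (φ.free \ {(i, x)}) j s t →
            AgreeOn φ.free j s t := fun s t h v hv => h v ⟨hv, by simp [hji]⟩
        exact ⟨fun s hs => (this.1 s hs).imp fun t ht => ⟨ht.1, sub _ _ ht.2⟩,
          fun s hs => (this.2 s hs).imp fun t ht => ⟨ht.1, sub _ _ ht.2⟩⟩

/-- It suffices to translate atoms, for teams restricted by markers. -/
theorem expressibleIn_of_guardDefinable {L : FirstOrder.Language.{u, v}} {K : PolyteamClass.{w}}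
    {C C' : Set Atom} {b : Prop}
    (hK : ∀ (A : Type w) [Subsingleton A] (X : Polyteam A), K A X → ∀ i, (X.team i).Nonempty)
    (hb : b → ∀ (A : Type w) (X : Polyteam A), K A X → ∀ i, (X.team i).Nonempty)
    (h : ∀ α ∈ C, GuardDefinable.{u, v, w} L b C' α) :
    ExpressibleIn K (PFO L C) (PFO L C') := by
  refine expressibleIn_of_nontrivial hK fun φ hφ => ?_
  obtain ⟨B, hB⟩ := φ.exists_boundedBy
  -- The initial guard equates the variable `B` with itself, so nothing is discarded. Binding this
  -- variable existentially makes it defined everywhere and keeps it from being free.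
  obtain ⟨ψ, h1, h2, h3⟩ := guard_translation h φ hφ hB (B + 1) (fun _ => B) (fun _ => B)
    (by simp) (by simp)
  obtain ⟨ψ', h4, h5, h6⟩ := (Definable.of_formula.{u, v, w} h1 (V := φ.free ∪
    {p | p.1 ∈ Finset.range B ∧ p.2 ∈ [B]}) (h2.trans (Set.union_subset_union_right _ (by
      rintro z ⟨hz, hz'⟩
      simpa [hz] using hz')))).exSorts (Finset.range B) [B]
  have hBf : ∀ i v, (i, v) ∈ φ.free → v ∉ [B] := by
    intro i v hv hvB
    have : v < B := (hB.free _ hv).2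
    simp only [List.mem_singleton] at hvB
    omega
  refine ⟨ψ', h4, h5, fun A _ _ X hX hKX => ?_⟩
  have key : ∀ X' : TeamFamily A, (∀ i ∈ Finset.range B, IsSupp (X.team i) [B] (X' i)) →
      (∀ i ∉ Finset.range B, X' i = X.team i) → (ψ.Sat X' ↔ φ.Sat X.team) := by
    intro X' h7 h8
    refine h3 A _ _ ?_ (fun hb' i => ?_) fun i hi => ⟨fun s hs => ?_, fun t ht => ?_⟩
    · rintro ⟨i, v⟩ hz s hs
      by_cases hi : i < B
      · obtain ⟨t, ht, h9, h10⟩ := (h7 i (by simpa using hi)).sub hs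
        rcases hz with hz | ⟨-, hz⟩
        · change (s v).isSome
          rw [h9 v (hBf i v hz)]
          exact X.total hX (i, v) hz t ht
        · exact h10 v (by simpa using hz)
      · rcases hz with hz | ⟨hz, -⟩
        · exact (hi (hB.free _ hz).1).elim
        · exact (hi hz).elim
    · by_cases hi : i < B
      · exact (h7 i (by simpa using hi)).nonempty (hb hb' A X hKX i)
      · rw [h8 i (by simpa using hi)]
        exact hb hb' A X hKX i
    · obtain ⟨t, ht, h9⟩ := (h7 i (by simpa using hi)).ex s hs
      exact ⟨t, ⟨ht, rfl⟩, fun v hv => (h9 v (hBf i v hv)).symm⟩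
    · obtain ⟨s, hs, h9, -⟩ := (h7 i (by simpa using hi)).sub ht.1
      exact ⟨s, hs, fun v hv => (h9 v (hBf i v hv)).symm⟩
  rw [h6]
  constructor
  · intro hs
    have h7 : ∀ i ∈ Finset.range B, IsSupp (X.team i) [B]
        (if i ∈ Finset.range B then extend (X.team i) [B] else X.team i) := by
      intro i hi
      rw [if_pos hi]
      refine ⟨subset_rfl, fun s hs => ⟨Function.update s B (some (Classical.arbitrary A)),
        ⟨s, hs, fun v hv => ?_, fun v hv => ?_⟩, fun v hv => ?_⟩⟩
      · simp [show v ≠ B by simpa using hv]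
      · simp [show v = B by simpa using hv]
      · simp [show v ≠ B by simpa using hv]
    have h8 : ∀ i ∉ Finset.range B,
        (if i ∈ Finset.range B then extend (X.team i) [B] else X.team i) = X.team i :=
      fun i hi => if_neg hi
    exact ⟨_, h7, h8, (key _ h7 h8).2 hs⟩
  · rintro ⟨X', h7, h8, hs⟩
    exact (key X' h7 h8).1 hs

/-! ### From single atoms to guarded atoms -/

/-- The atom is definable in families of teams in which, if `b` holds, the teams of the sorts not
occurring in the atom are nonempty. -/
def AtomDefinable (L : FirstOrder.Language.{u, v}) (b : Prop) (C : Set Atom) (α : Atom) : Prop :=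
  ∃ φ : Formula L, φ.AtomsIn C ∧ φ.free ⊆ α.vars ∧
    ∀ (A : Type w) [Nontrivial A] [L.Structure A] (X : TeamFamily A), Total α.vars X →
      (b → ∀ i ∉ α.sorts, (X i).Nonempty) → (φ.Sat X ↔ α.Sat X)

/-- Only the sorts of the atom are restricted by the guard. The other teams are left as they are,
hence still nonempty when `b` holds, although the guarded ones may be empty. -/
theorem AtomDefinable.guardDefinable {L : FirstOrder.Language.{u, v}} {b : Prop} {C : Set Atom}
    {α : Atom} (h : AtomDefinable.{u, v, w} L b C α) : GuardDefinable.{u, v, w} L b C α := by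
  intro p q _
  obtain ⟨φ, h1, h2, h3⟩ := h
  obtain ⟨ψ, h4, h5, h6⟩ := Definable.guard α.sorts (p := p) (q := q)
    (V := α.vars ∪ {z | z.1 ∈ α.sorts ∧ (z.2 = p z.1 ∨ z.2 = q z.1)})
    (fun i hi => ⟨.inr ⟨hi, .inl rfl⟩, .inr ⟨hi, .inr rfl⟩⟩)
    (Definable.of_formula.{u, v, w} h1 (h2.trans Set.subset_union_left))
  refine ⟨ψ, h4, h5, fun A _ _ X hX hne => ?_⟩
  refine (h6 A X).trans ?_
  dsimp only
  rw [h3 A _ ?_ fun hb i hi => by simpa [hi] using hne hb i]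
  · exact Atom.sat_congr_sorts fun i hi => by simp [hi]
  · rintro ⟨i, v⟩ hz s hs
    refine hX (i, v) (.inl hz) s ?_
    dsimp only at hs
    split_ifs at hs
    exacts [hs.1, hs]

theorem AtomDefinable.of_mem {L : FirstOrder.Language.{u, v}} {b : Prop} {C : Set Atom}
    {α : Atom} (h : α ∈ C) : AtomDefinable.{u, v, w} L b C α :=
  ⟨.atom α, h, subset_rfl, fun _ _ _ _ _ _ => Iff.rfl⟩

theorem AtomDefinable.of_equiv {L : FirstOrder.Language.{u, v}} {b : Prop} {C : Set Atom}
    {α β : Atom} (h : β ∈ C) (hV : β.vars ⊆ α.vars)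
    (hs : ∀ (A : Type w) (X : TeamFamily A), α.Sat X ↔ β.Sat X) :
    AtomDefinable.{u, v, w} L b C α :=
  ⟨.atom β, h, hV, fun A _ _ X _ _ => (hs A X).symm⟩

/-! ### Tuples of fresh variables -/

/-- The variables `N, N + 1, …, N + n - 1`. -/
def fresh (N n : ℕ) : Fin n → ℕ := fun k => N + k

theorem fresh_mem (N n : ℕ) (k : Fin n) : fresh N n k ∈ List.range' N n := by
  simp [fresh, List.mem_range'_1]

theorem comp_append {β γ : Type*} (f : β → γ) {m n : ℕ} (x : Fin m → β) (y : Fin n → β) :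
    f ∘ Fin.append x y = Fin.append (f ∘ x) (f ∘ y) := by
  funext k
  refine Fin.addCases (fun k => ?_) (fun k => ?_) k <;> simp

theorem append_eq_append {β : Type*} {m n : ℕ} {x x' : Fin m → β} {y y' : Fin n → β} :
    Fin.append x y = Fin.append x' y' ↔ x = x' ∧ y = y' := by
  refine ⟨fun h => ⟨funext fun k => ?_, funext fun k => ?_⟩, fun h => by rw [h.1, h.2]⟩
  · simpa using congrFun h (Fin.castAdd n k)
  · simpa using congrFun h (Fin.natAdd m k)

theorem fresh_add (N m n : ℕ) :
    fresh N (m + n) = Fin.append (fresh N m) (fresh (N + m) n) := by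
  funext k
  refine Fin.addCases (fun k => ?_) (fun k => ?_) k
  · simp [fresh]
  · simp [fresh, add_assoc]

theorem forall_append {β : Type*} {m n : ℕ} {x : Fin m → β} {y : Fin n → β} {P : β → Prop}
    (hx : ∀ k, P (x k)) (hy : ∀ k, P (y k)) (k : Fin (m + n)) : P (Fin.append x y k) := by
  refine Fin.addCases (fun k => ?_) (fun k => ?_) k
  · simpa using hx k
  · simpa using hy k

theorem tupleVars_append_subset {i m n : ℕ} {x : Fin m → ℕ} {y : Fin n → ℕ} {V : Set (ℕ × ℕ)}
    (hx : tupleVars i x ⊆ V) (hy : tupleVars i y ⊆ V) : tupleVars i (Fin.append x y) ⊆ V := by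
  rintro _ ⟨k, rfl⟩
  exact forall_append (P := fun z => (i, z) ∈ V) (fun k => hx ⟨k, rfl⟩) (fun k => hy ⟨k, rfl⟩) k

theorem Atom.exists_bound (α : Atom) : ∃ N, ∀ z ∈ α.vars, z.2 < N := by
  obtain ⟨N, hN⟩ := (α.vars_finite.image Prod.snd).bddAbove
  exact ⟨N + 1, fun z hz => Nat.lt_succ_of_le (hN ⟨z, hz, rfl⟩)⟩

section

variable {A : Type w}

theorem exists_extend {T : Set (Assignment A)} {s : Assignment A} (hs : s ∈ T) (N : ℕ) {n : ℕ}
    {a : Fin n → Option A} (ha : ∀ k, (a k).isSome) :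
    ∃ t ∈ extend T (List.range' N n), (∀ v ∉ List.range' N n, t v = s v) ∧ t ∘ fresh N n = a := by
  have h1 : ∀ v ∉ List.range' N n, (fun v => if h : N ≤ v ∧ v < N + n then
      a ⟨v - N, by omega⟩ else s v) v = s v := by
    intro v hv
    rw [List.mem_range'_1] at hv
    simp [hv]
  refine ⟨fun v => if h : N ≤ v ∧ v < N + n then a ⟨v - N, by omega⟩ else s v,
    ⟨s, hs, h1, fun v hv => ?_⟩, h1, ?_⟩
  · rw [List.mem_range'_1] at hv
    simp [hv, ha]
  · funext k
    simp [fresh]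

theorem comp_of_forall_notMem {D : List ℕ} {s t : Assignment A} (h : ∀ v ∉ D, t v = s v) {n : ℕ}
    {x : Fin n → ℕ} (hx : ∀ k, x k ∉ D) : t ∘ x = s ∘ x :=
  funext fun k => h _ (hx k)

theorem exists_of_mem_update {X : TeamFamily A} {i j : ℕ} {D : List ℕ} {T : Set (Assignment A)}
    (hT : T ⊆ extend (X i) D) {t : Assignment A} (ht : t ∈ Function.update X i T j) :
    ∃ s ∈ X j, ∀ v ∉ D, t v = s v := by
  by_cases hj : j = i
  · subst hj
    obtain ⟨s, hs, h, -⟩ := hT (by simpa using ht)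
    exact ⟨s, hs, h⟩
  · exact ⟨t, by simpa [hj] using ht, fun _ _ => rfl⟩

end

theorem notMem_range_of_lt {N n v : ℕ} (h : v < N) : v ∉ List.range' N n := by
  rw [List.mem_range'_1]
  omega

theorem Total.tuple {A : Type w} {V : Set (ℕ × ℕ)} {X : TeamFamily A} (hX : Total V X) {i n : ℕ}
    {x : Fin n → ℕ} (hx : tupleVars i x ⊆ V) {s : Assignment A} (hs : s ∈ X i) (k : Fin n) :
    ((s ∘ x) k).isSome := hX (i, x k) (hx ⟨k, rfl⟩) s hs

theorem tuple_lt {V : Set (ℕ × ℕ)} {N : ℕ} (hN : ∀ z ∈ V, z.2 < N) {i n : ℕ} {x : Fin n → ℕ}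
    (hx : tupleVars i x ⊆ V) (k : Fin n) : x k < N := hN (i, x k) (hx ⟨k, rfl⟩)

/-! ### Dependence and exclusion -/

section

variable {L : FirstOrder.Language.{u, v}} {b : Prop} {C : Set Atom}

/-- The formula is `∀ z (z = y ∨ⁱ x z | a b)`: no value other than that of `y` may accompany the
value of `x` in the other team. The hypothesis on `C` covers poly-exclusion and, for `i = j`,
ordinary exclusion. -/
theorem definable_pdep {i j : ℕ} (hC : ∀ {k : ℕ} (u v : Fin k → ℕ), ∃ β ∈ C,
      β.vars ⊆ tupleVars i u ∪ tupleVars j v ∧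
      ∀ (A : Type w) (X : TeamFamily A), β.Sat X ↔ (Atom.pexc i j u v).Sat X)
    {m n : ℕ} (x a : Fin m → ℕ) (y b : Fin n → ℕ) :
    ∃ φ : Formula L, φ.AtomsIn C ∧ φ.free ⊆ (Atom.pdep i j x y a b).vars ∧
      ∀ (A : Type w) [Nontrivial A] [L.Structure A] (X : TeamFamily A),
        Total (Atom.pdep i j x y a b).vars X → (φ.Sat X ↔ (Atom.pdep i j x y a b).Sat X) := by
  set V := (Atom.pdep i j x y a b).vars with hV
  obtain ⟨N, hN⟩ := (Atom.pdep i j x y a b).exists_bound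
  have hx : tupleVars i x ⊆ V := fun _ h => by simp only [hV, Atom.vars, Set.mem_union]; tauto
  have hy : tupleVars i y ⊆ V := fun _ h => by simp only [hV, Atom.vars, Set.mem_union]; tauto
  have ha : tupleVars j a ⊆ V := fun _ h => by simp only [hV, Atom.vars, Set.mem_union]; tauto
  have hb : tupleVars j b ⊆ V := fun _ h => by simp only [hV, Atom.vars, Set.mem_union]; tauto
  have off : ∀ {l : ℕ} {i : ℕ} {x : Fin l → ℕ}, tupleVars i x ⊆ V → ∀ k, x k ∉ List.range' N n :=
    fun h k => notMem_range_of_lt (tuple_lt hN h k)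
  set D := List.range' N n with hD
  set z := fresh N n with hz
  have hzV : tupleVars i z ⊆ V ∪ {p | p.1 = i ∧ p.2 ∈ D} := by
    rintro _ ⟨k, rfl⟩
    exact .inr ⟨rfl, fresh_mem N n k⟩
  obtain ⟨β, hβ, βV, hβs⟩ := hC (Fin.append x z) (Fin.append a b)
  obtain ⟨φ, h1, h2, h3⟩ := ((Definable.eqTuple (i := i) (x := z) (y := y) hzV
    (hy.trans Set.subset_union_left)).lor i (Definable.atom (L := L) hβ (βV.trans
      (Set.union_subset (tupleVars_append_subset (hx.trans Set.subset_union_left) hzV)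
        (tupleVars_append_subset (ha.trans Set.subset_union_left)
          (hb.trans Set.subset_union_left)))))).all i D
  refine ⟨φ, h1, h2, fun A _ _ X hX => (h3 A X).trans ?_⟩
  simp only [Function.update_self, Function.update_idem, hβs]
  simp only [Atom.Sat, Function.update_self, comp_append, append_eq_append, ne_eq, not_and]
  constructor
  · rintro ⟨Y, Z, hYZ, hY, hZ⟩ s hs s' hs' hxa
    by_contra hne
    have inZ : ∀ r ∈ X i, ∀ c : Fin n → Option A, (∀ k, (c k).isSome) → c ≠ r ∘ y →
        ∃ t ∈ Z, (∀ v ∉ D, t v = r v) ∧ t ∘ z = c := by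
      intro r hr c hc hcr
      obtain ⟨t, ht, h4, h5⟩ := exists_extend hr N hc
      refine ⟨t, ?_, h4, h5⟩
      rw [← hYZ] at ht
      refine ht.resolve_left fun htY => hcr ?_
      rw [← h5, hY t htY, comp_of_forall_notMem h4 (off hy)]
    obtain ⟨t, ht, h4, h5⟩ := inZ s hs (s' ∘ b) (hX.tuple hb hs') (Ne.symm hne)
    -- If `i = j`, the split also affects the second team, so `s'` needs an extension in `Z`, that
    -- is, a value of `z` other than `s'(y)`. One of the distinct values `s(y)` and `s'(b)` will do.
    have : ∃ t' ∈ Function.update X i Z j, ∀ v ∉ D, t' v = s' v := by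
      by_cases hij : j = i
      · subst hij
        by_cases hc : s' ∘ b = s' ∘ y
        · obtain ⟨t', ht', h6, -⟩ := inZ s' hs' (s ∘ y) (hX.tuple hy hs)
            (fun h => hne (h.trans hc.symm))
          exact ⟨t', by simpa using ht', h6⟩
        · obtain ⟨t', ht', h6, -⟩ := inZ s' hs' (s' ∘ b) (hX.tuple hb hs') hc
          exact ⟨t', by simpa using ht', h6⟩
      · exact ⟨s', by simpa [hij] using hs', fun _ _ => rfl⟩
    obtain ⟨t', ht', h6⟩ := this
    refine hZ t ht t' ht' ?_ ?_
    · rw [comp_of_forall_notMem h4 (off hx), comp_of_forall_notMem h6 (off ha), hxa]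
    · rw [h5, comp_of_forall_notMem h6 (off hb)]
  · intro h
    refine ⟨{t ∈ extend (X i) D | t ∘ z = t ∘ y}, {t ∈ extend (X i) D | t ∘ z ≠ t ∘ y}, ?_,
      fun t ht => ht.2, ?_⟩
    · ext t
      simp only [Set.mem_union, Set.mem_ofPred_eq]
      tauto
    · rintro t ⟨⟨s, hs, h4, -⟩, hne⟩ t' ht' h5 h6
      obtain ⟨s', hs', h7⟩ := exists_of_mem_update (fun _ h => h.1) ht'
      rw [comp_of_forall_notMem h4 (off hx), comp_of_forall_notMem h7 (off ha)] at h5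
      rw [comp_of_forall_notMem h7 (off hb)] at h6
      refine hne ?_
      rw [h6, comp_of_forall_notMem h4 (off hy), h s hs s' hs' h5]

theorem atomDefinable_pdep (i j : ℕ) {m n : ℕ} (x a : Fin m → ℕ) (y c : Fin n → ℕ)
    (hC : pexcAtoms ⊆ C) : AtomDefinable.{u, v, w} L b C (.pdep i j x y a c) := by
  obtain ⟨φ, h1, h2, h3⟩ := definable_pdep.{u, v, w} (L := L) (C := C) (i := i) (j := j)
    (fun u v => ⟨_, hC ⟨_, _, _, u, v, rfl⟩, subset_rfl, fun _ _ => Iff.rfl⟩) x a y c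
  exact ⟨φ, h1, h2, fun A _ _ X hX _ => h3 A X hX⟩

theorem atomDefinable_dep (i : ℕ) {m n : ℕ} (x : Fin m → ℕ) (y : Fin n → ℕ)
    (hC : excAtoms ⊆ C) : AtomDefinable.{u, v, w} L b C (.dep i x y) := by
  have hV : (Atom.pdep i i x y x y).vars = (Atom.dep i x y).vars := by
    ext
    simp only [Atom.vars, Set.mem_union]
    tauto
  obtain ⟨φ, h1, h2, h3⟩ := definable_pdep.{u, v, w} (L := L) (C := C) (i := i) (j := i)
    (fun u v => ⟨_, hC ⟨_, _, u, v, rfl⟩, subset_rfl, fun _ _ => Iff.rfl⟩) x x y y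
  rw [hV] at h2 h3
  exact ⟨φ, h1, h2, fun A _ _ X hX _ => h3 A X hX⟩

/-- If values of `x` and `y` coincided, the dependence atom would equate universally quantified
variables, which is impossible with two elements. -/
theorem atomDefinable_pexc (i j : ℕ) {n : ℕ} (x y : Fin n → ℕ) (hC : pdepAtoms ⊆ C) :
    AtomDefinable.{u, v, w} L b C (.pexc i j x y) := by
  set V := (Atom.pexc i j x y).vars with hV
  obtain ⟨N, hN⟩ := (Atom.pexc i j x y).exists_bound
  have hx : tupleVars i x ⊆ V := fun _ h => by simp only [hV, Atom.vars, Set.mem_union]; tauto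
  have hy : tupleVars j y ⊆ V := fun _ h => by simp only [hV, Atom.vars, Set.mem_union]; tauto
  have off : ∀ {l : ℕ} {i : ℕ} {x : Fin l → ℕ}, tupleVars i x ⊆ V → ∀ k, x k ∉ List.range' N 2 :=
    fun h k => notMem_range_of_lt (tuple_lt hN h k)
  -- Both fresh variables are quantified in both sorts, so one formula serves for `i = j` as well.
  obtain ⟨φ, h1, h2, h3⟩ := ((Definable.atom (L := L) (C := C)
    (V := V ∪ {p | p.1 = i ∧ p.2 ∈ List.range' N 2} ∪ {p | p.1 = j ∧ p.2 ∈ List.range' N 2})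
    (α := .pdep i j x (fun _ : Fin 1 => N) y (fun _ : Fin 1 => N + 1))
    (hC ⟨_, _, _, _, _, _, _, _, rfl⟩) (by
      rintro p (((hp | ⟨k, rfl⟩) | hp) | ⟨k, rfl⟩)
      · exact .inl (.inl (hx hp))
      · exact .inl (.inr ⟨rfl, by simp [List.mem_range'_1]⟩)
      · exact .inl (.inl (hy hp))
      · exact .inr ⟨rfl, by simp [List.mem_range'_1]⟩)).all j (List.range' N 2)).all i
        (List.range' N 2)
  refine ⟨φ, h1, h2, fun A _ _ X hX _ => (h3 A X).trans ?_⟩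
  have self : ∀ {T : Set (Assignment A)} {s}, s ∈ T → (∀ v ∈ List.range' N 2, (s v).isSome) →
      s ∈ extend T (List.range' N 2) := fun hs h => ⟨_, hs, fun _ _ => rfl, h⟩
  constructor
  · intro h s hs s' hs' hxy
    obtain ⟨c, d, hcd⟩ := exists_pair_ne A
    obtain ⟨t, ht, h4, h5⟩ := exists_extend hs N (n := 2) (a := fun _ => some c) (by simp)
    obtain ⟨t', ht', h6, h7⟩ := exists_extend hs' N (n := 2) (a := fun _ => some d) (by simp)
    have some_of : ∀ {T : Set (Assignment A)} {t}, t ∈ extend T (List.range' N 2) →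
        ∀ v ∈ List.range' N 2, (t v).isSome := fun ⟨_, _, _, h⟩ => h
    have ht2 := self ht (some_of ht)
    have ht2' := self ht' (some_of ht')
    have := h t (by
      by_cases hij : j = i
      · subst hij
        simpa using ht2
      · simpa [Ne.symm hij] using ht) t' (by
      by_cases hij : j = i
      · subst hij
        simpa using ht2'
      · simpa [hij] using ht') (by
        rw [comp_of_forall_notMem h4 (off hx), comp_of_forall_notMem h6 (off hy), hxy])
    have h8 : t N = some c := congrFun h5 0
    have h9 : t' (N + 1) = some d := congrFun h7 1
    have h10 : t N = t' (N + 1) := congrFun this 0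
    rw [h8, h9] at h10
    exact hcd (Option.some_injective _ h10)
  · intro h t ht t' ht' hxy
    obtain ⟨t₁, ht₁, h4⟩ := exists_of_mem_update subset_rfl ht
    obtain ⟨s, hs, h5⟩ := exists_of_mem_update subset_rfl ht₁
    obtain ⟨t₁', ht₁', h6⟩ := exists_of_mem_update subset_rfl ht'
    obtain ⟨s', hs', h7⟩ := exists_of_mem_update subset_rfl ht₁'
    rw [comp_of_forall_notMem h4 (off hx), comp_of_forall_notMem h5 (off hx),
      comp_of_forall_notMem h6 (off hy), comp_of_forall_notMem h7 (off hy)] at hxy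
    exact (h s hs s' hs' hxy).elim

end

section

variable {A : Type w}

theorem exists_extend_two {T : Set (Assignment A)} {s : Assignment A} (hs : s ∈ T) (N : ℕ)
    {m n : ℕ} {a : Fin m → Option A} {b : Fin n → Option A} (ha : ∀ k, (a k).isSome)
    (hb : ∀ k, (b k).isSome) :
    ∃ t ∈ extend T (List.range' N (m + n)), (∀ v ∉ List.range' N (m + n), t v = s v) ∧
      t ∘ fresh N m = a ∧ t ∘ fresh (N + m) n = b := by
  obtain ⟨t, ht, h1, h2⟩ := exists_extend hs N (a := Fin.append a b)
    (forall_append (P := fun o : Option A => o.isSome) ha hb)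
  rw [fresh_add, comp_append, append_eq_append] at h2
  exact ⟨t, ht, h1, h2⟩

end

theorem tupleVars_fresh_subset {V : Set (ℕ × ℕ)} {i M n : ℕ} {D : List ℕ}
    (h : ∀ k : Fin n, M + k ∈ D) : tupleVars i (fresh M n) ⊆ V ∪ {p | p.1 = i ∧ p.2 ∈ D} := by
  rintro _ ⟨k, rfl⟩
  exact .inr ⟨rfl, h k⟩

/-! ### Independence, inclusion and exclusion, with the help of nonempty teams -/

section

variable {L : FirstOrder.Language.{u, v}} {b : Prop} {C : Set Atom}

/-- With `l` a sort not in the atom, the formula is `∀ z₁ z₂ z₃ (z₁ z₂ z₃ ⊆ u v w ∨ˡ z₁ z₂ | x y ∨ˡ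
z₁ z₃ | a c)`: each triple is realized in the third team, or one of its two projections is missing
from the first or the second. The team of sort `l` must be nonempty for the quantifier to range over
all triples, and as `l` is fresh, splitting it leaves the other teams intact. -/
theorem atomDefinable_pind (i j k : ℕ) {m n o : ℕ} (x a u : Fin m → ℕ) (y v : Fin n → ℕ)
    (c w : Fin o → ℕ) (hC : pincAtoms ∪ pexcAtoms ⊆ C) :
    AtomDefinable.{u, v, w} L True C (.pind i j k x a u y v c w) := by
  set α := Atom.pind i j k x a u y v c w with hα
  set V := α.vars with hV
  obtain ⟨N, hN⟩ := α.exists_bound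
  obtain ⟨l, hl⟩ := Infinite.exists_notMem_finset α.sorts
  have hne : i ≠ l ∧ j ≠ l ∧ k ≠ l := by
    simp only [hα, Atom.sorts, Finset.mem_insert, Finset.mem_singleton, not_or] at hl
    exact ⟨Ne.symm hl.1, Ne.symm hl.2.1, Ne.symm hl.2.2⟩
  have hx : tupleVars i x ⊆ V := fun _ h => by simp only [hV, hα, Atom.vars, Set.mem_union]; tauto
  have hy : tupleVars i y ⊆ V := fun _ h => by simp only [hV, hα, Atom.vars, Set.mem_union]; tauto
  have ha : tupleVars j a ⊆ V := fun _ h => by simp only [hV, hα, Atom.vars, Set.mem_union]; tauto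
  have hc : tupleVars j c ⊆ V := fun _ h => by simp only [hV, hα, Atom.vars, Set.mem_union]; tauto
  have hu : tupleVars k u ⊆ V := fun _ h => by simp only [hV, hα, Atom.vars, Set.mem_union]; tauto
  have hv : tupleVars k v ⊆ V := fun _ h => by simp only [hV, hα, Atom.vars, Set.mem_union]; tauto
  have hw : tupleVars k w ⊆ V := fun _ h => by simp only [hV, hα, Atom.vars, Set.mem_union]; tauto
  set D := List.range' N (m + (n + o)) with hD
  set z₁ := fresh N m with hz₁
  set z₂ := fresh (N + m) n with hz₂
  set z₃ := fresh (N + m + n) o with hz₃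
  have inl : ∀ {i q} {x : Fin q → ℕ}, tupleVars i x ⊆ V →
    tupleVars i x ⊆ V ∪ {p | p.1 = l ∧ p.2 ∈ D} := fun h => h.trans Set.subset_union_left
  have h₁ : tupleVars l z₁ ⊆ V ∪ {p | p.1 = l ∧ p.2 ∈ D} :=
    tupleVars_fresh_subset fun k => by rw [hD, List.mem_range'_1]; omega
  have h₂ : tupleVars l z₂ ⊆ V ∪ {p | p.1 = l ∧ p.2 ∈ D} :=
    tupleVars_fresh_subset fun k => by rw [hD, List.mem_range'_1]; omega
  have h₃ : tupleVars l z₃ ⊆ V ∪ {p | p.1 = l ∧ p.2 ∈ D} :=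
    tupleVars_fresh_subset fun k => by rw [hD, List.mem_range'_1]; omega
  obtain ⟨φ, hφ, hf, hs⟩ := ((Definable.atom (L := L) (C := C)
      (α := .pinc l k (Fin.append z₁ (Fin.append z₂ z₃)) (Fin.append u (Fin.append v w)))
      (hC (.inl ⟨_, _, _, _, _, rfl⟩)) (Set.union_subset
        (tupleVars_append_subset h₁ (tupleVars_append_subset h₂ h₃))
        (tupleVars_append_subset (inl hu) (tupleVars_append_subset (inl hv) (inl hw))))).lor l
    ((Definable.atom (L := L) (C := C) (α := .pexc l i (Fin.append z₁ z₂) (Fin.append x y))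
      (hC (.inr ⟨_, _, _, _, _, rfl⟩)) (Set.union_subset (tupleVars_append_subset h₁ h₂)
        (tupleVars_append_subset (inl hx) (inl hy)))).lor l
    (Definable.atom (L := L) (C := C) (α := .pexc l j (Fin.append z₁ z₃) (Fin.append a c))
      (hC (.inr ⟨_, _, _, _, _, rfl⟩)) (Set.union_subset (tupleVars_append_subset h₁ h₃)
        (tupleVars_append_subset (inl ha) (inl hc)))))).all l D
  refine ⟨φ, hφ, hf, fun A _ _ X hX hnonempty => (hs A X).trans ?_⟩
  obtain ⟨r, hr⟩ := hnonempty trivial l hl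
  simp only [hα, Atom.Sat, Function.update_self, Function.update_idem, comp_append,
    append_eq_append, ne_eq, not_and, Function.update_of_ne hne.1, Function.update_of_ne hne.2.1,
    Function.update_of_ne hne.2.2]
  constructor
  · rintro ⟨Y, Z, hYZ, hY, Z₁, Z₂, hZ, hZ₁, hZ₂⟩ s hs s' hs' hxa
    obtain ⟨t, ht, -, h4, h5⟩ := exists_extend_two hr N (hX.tuple hx hs)
      (forall_append (P := fun o : Option A => o.isSome) (hX.tuple hy hs) (hX.tuple hc hs'))
    rw [fresh_add, comp_append, append_eq_append] at h5
    rw [← hYZ] at ht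
    rcases ht with ht | ht
    · obtain ⟨s'', hs'', h6, h7, h8⟩ := hY t ht
      exact ⟨s'', hs'', by rw [← h6, h4], by rw [← h7, h5.1], by rw [← h8, h5.2]⟩
    · rw [← hZ] at ht
      rcases ht with ht | ht
      · exact (hZ₁ t ht s hs h4 h5.1).elim
      · exact (hZ₂ t ht s' hs' (h4.trans hxa) h5.2).elim
  · intro h
    refine ⟨{t ∈ extend (X l) D | ∃ s' ∈ X k, t ∘ z₁ = s' ∘ u ∧ t ∘ z₂ = s' ∘ v ∧ t ∘ z₃ = s' ∘ w},
      {t ∈ extend (X l) D | (∀ s ∈ X i, t ∘ z₁ = s ∘ x → ¬ t ∘ z₂ = s ∘ y) ∨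
        (∀ s ∈ X j, t ∘ z₁ = s ∘ a → ¬ t ∘ z₃ = s ∘ c)}, ?_, fun t ht => ht.2,
      {t ∈ extend (X l) D | (∀ s ∈ X i, t ∘ z₁ = s ∘ x → ¬ t ∘ z₂ = s ∘ y)},
      {t ∈ extend (X l) D | (∀ s ∈ X j, t ∘ z₁ = s ∘ a → ¬ t ∘ z₃ = s ∘ c)}, ?_, fun t ht => ht.2,
      fun t ht => ht.2⟩
    · ext t
      constructor
      · rintro (ht | ht)
        exacts [ht.1, ht.1]
      · intro ht
        by_contra hn
        simp only [Set.mem_union, Set.mem_ofPred_eq, not_or, not_and, ht, true_imp_iff] at hn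
        obtain ⟨h5, h6, h7⟩ := hn
        push Not at h6 h7
        obtain ⟨s, hs, h8, h9⟩ := h6
        obtain ⟨s', hs', h10, h11⟩ := h7
        obtain ⟨s'', hs'', h12, h13, h14⟩ := h s hs s' hs' (h8.symm.trans h10)
        exact h5 ⟨s'', hs'', by rw [h12, h8], by rw [h13, h9], by rw [h14, h11]⟩
    · ext t
      simp only [Set.mem_union, Set.mem_ofPred_eq]
      tauto

/-- For distinct sorts, `∀ z (∃ r (z r r ⊆ y p q) ∨ʲ x | z)` in sort `j`: each tuple `z` is a value
of `y`, or is not a value of `x`. The guarded team of sort `j` may be empty, so the quantifier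
ranges over the unguarded one. There the repeated `r` forces the assignment that witnesses the
inclusion to satisfy the guard. -/
theorem guardDefinable_pinc (i j : ℕ) {n : ℕ} (x y : Fin n → ℕ)
    (hC : pexcAtoms ∪ incAtoms ⊆ C) : GuardDefinable.{u, v, w} L True C (.pinc i j x y) := by
  by_cases hij : i = j
  · subst hij
    exact (AtomDefinable.of_equiv (α := .pinc i i x y) (β := .inc i x y)
      (hC (.inr ⟨i, n, x, y, rfl⟩)) (by simp [Atom.vars]) fun _ _ => Iff.rfl).guardDefinable
  intro p q hpq
  set α := Atom.pinc i j x y with hα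
  set V := α.vars ∪ {z | z.1 ∈ α.sorts ∧ (z.2 = p z.1 ∨ z.2 = q z.1)} with hV
  obtain ⟨N₀, hN₀⟩ := α.exists_bound
  obtain ⟨N, hN, hpN, hqN⟩ : ∃ N, (∀ z ∈ α.vars, z.2 < N) ∧ p j < N ∧ q j < N :=
    ⟨N₀ + p j + q j + 1, fun z hz => by have := hN₀ z hz; omega, by omega, by omega⟩
  have hx : tupleVars i x ⊆ α.vars := fun _ h => by simp only [hα, Atom.vars, Set.mem_union]; tauto
  have hy : tupleVars j y ⊆ α.vars := fun _ h => by simp only [hα, Atom.vars, Set.mem_union]; tauto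
  have hyN : ∀ k, y k < N := tuple_lt hN hy
  set D := List.range' N n with hD
  set z := fresh N n with hz
  set V' := V ∪ {p | p.1 = j ∧ p.2 ∈ D} with hV'
  have hz' : tupleVars j z ⊆ V' := tupleVars_fresh_subset fun k => by
    rw [hD, List.mem_range'_1]
    omega
  have hzr : ∀ k, z k ∉ [N + n] := fun k => by
    simp only [hz, fresh, List.mem_singleton]
    omega
  have hyr : ∀ k, y k ∉ [N + n] := fun k => by
    have := hyN k
    simp only [List.mem_singleton]
    omega
  have hyD : ∀ k, y k ∉ D := fun k => notMem_range_of_lt (hyN k)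
  have hpr : p j ∉ [N + n] := by
    simp only [List.mem_singleton]
    omega
  have hqr : q j ∉ [N + n] := by
    simp only [List.mem_singleton]
    omega
  have hpD : p j ∉ D := notMem_range_of_lt hpN
  have hqD : q j ∉ D := notMem_range_of_lt hqN
  have hi : i ∈ α.sorts := by simp [hα, Atom.sorts]
  have hj : j ∈ α.sorts := by simp [hα, Atom.sorts]
  obtain ⟨φ, hφ, hf, hs⟩ := Definable.guard {i} (p := p) (q := q) (V := V) (fun k hk => by
      rw [Finset.mem_singleton.1 hk]
      exact ⟨.inr ⟨hi, .inl rfl⟩, .inr ⟨hi, .inr rfl⟩⟩)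
    ((((Definable.atom (L := L) (C := C) (V := V' ∪ {p | p.1 = j ∧ p.2 ∈ [N + n]})
      (α := .inc j (Fin.append z ![N + n, N + n]) (Fin.append y ![p j, q j]))
      (hC (.inr ⟨_, _, _, _, rfl⟩)) (Set.union_subset
        (tupleVars_append_subset (hz'.trans Set.subset_union_left) (by
          rintro _ ⟨k, rfl⟩
          fin_cases k <;> exact .inr ⟨rfl, by simp⟩))
        (tupleVars_append_subset ((hy.trans (Set.subset_union_left.trans
          Set.subset_union_left)).trans Set.subset_union_left) (by
          rintro _ ⟨k, rfl⟩
          fin_cases k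
          · exact .inl (.inl (.inr ⟨hj, .inl rfl⟩))
          · exact .inl (.inl (.inr ⟨hj, .inr rfl⟩)))))).ex j [N + n]).lor j
      (Definable.atom (L := L) (C := C) (α := .pexc i j x z) (hC (.inl ⟨_, _, _, _, _, rfl⟩))
        (Set.union_subset (hx.trans (Set.subset_union_left.trans Set.subset_union_left))
          hz'))).all j D)
  refine ⟨φ, hφ, hf, fun A _ _ X hX hne => (hs A X).trans ?_⟩
  have hji : j ≠ i := Ne.symm hij
  have pair : ∀ (s : Assignment A) (c d : ℕ), s ∘ ![c, d] = ![s c, s d] := by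
    intro s c d
    funext k
    fin_cases k <;> rfl
  simp only [hα, Atom.Sat, Function.update_self, Function.update_idem, comp_append,
    append_eq_append, ne_eq, Function.update_of_ne hij, Finset.mem_singleton, hji, if_true,
    if_false, pair]
  obtain ⟨r, hr⟩ := hne trivial j
  constructor
  · rintro ⟨Y, Z, hYZ, ⟨T, hT, hinc⟩, hexc⟩ s hs
    obtain ⟨t, ht, h4, h5⟩ := exists_extend hr N (hX.tuple (hx.trans Set.subset_union_left) hs.1)
    have htY : t ∈ Y := (hYZ.symm ▸ ht : t ∈ Y ∪ Z).resolve_right fun h => hexc s hs t h h5.symm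
    obtain ⟨t', ht', h6⟩ := hT.ex t htY
    obtain ⟨t'', ht'', h7, h8⟩ := hinc t' ht'
    obtain ⟨t₁, ht₁, h9, -⟩ := hT.sub ht''
    obtain ⟨s', hs', h10, -⟩ := (hYZ.subset (.inl ht₁) : t₁ ∈ extend (X j) D)
    have e0 := congrFun h8 0
    have e1 := congrFun h8 1
    simp only [Matrix.cons_val_zero, Matrix.cons_val_one] at e0 e1
    refine ⟨s', ⟨hs', ?_⟩, ?_⟩
    · rw [← h10 _ hpD, ← h10 _ hqD, ← h9 _ hpr, ← h9 _ hqr, ← e0, e1]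
    · rw [← h5, ← comp_of_forall_notMem h6 hzr, h7, comp_of_forall_notMem h9 hyr,
        comp_of_forall_notMem h10 hyD]
  · intro h
    refine ⟨{t ∈ extend (X j) D | ∃ s' ∈ guardTeam (p j) (q j) (X j), t ∘ z = s' ∘ y},
      {t ∈ extend (X j) D | ∀ s ∈ guardTeam (p i) (q i) (X i), ¬ s ∘ x = t ∘ z}, ?_,
      ⟨{t' | ∃ t ∈ extend (X j) D, ∃ s' ∈ guardTeam (p j) (q j) (X j), t ∘ z = s' ∘ y ∧
        t' = Function.update t (N + n) (s' (p j))}, ⟨?_, ?_⟩, ?_⟩, fun s hs t ht => ht.2 s hs⟩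
    · ext t
      constructor
      · rintro (ht | ht)
        exacts [ht.1, ht.1]
      · intro ht
        by_cases h' : ∃ s ∈ guardTeam (p i) (q i) (X i), s ∘ x = t ∘ z
        · obtain ⟨s, hs, hst⟩ := h'
          obtain ⟨s', hs', h4⟩ := h s hs
          exact .inl ⟨ht, s', hs', hst.symm.trans h4⟩
        · push Not at h'
          exact .inr ⟨ht, h'⟩
    · rintro _ ⟨t, ht, s', hs', h4, rfl⟩
      refine ⟨t, ⟨ht, s', hs', h4⟩, fun v hv => ?_, fun v hv => ?_⟩
      · simp [show v ≠ N + n by simpa using hv]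
      · rw [show v = N + n by simpa using hv, Function.update_self]
        exact hX (j, p j) (.inr ⟨hj, .inl rfl⟩) s' hs'.1
    · rintro t ⟨ht, s', hs', h4⟩
      exact ⟨_, ⟨t, ht, s', hs', h4, rfl⟩, fun v hv => by simp [show v ≠ N + n by simpa using hv]⟩
    · rintro _ ⟨t, ht, s', hs', h4, rfl⟩
      -- The inclusion is witnessed by `s'` with `z` set to `s'(y)`: it again belongs to the left
      -- half, and `r` is the common guard value of `s'`.
      obtain ⟨t₁, ht₁, h5, h6⟩ := exists_extend hs'.1 N
        (hX.tuple (hy.trans Set.subset_union_left) hs'.1)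
      have upd : ∀ (t : Assignment A) (a : Option A), ∀ v ∉ [N + n],
          Function.update t (N + n) a v = t v := fun t a v hv => by
        simp [show v ≠ N + n by simpa using hv]
      refine ⟨_, ⟨t₁, ht₁, s', hs', h6, rfl⟩, ?_, ?_⟩
      · rw [comp_of_forall_notMem (upd _ _) hzr, comp_of_forall_notMem (upd _ _) hyr,
          comp_of_forall_notMem h5 hyD, h4]
      · rw [upd _ _ _ hpr, upd _ _ _ hqr, h5 _ hpD, h5 _ hqD, ← hs'.2, Function.update_self]

/-- In a fresh sort, `∀ z ∃ c d` with the dependence of `c d` on `z` encodes a set of tuples, namely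
those with `c = d`. The first inclusion places all values of `x` in this set, the second all values
of `y` outside it. -/
theorem atomDefinable_pexc_of_pinc_dep (i j : ℕ) {n : ℕ} (x y : Fin n → ℕ)
    (hC : pincAtoms ∪ depAtoms ⊆ C) : AtomDefinable.{u, v, w} L True C (.pexc i j x y) := by
  classical
  set α := Atom.pexc i j x y with hα
  set V := α.vars with hV
  obtain ⟨N, hN⟩ := α.exists_bound
  obtain ⟨l, hl⟩ := Infinite.exists_notMem_finset α.sorts
  have hil : i ≠ l := by
    simp only [hα, Atom.sorts, Finset.mem_insert, Finset.mem_singleton, not_or] at hl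
    exact Ne.symm hl.1
  have hjl : j ≠ l := by
    simp only [hα, Atom.sorts, Finset.mem_insert, Finset.mem_singleton, not_or] at hl
    exact Ne.symm hl.2
  have hx : tupleVars i x ⊆ V := fun _ h => by simp only [hV, hα, Atom.vars, Set.mem_union]; tauto
  have hy : tupleVars j y ⊆ V := fun _ h => by simp only [hV, hα, Atom.vars, Set.mem_union]; tauto
  set D := List.range' N n with hD
  set z := fresh N n with hz
  set D' := [N + n, N + n + 1] with hD'
  set V₁ := V ∪ {p | p.1 = l ∧ p.2 ∈ D} with hV₁
  set V₂ := V₁ ∪ {p | p.1 = l ∧ p.2 ∈ D'} with hV₂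
  have hzV : tupleVars l z ⊆ V₂ := (tupleVars_fresh_subset fun k => by
    rw [hD, List.mem_range'_1]
    omega).trans Set.subset_union_left
  have hcd : tupleVars l ![N + n, N + n + 1] ⊆ V₂ := by
    rintro _ ⟨k, rfl⟩
    fin_cases k <;> exact .inr ⟨rfl, by simp [hD']⟩
  have hVV₂ : V ⊆ V₂ := Set.subset_union_left.trans Set.subset_union_left
  have hzD' : ∀ k, z k ∉ D' := fun k => by
    simp only [hz, fresh, hD', List.mem_cons, List.not_mem_nil, or_false]
    omega
  have hxN : ∀ k, x k ∉ [N] := fun k => by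
    have := tuple_lt hN hx k
    simp only [List.mem_singleton]
    omega
  have hyN : ∀ k, y k ∉ [N, N + 1] := fun k => by
    have := tuple_lt hN hy k
    simp only [List.mem_cons, List.not_mem_nil, or_false]
    omega
  obtain ⟨φ, hφ, hf, hs⟩ := (((Definable.atom (L := L) (C := C) (V := V₂)
      (α := .dep l z ![N + n, N + n + 1]) (hC (.inr ⟨_, _, _, _, _, rfl⟩))
      (Set.union_subset hzV hcd)).and
    (((Definable.atom (L := L) (C := C) (V := V₂ ∪ {p | p.1 = i ∧ p.2 ∈ [N]})
      (α := .pinc i l (Fin.append x ![N, N]) (Fin.append z ![N + n, N + n + 1]))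
      (hC (.inl ⟨_, _, _, _, _, rfl⟩)) (Set.union_subset
        (tupleVars_append_subset ((hx.trans hVV₂).trans Set.subset_union_left) (by
          rintro _ ⟨k, rfl⟩
          fin_cases k <;> exact .inr ⟨rfl, by simp⟩))
        (tupleVars_append_subset (hzV.trans Set.subset_union_left)
          (hcd.trans Set.subset_union_left)))).ex i [N]).and
    (((Definable.neq (V := V₂ ∪ {p | p.1 = j ∧ p.2 ∈ [N, N + 1]}) (i := j) (x := N) (y := N + 1)
      (.inr ⟨rfl, by simp⟩) (.inr ⟨rfl, by simp⟩)).and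
      (Definable.atom (L := L) (C := C)
      (α := .pinc j l (Fin.append y ![N, N + 1]) (Fin.append z ![N + n, N + n + 1]))
      (hC (.inl ⟨_, _, _, _, _, rfl⟩)) (Set.union_subset
        (tupleVars_append_subset ((hy.trans hVV₂).trans Set.subset_union_left) (by
          rintro _ ⟨k, rfl⟩
          fin_cases k <;> exact .inr ⟨rfl, by simp⟩))
        (tupleVars_append_subset (hzV.trans Set.subset_union_left)
          (hcd.trans Set.subset_union_left))))).ex j [N, N + 1]))).ex l D').all l D
  refine ⟨φ, hφ, hf, fun A _ _ X hX hnonempty => (hs A X).trans ?_⟩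
  have pair : ∀ (s : Assignment A) (c d : ℕ), s ∘ ![c, d] = ![s c, s d] := by
    intro s c d
    funext k
    fin_cases k <;> rfl
  have pair_eq : ∀ a b c d : Option A, ![a, b] = ![c, d] ↔ a = c ∧ b = d := by
    intro a b c d
    simp
  obtain ⟨r, hr⟩ := hnonempty trivial l hl
  simp only [hα, Atom.Sat, Function.update_self, Function.update_idem, comp_append,
    append_eq_append, ne_eq, Function.update_of_ne hil, Function.update_of_ne hjl,
    Function.update_of_ne hil.symm, Function.update_of_ne hjl.symm, pair, pair_eq]
  constructor
  · rintro ⟨T, hT, hdep, ⟨Ti, hTi, hi⟩, Tj, hTj, hneq, hj⟩ s hs s' hs' hxy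
    obtain ⟨s₁, hs₁, h1⟩ := hTi.ex s hs
    obtain ⟨s₁', hs₁', h2⟩ := hTj.ex s' hs'
    obtain ⟨t, ht, h3, h4, h5⟩ := hi s₁ hs₁
    obtain ⟨t', ht', h6, h7, h8⟩ := hj s₁' hs₁'
    rw [comp_of_forall_notMem h1 hxN] at h3
    rw [comp_of_forall_notMem h2 hyN] at h6
    obtain ⟨h9, h10⟩ := hdep t ht t' ht' (by rw [← h3, ← h6, hxy])
    refine hneq s₁' hs₁' ?_
    rw [h7, h8, ← h9, ← h10, ← h4, ← h5]
  · intro h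
    obtain ⟨c, d, hcd'⟩ := exists_pair_ne A
    -- The characteristic function of the set of values of `x`: the two marks are equal exactly on
    -- these.
    let mk : Assignment A → Assignment A := fun t v =>
      if v = N + n then some c else if v = N + n + 1 then
        (if ∃ s ∈ X i, s ∘ x = t ∘ z then some c else some d) else t v
    have mk0 : ∀ t, mk t (N + n) = some c := fun t => by simp [mk]
    have mk1 : ∀ t, mk t (N + n + 1) =
        if ∃ s ∈ X i, s ∘ x = t ∘ z then some c else some d := fun t => by simp [mk]
    have mk2 : ∀ t, ∀ v ∉ D', mk t v = t v := by
      intro t v hv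
      simp only [hD', List.mem_cons, List.not_mem_nil, or_false, not_or] at hv
      simp [mk, hv]
    have mkz : ∀ t, mk t ∘ z = t ∘ z := fun t => comp_of_forall_notMem (mk2 t) hzD'
    refine ⟨{t' | ∃ t ∈ extend (X l) D, t' = mk t}, ⟨?_, ?_⟩, ?_,
      ⟨{t | ∃ s ∈ X i, t = Function.update s N (some c)}, ⟨?_, ?_⟩, ?_⟩,
      {t | ∃ s ∈ X j, t = Function.update (Function.update s N (some c)) (N + 1) (some d)},
      ⟨?_, ?_⟩, ?_, ?_⟩
    · rintro _ ⟨t, ht, rfl⟩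
      refine ⟨t, ht, mk2 t, fun v hv => ?_⟩
      simp only [hD', List.mem_cons, List.not_mem_nil, or_false] at hv
      rcases hv with rfl | rfl
      · simp [mk0]
      · rw [mk1]
        split_ifs <;> rfl
    · exact fun t ht => ⟨_, ⟨t, ht, rfl⟩, mk2 t⟩
    · rintro _ ⟨t, ht, rfl⟩ _ ⟨t', ht', rfl⟩ htt'
      rw [mkz, mkz] at htt'
      simp only [mk0, mk1, htt', and_self]
    · rintro _ ⟨s, hs, rfl⟩
      exact ⟨s, hs, fun v hv => by simp [show v ≠ N by simpa using hv],
        fun v hv => by simp [show v = N by simpa using hv]⟩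
    · exact fun s hs => ⟨_, ⟨s, hs, rfl⟩, fun v hv => by simp [show v ≠ N by simpa using hv]⟩
    · rintro _ ⟨s, hs, rfl⟩
      obtain ⟨t, ht, -, h4⟩ := exists_extend hr N (hX.tuple hx hs)
      refine ⟨mk t, ⟨t, ht, rfl⟩, ?_, ?_, ?_⟩
      · rw [mkz, h4]
        exact comp_of_forall_notMem (fun v hv => by simp [show v ≠ N by simpa using hv]) hxN
      · simp [mk0]
      · rw [mk1, if_pos ⟨s, hs, h4.symm⟩, Function.update_self]
    · rintro _ ⟨s, hs, rfl⟩
      refine ⟨s, hs, fun v hv => ?_, fun v hv => ?_⟩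
      · simp only [List.mem_cons, List.not_mem_nil, or_false, not_or] at hv
        simp [hv]
      · simp only [List.mem_cons, List.not_mem_nil, or_false] at hv
        rcases hv with rfl | rfl <;> simp
    · refine fun s hs => ⟨_, ⟨s, hs, rfl⟩, fun v hv => ?_⟩
      simp only [List.mem_cons, List.not_mem_nil, or_false, not_or] at hv
      simp [hv]
    · rintro _ ⟨s, hs, rfl⟩
      simpa using hcd'
    · rintro _ ⟨s, hs, rfl⟩
      obtain ⟨t, ht, -, h4⟩ := exists_extend hr N (hX.tuple hy hs)
      refine ⟨mk t, ⟨t, ht, rfl⟩, ?_, ?_, ?_⟩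
      · rw [mkz, h4]
        refine comp_of_forall_notMem (fun v hv => ?_) hyN
        simp only [List.mem_cons, List.not_mem_nil, or_false, not_or] at hv
        simp [hv]
      · simp [mk0]
      · rw [mk1, if_neg, Function.update_self]
        rintro ⟨s', hs', h5⟩
        exact h s' hs' s hs (h5.trans h4)

/-- After quantifying `z` and a pair `c`, the right half contains `z = x` with equal entries of `c`
and `z = y` with arbitrary `c`. Independence of `z` and `c` combines the value of `x` with an
unequal pair, and with such a pair only `z = y` is allowed. So the value of `x` is a value of `y`.
-/
theorem atomDefinable_inc (i : ℕ) {n : ℕ} (x y : Fin n → ℕ) (hC : indAtoms ⊆ C) :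
    AtomDefinable.{u, v, w} L b C (.inc i x y) := by
  set α := Atom.inc i x y with hα
  set V := α.vars with hV
  obtain ⟨N, hN⟩ := α.exists_bound
  have hx : tupleVars i x ⊆ V := fun _ h => by simp only [hV, hα, Atom.vars, Set.mem_union]; tauto
  have hy : tupleVars i y ⊆ V := fun _ h => by simp only [hV, hα, Atom.vars, Set.mem_union]; tauto
  set D := List.range' N (n + 2) with hD
  set z := fresh N n with hz
  set c := fresh (N + n) 2 with hc
  set V' := V ∪ {p | p.1 = i ∧ p.2 ∈ D} with hV'
  have hxV : tupleVars i x ⊆ V' := hx.trans Set.subset_union_left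
  have hyV : tupleVars i y ⊆ V' := hy.trans Set.subset_union_left
  have hzV : tupleVars i z ⊆ V' := tupleVars_fresh_subset fun k => by
    rw [hD, List.mem_range'_1]
    omega
  have hcV : tupleVars i c ⊆ V' := tupleVars_fresh_subset fun k => by
    rw [hD, List.mem_range'_1]
    omega
  have hc0 : (i, c 0) ∈ V' := hcV ⟨0, rfl⟩
  have hc1 : (i, c 1) ∈ V' := hcV ⟨1, rfl⟩
  have hxD : ∀ k, x k ∉ D := fun k => notMem_range_of_lt (tuple_lt hN hx k)
  have hyD : ∀ k, y k ∉ D := fun k => notMem_range_of_lt (tuple_lt hN hy k)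
  obtain ⟨φ, hφ, hf, hs⟩ := ((((Definable.neTuple hzV hyV).and_flat i
      ((Definable.neTuple hzV hxV).lor_flat i (Definable.neq hc0 hc1))).lor i
    (((Definable.eq hc0 hc1).lor_flat i (Definable.eqTuple hzV hyV)).and
      (Definable.atom (L := L) (C := C) (α := .ind i (Fin.elim0 : Fin 0 → ℕ) z c)
        (hC ⟨_, _, _, _, _, _, _, rfl⟩) (Set.union_subset (Set.union_subset (by
          rintro _ ⟨k, -⟩
          exact k.elim0) hzV) hcV))))).all i D
  refine ⟨φ, hφ, hf, fun A _ _ X hX _ => (hs A X).trans ?_⟩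
  simp only [hα, Atom.Sat, Function.update_self]
  have e0 : ∀ t t' : Assignment A, t ∘ c = t' ∘ c → t (c 0) = t' (c 0) ∧ t (c 1) = t' (c 1) :=
    fun t t' h => ⟨congrFun h 0, congrFun h 1⟩
  constructor
  · rintro ⟨Y, Z, hYZ, hY, hZ, hind⟩ s hs
    obtain ⟨a, a', ha⟩ := exists_pair_ne A
    obtain ⟨t₁, ht₁, h1, h2, h3⟩ := exists_extend_two hs N (hX.tuple hx hs)
      (n := 2) (b := fun _ => some a) (by simp)
    obtain ⟨t₂, ht₂, h4, h5, h6⟩ := exists_extend_two hs N (hX.tuple hy hs)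
      (n := 2) (b := ![some a, some a']) (by simp [Fin.forall_fin_two])
    have hZ₁ : t₁ ∈ Z := (hYZ.symm ▸ ht₁ : t₁ ∈ Y ∪ Z).resolve_left fun h => by
      rcases (hY t₁ h).2 with h' | h'
      · exact h' (h2.trans (comp_of_forall_notMem h1 hxD).symm)
      · exact h' ((congrFun h3 0).trans (congrFun h3 1).symm)
    have hZ₂ : t₂ ∈ Z := (hYZ.symm ▸ ht₂ : t₂ ∈ Y ∪ Z).resolve_left fun h =>
      (hY t₂ h).1 (h5.trans (comp_of_forall_notMem h4 hyD).symm)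
    obtain ⟨t, ht, -, h7, h8⟩ := hind t₁ hZ₁ t₂ hZ₂ (Subsingleton.elim _ _)
    obtain ⟨s', hs', h9, -⟩ := (hYZ.subset (.inr ht) : t ∈ extend (X i) D)
    refine ⟨s', hs', ?_⟩
    rw [← h2, ← h7, ← comp_of_forall_notMem h9 hyD]
    refine (hZ t ht).resolve_left fun h => ha ?_
    obtain ⟨h10, h11⟩ := e0 _ _ h8
    rw [h10, h11] at h
    have h12 : t₂ (c 0) = some a := congrFun h6 0
    have h13 : t₂ (c 1) = some a' := congrFun h6 1
    rw [h12, h13] at h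
    exact Option.some_injective _ h
  · intro h
    refine ⟨{t ∈ extend (X i) D | t ∘ z ≠ t ∘ y ∧ (t ∘ z ≠ t ∘ x ∨ t (c 0) ≠ t (c 1))},
      {t ∈ extend (X i) D | t ∘ z = t ∘ y ∨ t ∘ z = t ∘ x ∧ t (c 0) = t (c 1)}, ?_,
      fun t ht => ht.2, fun t ht => ?_, ?_⟩
    · ext t
      simp only [Set.mem_union, Set.mem_ofPred_eq]
      tauto
    · rcases ht.2 with h' | h'
      exacts [.inr h', .inl h'.2]
    · rintro t ⟨ht, htz⟩ t' ⟨ht', -⟩ -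
      have hsome : ∀ k, ((t' ∘ c) k).isSome := by
        obtain ⟨_, _, _, h'⟩ := ht'
        intro k
        refine h' _ ?_
        rw [hc, hD, List.mem_range'_1, fresh]
        omega
      -- By the inclusion, every `z` in the right half is a value of `y` somewhere. There it
      -- satisfies `z = y`, so it may be combined with any pair `c`.
      have hs : ∃ s ∈ X i, s ∘ y = t ∘ z := by
        obtain ⟨s, hs, h1, -⟩ := ht
        rcases htz with h2 | ⟨h2, -⟩
        · exact ⟨s, hs, by rw [h2, comp_of_forall_notMem h1 hyD]⟩
        · obtain ⟨s', hs', h3⟩ := h s hs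
          exact ⟨s', hs', by rw [h2, comp_of_forall_notMem h1 hxD, h3]⟩
      obtain ⟨s, hs, h1⟩ := hs
      obtain ⟨t'', ht'', h2, h3, h4⟩ := exists_extend_two hs N (hX.tuple hy hs) hsome
      exact ⟨t'', ⟨ht'', .inl (h3.trans (comp_of_forall_notMem h2 hyD).symm)⟩,
        Subsingleton.elim _ _, h3.trans h1, h4⟩

end

/-! ### Composition of translations, and atoms as instances of independence -/

theorem ExpressibleIn.trans {L : FirstOrder.Language.{u, v}} {K : PolyteamClass.{w}}
    {𝓛₁ 𝓛₂ 𝓛₃ : Set (Formula L)} (h₁ : ExpressibleIn K 𝓛₁ 𝓛₂) (h₂ : ExpressibleIn K 𝓛₂ 𝓛₃) :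
    ExpressibleIn K 𝓛₁ 𝓛₃ := by
  intro φ hφ
  obtain ⟨φ', hφ', hf, hs⟩ := h₁ φ hφ
  obtain ⟨φ'', hφ'', hf', hs'⟩ := h₂ φ' hφ'
  exact ⟨φ'', hφ'', hf'.trans hf, fun A _ _ X hX hK =>
    (hs A X hX hK).trans (hs' A X (hf.trans hX) hK)⟩

variable {L : FirstOrder.Language.{u, v}} {b : Prop} {C : Set Atom}

theorem expressibleIn_nonemptyTeams {C C' : Set Atom}
    (h : ∀ α ∈ C, GuardDefinable.{u, v, w} L True C' α) :
    ExpressibleIn nonemptyTeams.{w} (PFO L C) (PFO L C') :=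
  expressibleIn_of_guardDefinable (fun _ _ _ h => h) (fun _ _ _ h => h) h

/-- With `b` false no team is assumed nonempty over larger structures; the restriction on the class
serves only the one-element ones. -/
theorem expressibleIn_nontrivialOrNonemptyTeams {C C' : Set Atom}
    (h : ∀ α ∈ C, AtomDefinable.{u, v, w} L False C' α) :
    ExpressibleIn nontrivialOrNonemptyTeams.{w} (PFO L C) (PFO L C') :=
  expressibleIn_of_guardDefinable (fun A _ _ h => h.resolve_left fun h' => not_subsingleton A ‹_›)
    False.elim fun α hα => (h α hα).guardDefinable

/-- Using `y` for both target tuples forces the two source values to be values of `y` under one and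
the same assignment, hence equal. -/
theorem atomDefinable_pdep_of_pind (hC : pindAtoms ⊆ C) {α : Atom} (hα : α ∈ pdepAtoms) :
    AtomDefinable.{u, v, w} L b C α := by
  obtain ⟨i, j, m, n, x, a, y, c, rfl⟩ := hα
  refine .of_equiv (β := .pind i j i x a x y y c y)
    (hC ⟨_, _, _, _, _, _, _, _, _, _, _, _, _, rfl⟩) ?_ fun A X => ?_
  · intro z
    simp only [Atom.vars, Set.mem_union]
    tauto
  · constructor
    · exact fun h s hs s' hs' hx => ⟨s, hs, rfl, rfl, h s hs s' hs' hx⟩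
    · intro h s hs s' hs' hx
      obtain ⟨s'', -, -, h1, h2⟩ := h s hs s' hs' hx
      exact h1.symm.trans h2

/-- With both source teams equal and the remaining tuples empty, only the existence of a match for
the value of `x` is left. -/
theorem atomDefinable_pinc_of_pind (hC : pindAtoms ⊆ C) {α : Atom} (hα : α ∈ pincAtoms) :
    AtomDefinable.{u, v, w} L b C α := by
  obtain ⟨i, j, n, x, y, rfl⟩ := hα
  refine .of_equiv (β := .pind i i j x x y (Fin.elim0 : Fin 0 → ℕ) Fin.elim0
    (Fin.elim0 : Fin 0 → ℕ) Fin.elim0)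
    (hC ⟨_, _, _, _, _, _, _, _, _, _, _, _, _, rfl⟩) ?_ fun A X => ?_
  · intro z
    have h0 : ∀ k, z ∉ tupleVars k (Fin.elim0 : Fin 0 → ℕ) := fun _ ⟨k, _⟩ => k.elim0
    simp only [Atom.vars, Set.mem_union, h0]
    tauto
  · constructor
    · intro h s hs s' hs' _
      obtain ⟨s'', hs'', h1⟩ := h s hs
      exact ⟨s'', hs'', h1.symm, Subsingleton.elim _ _, Subsingleton.elim _ _⟩
    · intro h s hs
      obtain ⟨s'', hs'', h1, -⟩ := h s hs s hs rfl
      exact ⟨s'', hs'', h1.symm⟩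

theorem atomDefinable_ind_of_pind (hC : pindAtoms ⊆ C) {α : Atom} (hα : α ∈ indAtoms) :
    AtomDefinable.{u, v, w} L b C α := by
  obtain ⟨i, m, n, l, x, y, z, rfl⟩ := hα
  refine .of_equiv (β := .pind i i i x x x y y z z)
    (hC ⟨_, _, _, _, _, _, _, _, _, _, _, _, _, rfl⟩) ?_ fun A X => Iff.rfl
  intro z
  simp only [Atom.vars, Set.mem_union]
  tauto

theorem atomDefinable_inc_of_pind (hC : pindAtoms ⊆ C) {α : Atom} (hα : α ∈ incAtoms) :
    AtomDefinable.{u, v, w} L b C α := by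
  obtain ⟨i, n, x, y, rfl⟩ := hα
  obtain ⟨φ, h1, h2, h3⟩ := atomDefinable_pinc_of_pind.{u, v, w} (L := L) (b := b) hC
    (α := .pinc i i x y) ⟨_, _, _, _, _, rfl⟩
  exact ⟨φ, h1, h2, fun A _ _ X hX hne => h3 A X hX (by simpa [Atom.sorts] using hne)⟩

theorem atomDefinable_dep_of_pind (hC : pindAtoms ⊆ C) {α : Atom} (hα : α ∈ depAtoms) :
    AtomDefinable.{u, v, w} L b C α := by
  obtain ⟨i, m, n, x, y, rfl⟩ := hα
  obtain ⟨φ, h1, h2, h3⟩ := atomDefinable_pdep_of_pind.{u, v, w} (L := L) (b := b) hC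
    (α := .pdep i i x y x y) ⟨_, _, _, _, _, _, _, _, rfl⟩
  have hV : (Atom.pdep i i x y x y).vars = (Atom.dep i x y).vars := by
    ext
    simp only [Atom.vars, Set.mem_union]
    tauto
  rw [hV] at h2 h3
  exact ⟨φ, h1, h2, fun A _ _ X hX hne => h3 A X hX (by simpa [Atom.sorts] using hne)⟩

theorem atomDefinable_dep_of_ind (hC : indAtoms ⊆ C) {α : Atom} (hα : α ∈ depAtoms) :
    AtomDefinable.{u, v, w} L b C α := by
  obtain ⟨i, m, n, x, y, rfl⟩ := hα
  refine .of_equiv (β := .ind i x y y) (hC ⟨_, _, _, _, _, _, _, rfl⟩) ?_ fun A X => ?_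
  · intro z
    simp only [Atom.vars, Set.mem_union]
    tauto
  · constructor
    · exact fun h s hs s' hs' hx => ⟨s, hs, rfl, rfl, h s hs s' hs' hx⟩
    · intro h s hs s' hs' hx
      obtain ⟨s'', -, -, h1, h2⟩ := h s hs s' hs' hx
      exact h1.symm.trans h2

end PolyTeam

/-! ### The cycle of translations -/

theorem mainTheorem6 (L : FirstOrder.Language.{u, v}) [L.IsRelational] :
    EquiExpressive nontrivialOrNonemptyTeams.{w} (PFO L pdepAtoms) (PFO L pexcAtoms) ∧
    (EquiExpressive nonemptyTeams.{w} (PFO L pindAtoms) (PFO L (pexcAtoms ∪ incAtoms)) ∧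
     EquiExpressive nonemptyTeams.{w} (PFO L pindAtoms) (PFO L (pincAtoms ∪ excAtoms)) ∧
     EquiExpressive nonemptyTeams.{w} (PFO L pindAtoms) (PFO L (pdepAtoms ∪ incAtoms)) ∧
     EquiExpressive nonemptyTeams.{w} (PFO L pindAtoms) (PFO L (pincAtoms ∪ depAtoms)) ∧
     EquiExpressive nonemptyTeams.{w} (PFO L pindAtoms) (PFO L (pdepAtoms ∪ indAtoms)) ∧
     EquiExpressive nonemptyTeams.{w} (PFO L pindAtoms) (PFO L (pexcAtoms ∪ indAtoms)) ∧
     EquiExpressive nonemptyTeams.{w} (PFO L pindAtoms) (PFO L (pincAtoms ∪ indAtoms))) := by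
  have lift : ∀ {C C' : Set Atom}, (∀ α ∈ C, AtomDefinable.{u, v, w} L True C' α) →
      ExpressibleIn nonemptyTeams.{w} (PFO L C) (PFO L C') := fun h =>
    expressibleIn_nonemptyTeams fun α hα => (h α hα).guardDefinable
  have left : ∀ {C C' : Set Atom}, C ⊆ C ∪ C' := @fun _ _ => Set.subset_union_left
  have right : ∀ {C C' : Set Atom}, C' ⊆ C ∪ C' := @fun _ _ => Set.subset_union_right
  have pexc_pdep : ∀ {b : Prop} {C : Set Atom}, pdepAtoms ⊆ C → ∀ α ∈ pexcAtoms,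
      AtomDefinable.{u, v, w} L b C α := by
    rintro b C hC _ ⟨i, j, n, x, y, rfl⟩
    exact atomDefinable_pexc i j x y hC
  have pdep_pexc : ∀ {b : Prop} {C : Set Atom}, pexcAtoms ⊆ C → ∀ α ∈ pdepAtoms,
      AtomDefinable.{u, v, w} L b C α := by
    rintro b C hC _ ⟨i, j, m, n, x, a, y, c, rfl⟩
    exact atomDefinable_pdep i j x a y c hC
  have inc_ind : ∀ {C : Set Atom}, indAtoms ⊆ C → ∀ α ∈ incAtoms,
      AtomDefinable.{u, v, w} L True C α := by
    rintro C hC _ ⟨i, n, x, y, rfl⟩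
    exact atomDefinable_inc i x y hC
  -- upper bounds
  have up_pdep_pinc : ExpressibleIn nonemptyTeams.{w} (PFO L (pdepAtoms ∪ pincAtoms))
      (PFO L pindAtoms) := lift fun α hα => hα.elim (atomDefinable_pdep_of_pind subset_rfl)
    (atomDefinable_pinc_of_pind subset_rfl)
  have up_pdep_inc : ExpressibleIn nonemptyTeams.{w} (PFO L (pdepAtoms ∪ incAtoms))
      (PFO L pindAtoms) := lift fun α hα => hα.elim (atomDefinable_pdep_of_pind subset_rfl)
    (atomDefinable_inc_of_pind subset_rfl)
  have up_pdep_ind : ExpressibleIn nonemptyTeams.{w} (PFO L (pdepAtoms ∪ indAtoms))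
      (PFO L pindAtoms) := lift fun α hα => hα.elim (atomDefinable_pdep_of_pind subset_rfl)
    (atomDefinable_ind_of_pind subset_rfl)
  have up_pinc_dep : ExpressibleIn nonemptyTeams.{w} (PFO L (pincAtoms ∪ depAtoms))
      (PFO L pindAtoms) := lift fun α hα => hα.elim (atomDefinable_pinc_of_pind subset_rfl)
    (atomDefinable_dep_of_pind subset_rfl)
  have up_pinc_ind : ExpressibleIn nonemptyTeams.{w} (PFO L (pincAtoms ∪ indAtoms))
      (PFO L pindAtoms) := lift fun α hα => hα.elim (atomDefinable_pinc_of_pind subset_rfl)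
    (atomDefinable_ind_of_pind subset_rfl)
  have pexc_inc_pdep_inc : ExpressibleIn nonemptyTeams.{w} (PFO L (pexcAtoms ∪ incAtoms))
      (PFO L (pdepAtoms ∪ incAtoms)) :=
    lift fun α hα => hα.elim (pexc_pdep left α) fun h => .of_mem (right h)
  have pexc_ind_pdep_ind : ExpressibleIn nonemptyTeams.{w} (PFO L (pexcAtoms ∪ indAtoms))
      (PFO L (pdepAtoms ∪ indAtoms)) :=
    lift fun α hα => hα.elim (pexc_pdep left α) fun h => .of_mem (right h)
  have pinc_exc_pdep_pinc : ExpressibleIn nonemptyTeams.{w} (PFO L (pincAtoms ∪ excAtoms))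
      (PFO L (pdepAtoms ∪ pincAtoms)) := lift fun α hα => hα.elim (fun h => .of_mem (right h)) (by
    rintro ⟨i, n, x, y, rfl⟩
    obtain ⟨φ, h1, h2, h3⟩ := atomDefinable_pexc.{u, v, w} (L := L) (b := True) i i x y
      (left (C := pdepAtoms) (C' := pincAtoms))
    exact ⟨φ, h1, h2, fun A _ _ X hX hne => h3 A X hX (by simpa [Atom.sorts] using hne)⟩)
  -- lower bounds
  have pind_pinc_pexc : ExpressibleIn nonemptyTeams.{w} (PFO L pindAtoms)
      (PFO L (pincAtoms ∪ pexcAtoms)) := lift (by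
    rintro _ ⟨i, j, k, m, n, l, x, a, u, y, v, c, w, rfl⟩
    exact atomDefinable_pind i j k x a u y v c w subset_rfl)
  -- The composition is at the level of logics, so that poly-inclusion can be treated by its guarded
  -- definition.
  have pind_pexc_inc : ExpressibleIn nonemptyTeams.{w} (PFO L pindAtoms)
      (PFO L (pexcAtoms ∪ incAtoms)) := pind_pinc_pexc.trans (expressibleIn_nonemptyTeams (by
    rintro _ (⟨i, j, n, x, y, rfl⟩ | h)
    · exact guardDefinable_pinc i j x y subset_rfl
    · exact (AtomDefinable.of_mem (left h)).guardDefinable))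
  have pind_pinc_dep : ExpressibleIn nonemptyTeams.{w} (PFO L pindAtoms)
      (PFO L (pincAtoms ∪ depAtoms)) := pind_pinc_pexc.trans (lift (by
    rintro _ (h | ⟨i, j, n, x, y, rfl⟩)
    · exact .of_mem (left h)
    · exact atomDefinable_pexc_of_pinc_dep i j x y subset_rfl))
  -- The goals left open exchange ordinary atoms: exclusion defines dependence, and independence
  -- defines inclusion (twice) and dependence.
  refine ⟨⟨expressibleIn_nontrivialOrNonemptyTeams (pdep_pexc subset_rfl),
    expressibleIn_nontrivialOrNonemptyTeams (pexc_pdep subset_rfl)⟩,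
    ⟨pind_pexc_inc, pexc_inc_pdep_inc.trans up_pdep_inc⟩,
    ⟨pind_pinc_dep.trans (lift ?_), pinc_exc_pdep_pinc.trans up_pdep_pinc⟩,
    ⟨pind_pexc_inc.trans pexc_inc_pdep_inc, up_pdep_inc⟩,
    ⟨pind_pinc_dep, up_pinc_dep⟩,
    ⟨(pind_pexc_inc.trans (lift ?_)).trans pexc_ind_pdep_ind, up_pdep_ind⟩,
    ⟨pind_pexc_inc.trans (lift ?_), pexc_ind_pdep_ind.trans up_pdep_ind⟩,
    ⟨pind_pinc_dep.trans (lift ?_), up_pinc_ind⟩⟩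
  · rintro _ (h | ⟨i, m, n, x, y, rfl⟩)
    · exact .of_mem (left h)
    · exact atomDefinable_dep i x y right
  · exact fun α hα => hα.elim (fun h => .of_mem (left h)) (inc_ind right α)
  · exact fun α hα => hα.elim (fun h => .of_mem (left h)) (inc_ind right α)
  · exact fun α hα => hα.elim (fun h => .of_mem (left h)) (atomDefinable_dep_of_ind right)
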